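/- **Theorem 2.6.** Let $m$ be the normalized arclength measure on the unit circle $\mathbb T$, and let $\sigma$ be an infinitely supported probability measure on $\mathbb T$ with Lebesgue decomposition $d\sigma=\sigma'\,dm+d\sigma_s$. Let $\Phi_n$ and $\phi_n=\Phi_n/\|\Phi_n\|_{2,\sigma}$ be the monic orthogonal and the orthonormal polynomials of $\sigma$, let $\phi_n^*(z)=z^n\overline{\phi_n(z)}$ for $z\in\mathbb T$, and let $\gamma_n=-\overline{\Phi_{n+1}(0)}$ be the Verblunsky coefficients, so that $\Phi_{n+1}(z)=z\Phi_n(z)-\bar\gamma_n\Phi_n^*(z)$. Assume $\sum_{n\ge 0}|\gamma_n|^2<\infty$ and $$\lim_{n\to\infty}\log n\sum_{s=n}^{2n}|\gamma_s|^2=0 .$$ Let $$D(z)=\exp\Bigl(\tfrac12\int_{\mathbb T}\frac{w+z}{w-z}\log\sigma'(w)\,dm(w)\Bigr),\quad |z|<1,$$ be the Szegő function, with its nontangential boundary values on $\mathbb T$ (which exist $m$-a.e.), let $E_{\rm ac}\subset\mathbb T$ be a Borel set with $m(\mathbb T\setminus E_{\rm ac})=0$ and $\sigma_s(E_{\rm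 ac})=0$, and put $\Pi=D^{-1}\mathbb 1_{E_{\rm ac}}$. Let $h:\mathbb R\to[0,\infty)$ be a $C^\infty$ function supported in $[-2\pi,2\pi]$. For integers $\kappa\ge 1$ and $0\le j<\kappa$ put $z_j=e^{2\pi ij/\kappa}$, $\omega_0(e^{ix})=h(\kappa x)$ for $-\pi<x\le\pi$, and $\omega_j(z)=\omega_0(z/z_j)$, and assume that $\sum_{j=0}^{\kappa-1}\omega_j=1$ on $\mathbb T$ for all sufficiently large $\kappa$. Let $f_{j,\kappa}$ be complex numbers with $|f_{j,\kappa}|\le M$ for all $\kappa\ge1$ and $0\le j<\kappa$, where $M$ does not depend on $j$ or $\kappa$. Then the functions $\sum_{j=0}^{\kappa-1}f_{j,\kappa}\,\phi^*_{\kappa^2+\kappa j}\,\omega_j-\Pi\sum_{j=0}^{\kappa-1}f_{j,\kappa}\,\omega_j$ belong to $L^2_\sigma(\mathbb T)$ and $$\Bigl\|\sum_{j=0}^{\kappa-1}f_{j,\kappa}\,\phi^*_{\kappa^2+\kappa j}\,\omega_j-\Pi\sum_{j=0}^{\kappa-1}f_{j,\kappa}\,\omega_j\Bigr\|_{2,\sigma}\to0,\qquad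 \kappa\to\infty .$$ -/

import Mathlib

open MeasureTheory Filter Topology Polynomial
open scoped ContDiff ComplexConjugate

noncomputable section

namespace OPUC

instance : MeasurableSpace Circle := borel Circle

instance : BorelSpace Circle := ⟨rfl⟩

/-- Normalized arclength measure `m` on the unit circle: the image of `dx / (2π)` on `(-π, π]`
under `x ↦ e^{ix}`. -/
def arcMeasure : Measure Circle :=
  Measure.map Circle.exp
    ((ENNReal.ofReal (2 * Real.pi))⁻¹ • volume.restrict (Set.Ioc (-Real.pi) Real.pi))

/-- The inner product `⟨p, q⟩_σ = ∫ p(z) conj(q(z)) dσ(z)` of two polynomials on the circle. -/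
def polyInner (σ : Measure Circle) (p q : ℂ[X]) : ℂ :=
  ∫ z : Circle, p.eval (z : ℂ) * conj (q.eval (z : ℂ)) ∂σ

/-- The monic orthogonal polynomials `Φ_n` of `σ`, by Gram-Schmidt orthogonalization of the
monomials `1, z, z ^ 2, …` in `L²(σ)`. -/
def monicOP (σ : Measure Circle) (n : ℕ) : ℂ[X] :=
  X ^ n - ∑ k : Fin n,
    C (polyInner σ (X ^ n) (monicOP σ k) / polyInner σ (monicOP σ k) (monicOP σ k)) * monicOP σ k
termination_by n
decreasing_by all_goals exact k.2

/-- The orthonormal polynomials `φ_n = Φ_n / ‖Φ_n‖_{2,σ}`. -/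
def orthonormalOP (σ : Measure Circle) (n : ℕ) : ℂ[X] :=
  C (((Real.sqrt (∫ z : Circle, ‖(monicOP σ n).eval (z : ℂ)‖ ^ 2 ∂σ))⁻¹ : ℝ) : ℂ) * monicOP σ n

/-- The reversed orthonormal polynomial `φ_n^*(z) = z ^ n conj(φ_n(z))` on the unit circle. -/
def revOP (σ : Measure Circle) (n : ℕ) (z : Circle) : ℂ :=
  (z : ℂ) ^ n * conj ((orthonormalOP σ n).eval (z : ℂ))

/-- The Verblunsky coefficients `γ_n = - conj(Φ_{n+1}(0))`; these are the coefficients in the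
recurrence `Φ_{n+1}(z) = z Φ_n(z) - conj(γ_n) Φ_n^*(z)`, since `Φ_n^*(0) = 1`. -/
def verblunsky (σ : Measure Circle) (n : ℕ) : ℂ :=
  - conj ((monicOP σ (n + 1)).eval 0)

/-- The density `σ'` of the absolutely continuous part of `σ` with respect to `m`. -/
def density (σ : Measure Circle) (w : Circle) : ℝ :=
  (σ.rnDeriv arcMeasure w).toReal

/-- The Szegő function `D(z) = exp (½ ∫ (w + z) / (w - z) log σ'(w) dm(w))` in the unit disk. -/
def szegoD (σ : Measure Circle) (z : ℂ) : ℂ :=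
  Complex.exp (1 / 2 * ∫ w : Circle,
    ((w : ℂ) + z) / ((w : ℂ) - z) * ((Real.log (density σ w) : ℝ) : ℂ) ∂arcMeasure)

/-- The boundary values of the Szegő function, as radial limits. -/
def szegoBoundary (σ : Measure Circle) (z : Circle) : ℂ :=
  limUnder (𝓝[<] (1 : ℝ)) fun r : ℝ => szegoD σ ((r : ℂ) * (z : ℂ))

/-- `E` is a Borel set of full Lebesgue measure that is null for the singular part of `σ`, i.e. the
complement of a (measure-theoretic) support of the singular part.  Two such sets differ by
a `σ`-null set. -/
def IsAcSet (σ : Measure Circle) (E : Set Circle) : Prop :=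
  MeasurableSet E ∧ arcMeasure Eᶜ = 0 ∧ σ.singularPart arcMeasure E = 0

/-- The function `Π = D⁻¹ 𝟙_E`. -/
def szegoPi (σ : Measure Circle) (E : Set Circle) : Circle → ℂ :=
  E.indicator fun z => (szegoBoundary σ z)⁻¹

/-- The bumps `ω_j(z) = ω_0(z / z_j)`, where `z_j = exp (2 π i j / κ)` and `ω_0(e^{ix}) = h(κ x)`
for `-π < x ≤ π`. -/
def bump (h : ℝ → ℝ) (κ j : ℕ) (z : Circle) : ℝ :=
  h ((κ : ℝ) * Complex.arg ((z / Circle.exp (2 * Real.pi * j / κ) : Circle) : ℂ))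

/-- `h` is a smooth nonnegative function supported in `[-2π, 2π]` whose bumps `ω_0, …, ω_{κ-1}`
form a partition of unity on the circle, for all large `κ`. -/
structure IsProfile (h : ℝ → ℝ) : Prop where
  smooth : ContDiff ℝ ∞ h
  nonneg : ∀ x, 0 ≤ h x
  support_subset : Function.support h ⊆ Set.Icc (-(2 * Real.pi)) (2 * Real.pi)
  sum_eq_one : ∀ᶠ κ : ℕ in atTop, ∀ z : Circle, ∑ j ∈ Finset.range κ, bump h κ j z = 1

/-- The sum `Σ_κ = ∑_{j<κ} f_{j,κ} φ^*_{κ²+κj} ω_j`. -/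
def packetSum (σ : Measure Circle) (h : ℝ → ℝ) (f : ℕ → ℕ → ℂ) (κ : ℕ) (z : Circle) : ℂ :=
  ∑ j ∈ Finset.range κ, f j κ * revOP σ (κ ^ 2 + κ * j) z * (bump h κ j z : ℂ)

end OPUC

end

/-!
The proof has three layers.

*Szegő asymptotics.* With `e_n = ‖Φ_n‖²` the recurrence gives `e_{n+1} = (1 - |γ_n|²) e_n`, so
square summability of the Verblunsky coefficients means that `e_n` decreases to a positive limit
`e`. As `Φ_n^*` minimizes the norm among polynomials with value `1` at the origin, this yields
Szegő's variational inequality `e exp (∫ t dm) ≤ ∫ exp t dσ` for bounded `t` and hence, testing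
with truncations of `-log σ'`, that `log σ'` is integrable with `log e ≤ ∫ log σ' dm`
(`szego_entropy`). Therefore the Szegő function `D` is an outer function in `H²`; by Fatou's
theorem its radial limits exist almost everywhere and have modulus `√σ'` (`outer_boundary`).
Expanding the square, `‖φ_n^* - Π‖² = 2 - 2 D(0) / √e_n`, where `D(0) ≥ √e`, so the distance tends
to zero (`memLp_szegoPi_and_integral_le`).

*Localized comparison of polynomials of different degree.* Put `N = 3κ²` and `N_j = κ² + κj`.
The heart of the matter is that `∑_j ∫ ω_j |Φ_{N_j}^* - Φ_N^*|² dσ` tends to zero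
(`tendsto_sum_integral_bump`). Expanding the square leaves two terms. The diagonal term
`∑_j ∫ ω_j |Φ_{N_j}|² dσ` is `κ⁻¹ ∑_j e_{N_j}` up to frequencies `d ≠ 0` of `|Φ_{N_j}|² σ`; these
are at most `(e_{N_j - |d|} - e_{N_j + |d|}) / 2`, and their sum over `j` telescopes
(`norm_sum_inner_Phi_bump_le`). The cross term is turned by summation by parts into
`∑_s γ_s ⟪Φ_N^*, z W_s Φ_s⟫`, where `W_s` is a partial sum of bumps. By orthogonality the
frequencies `0 ≤ d < κ²` of `W_s` do not contribute; for the others Bessel's inequality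
controls the inner products of a given frequency for all `s` at once, and
`|Ŵ_s(d)| ≤ C min (1 / |d|, κ / d²)` (`exists_norm_coeffC_le`) makes the sum over `d`
cost a factor `log κ` (`norm_sum_inner_PhiS_bump_le`). This is the factor that the logarithmic
hypothesis absorbs (`tendsto_energy`).

The bound for `Ŵ_s` uses that the bumps form a partition of unity: the Fourier transform of the
profile then vanishes at the nonzero integers, which are the points where the geometric sum over the
centres of the bumps has no cancellation.

*Conclusion.* By Jensen's inequality for the weights `ω_j`, the square of the norm in question is at
most `M² ∑_j ∫ ω_j |φ_{N_j}^* - Π|² dσ`, and `φ_{N_j}^*` is compared with `φ_N^*`, then with `Π`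
(`integral_norm_packetSum_sub_sq_le`).
-/

noncomputable section

namespace OPUC

/-! ### Arclength measure and the characters of the circle -/

instance : Fact (0 < 2 * Real.pi) := ⟨Real.two_pi_pos⟩

theorem arcMeasure_eq_map_haarAddCircle :
    arcMeasure = Measure.map AddCircle.homeomorphCircle'
      (AddCircle.haarAddCircle : Measure (AddCircle (2 * Real.pi))) := by
  have h2 := AddCircle.measurePreserving_mk (2 * Real.pi) (-Real.pi)
  have e : -Real.pi + 2 * Real.pi = Real.pi := by ring
  rw [e] at h2
  have h3 : (AddCircle.haarAddCircle : Measure (AddCircle (2 * Real.pi))) =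
      (ENNReal.ofReal (2 * Real.pi))⁻¹ • volume := by
    rw [AddCircle.volume_eq_smul_haarAddCircle, smul_smul, ENNReal.inv_mul_cancel, one_smul]
    · simp [Real.pi_pos]
    · exact ENNReal.ofReal_ne_top
  rw [h3, ← h2.map_eq, Measure.map_smul, arcMeasure, Measure.map_smul, Measure.map_map]
  · rfl
  · exact AddCircle.homeomorphCircle'.continuous.measurable
  · exact h2.measurable

instance : IsProbabilityMeasure arcMeasure := by
  rw [arcMeasure_eq_map_haarAddCircle]
  exact Measure.isProbabilityMeasure_map
    AddCircle.homeomorphCircle'.continuous.measurable.aemeasurable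

theorem integral_arcMeasure_eq_haar {F : Type*} [NormedAddCommGroup F] [NormedSpace ℝ F]
    (f : Circle → F) :
    ∫ z, f z ∂arcMeasure = ∫ t : AddCircle (2 * Real.pi), f (AddCircle.homeomorphCircle' t)
      ∂AddCircle.haarAddCircle := by
  rw [arcMeasure_eq_map_haarAddCircle]
  exact AddCircle.homeomorphCircle'.measurableEmbedding.integral_map _

theorem integral_arcMeasure {F : Type*} [NormedAddCommGroup F] [NormedSpace ℝ F]
    (f : Circle → F) (a : ℝ) :
    ∫ z, f z ∂arcMeasure =
      (2 * Real.pi)⁻¹ • ∫ x in a..a + 2 * Real.pi, f (Circle.exp x) := by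
  rw [integral_arcMeasure_eq_haar, AddCircle.integral_haarAddCircle,
    ← AddCircle.intervalIntegral_preimage (2 * Real.pi) a]
  rfl

theorem intervalIntegrable_comp_exp {F : Type*} [NormedAddCommGroup F] {f : Circle → F}
    (hf : Integrable f arcMeasure) (a b : ℝ) :
    IntervalIntegrable (fun x : ℝ => f (Circle.exp x)) volume a b := by
  have hp : Function.Periodic (fun x : ℝ => f (Circle.exp x)) (2 * Real.pi) := fun x => by
    simp
  refine hp.intervalIntegrable (t := -Real.pi) Real.two_pi_pos.ne' ?_ a b
  have e : -Real.pi + 2 * Real.pi = Real.pi := by ring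
  rw [e, intervalIntegrable_iff_integrableOn_Ioc_of_le (by linarith [Real.pi_pos])]
  unfold arcMeasure at hf
  have := (integrable_map_measure hf.1 Circle.exp.continuous.measurable.aemeasurable).1 hf
  refine (integrable_smul_measure ?_ ?_).1 this
  · simpa using ENNReal.mul_ne_top ENNReal.ofNat_ne_top ENNReal.ofReal_ne_top
  · simp [Real.pi_pos]

/-- A property holding at almost every angle holds at almost every point of the circle. -/
theorem ae_arcMeasure_of_ae {p : Circle → Prop} (h : ∀ᵐ x : ℝ, p (Circle.exp x)) :
    ∀ᵐ z ∂arcMeasure, p z := by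
  obtain ⟨t, ht, htm, ht0⟩ := exists_measurable_superset_of_null (ae_iff.1 h)
  have hinj : Set.InjOn Circle.exp (t ∩ Set.Ioc (-Real.pi) Real.pi) :=
    (Circle.exp_injOn_Ioc (a := -Real.pi) (b := Real.pi) (by linarith)).mono
      Set.inter_subset_right
  have hm : MeasurableSet (Circle.exp '' (t ∩ Set.Ioc (-Real.pi) Real.pi)) :=
    (htm.inter measurableSet_Ioc).image_of_continuousOn_injOn Circle.exp.continuous.continuousOn
      hinj
  rw [ae_iff]
  refine measure_mono_null (t := Circle.exp '' (t ∩ Set.Ioc (-Real.pi) Real.pi)) ?_ ?_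
  · intro z hz
    refine ⟨Complex.arg z, ⟨ht ?_, Complex.neg_pi_lt_arg _, Complex.arg_le_pi _⟩,
      Circle.exp_arg z⟩
    simpa [Circle.exp_arg] using hz
  · rw [arcMeasure, Measure.map_apply Circle.exp.continuous.measurable hm]
    simp only [Measure.smul_apply, smul_eq_mul, mul_eq_zero]
    right
    rw [Measure.restrict_apply (Circle.exp.continuous.measurable hm)]
    refine measure_mono_null ?_ ht0
    rintro x ⟨⟨y, ⟨hy, hy'⟩, hxy⟩, hx⟩
    rwa [← Circle.exp_injOn_Ioc (a := -Real.pi) (b := Real.pi) (by linarith) hy' hx hxy]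

/-- The character `z ↦ z ^ k` of the circle. -/
def zeta (k : ℤ) : C(Circle, ℂ) where
  toFun z := (z : ℂ) ^ k
  continuous_toFun := by
    have : Continuous fun z : Circle => ((z ^ k : Circle) : ℂ) :=
      continuous_subtype_val.comp (continuous_zpow k)
    simpa using this

theorem zeta_apply (k : ℤ) (z : Circle) : zeta k z = (z : ℂ) ^ k := rfl

@[simp] theorem zeta_zero : zeta 0 = 1 := by ext z; simp [zeta_apply]

theorem zeta_mul (k l : ℤ) : zeta k * zeta l = zeta (k + l) := by
  ext z
  simp [zeta_apply, zpow_add₀]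

theorem star_zeta (k : ℤ) : star (zeta k) = zeta (-k) := by
  ext z
  simp only [ContinuousMap.star_apply, zeta_apply, zpow_neg, RCLike.star_def]
  rw [map_zpow₀, ← Circle.coe_inv_eq_conj, Circle.coe_inv, inv_zpow]

@[simp] theorem norm_zeta_apply (k : ℤ) (z : Circle) : ‖zeta k z‖ = 1 := by
  rw [zeta_apply, norm_zpow, Circle.norm_coe, one_zpow]

theorem norm_zeta (k : ℤ) : ‖zeta k‖ = 1 := by
  apply le_antisymm
  · exact (ContinuousMap.norm_le _ zero_le_one).2 fun z => (norm_zeta_apply k z).le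
  · calc (1 : ℝ) = ‖zeta k 1‖ := by simp
      _ ≤ _ := ContinuousMap.norm_coe_le_norm _ _

theorem conj_zeta_apply (k : ℤ) (z : Circle) : conj (zeta k z) = zeta (-k) z := by
  rw [← star_zeta]; rfl

theorem zeta_homeomorphCircle' (k : ℤ) (t : AddCircle (2 * Real.pi)) :
    zeta k (AddCircle.homeomorphCircle' t) = fourier k t := by
  induction t using QuotientAddGroup.induction_on with
  | H x =>
    rw [fourier_coe_apply, zeta_apply]
    have : AddCircle.homeomorphCircle' (x : AddCircle (2 * Real.pi)) = Circle.exp x := rfl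
    erw [this]
    rw [Circle.coe_exp, ← Complex.exp_int_mul]
    congr 1
    have : (Real.pi : ℂ) ≠ 0 := by exact_mod_cast Real.pi_ne_zero
    push_cast
    field_simp

theorem integral_zeta (k : ℤ) : ∫ z, zeta k z ∂arcMeasure = if k = 0 then 1 else 0 := by
  rw [integral_arcMeasure_eq_haar]
  simp_rw [zeta_homeomorphCircle']
  have h := fourierCoeff_fourier (T := 2 * Real.pi) k
  have h0 := congrFun h 0
  rw [fourierCoeff] at h0
  simp only [neg_zero, fourier_zero, one_smul] at h0
  rw [h0, Pi.single_apply]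
  simp [eq_comm]

theorem integrable_continuousMap {F : Type*} [NormedAddCommGroup F] {ν : Measure Circle}
    [IsFiniteMeasure ν] (f : C(Circle, F)) : Integrable (fun z => f z) ν := by
  refine Integrable.of_bound (C := ‖f‖) ?_ (ae_of_all _ fun z => f.norm_coe_le_norm z)
  exact f.continuous.aestronglyMeasurable_of_compactSpace

/-- The Fourier coefficient of a function on the circle. -/
def coeffC (f : Circle → ℂ) (k : ℤ) : ℂ := ∫ z, zeta (-k) z * f z ∂arcMeasure

theorem fourierCoeff_comp_homeomorphCircle' (f : Circle → ℂ) (k : ℤ) :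
    fourierCoeff (fun t : AddCircle (2 * Real.pi) => f (AddCircle.homeomorphCircle' t)) k =
      coeffC f k := by
  rw [coeffC, integral_arcMeasure_eq_haar, fourierCoeff]
  simp_rw [zeta_homeomorphCircle', smul_eq_mul]

/-- A continuous function with absolutely summable Fourier coefficients is the sum of its Fourier
series, uniformly. -/
theorem hasSum_coeffC (f : C(Circle, ℂ)) (h : Summable fun k => ‖coeffC f k‖) :
    HasSum (fun k : ℤ => coeffC f k • zeta k) f := by
  have hs : Summable fun k : ℤ => coeffC f k • zeta k := by
    refine Summable.of_norm ?_
    simpa [norm_smul, norm_zeta] using h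
  let F : C(AddCircle (2 * Real.pi), ℂ) := f.comp
    ⟨AddCircle.homeomorphCircle', AddCircle.homeomorphCircle'.continuous⟩
  have hF : ∀ k, fourierCoeff F k = coeffC f k := fun k =>
    fourierCoeff_comp_homeomorphCircle' f k
  have key : ∑' k : ℤ, coeffC f k • zeta k = f := by
    ext z
    obtain ⟨t, rfl⟩ := AddCircle.homeomorphCircle'.surjective z
    have h1 := has_pointwise_sum_fourier_series_of_summable (f := F)
      (by simp_rw [funext hF]; exact h.of_norm) t
    have h2 := (ContinuousMap.evalCLM ℂ (AddCircle.homeomorphCircle' t)).hasSum hs.hasSum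
    refine h2.unique ?_
    simp only [hF] at h1
    convert h1 using 2 with k
    · simp [zeta_homeomorphCircle']
    · rfl
  have := hs.hasSum
  rwa [key] at this

/-- Trigonometric polynomials are dense in the continuous functions on the circle. -/
theorem dense_span_zeta : (Submodule.span ℂ (Set.range zeta)).topologicalClosure = ⊤ := by
  have h1 := span_fourier_closure_eq_top (T := 2 * Real.pi)
  rw [eq_top_iff]
  rintro f -
  rw [← SetLike.mem_coe, Submodule.topologicalClosure_coe, Metric.mem_closure_iff]
  intro ε hε
  let F : C(AddCircle (2 * Real.pi), ℂ) := f.comp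
    ⟨AddCircle.homeomorphCircle', AddCircle.homeomorphCircle'.continuous⟩
  have hF : F ∈ (Submodule.span ℂ (Set.range <| @fourier (2 * Real.pi))).topologicalClosure := by
    rw [h1]; trivial
  rw [← SetLike.mem_coe, Submodule.topologicalClosure_coe, Metric.mem_closure_iff] at hF
  obtain ⟨G, hG, hFG⟩ := hF ε hε
  let L : C(AddCircle (2 * Real.pi), ℂ) →ₗ[ℂ] C(Circle, ℂ) :=
    { toFun := fun g => g.comp ⟨AddCircle.homeomorphCircle'.symm,
        AddCircle.homeomorphCircle'.symm.continuous⟩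
      map_add' := fun _ _ => rfl
      map_smul' := fun _ _ => rfl }
  refine ⟨L G, ?_, ?_⟩
  · have : L G ∈ (Submodule.span ℂ (Set.range <| @fourier (2 * Real.pi))).map L :=
      Submodule.mem_map_of_mem hG
    rw [Submodule.map_span] at this
    refine Submodule.span_mono ?_ this
    rintro _ ⟨_, ⟨k, rfl⟩, rfl⟩
    refine ⟨k, ?_⟩
    ext z
    have := zeta_homeomorphCircle' k (AddCircle.homeomorphCircle'.symm z)
    rw [Homeomorph.apply_symm_apply] at this
    exact this
  · refine (ContinuousMap.dist_lt_iff hε).2 fun z => ?_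
    have := (ContinuousMap.dist_lt_iff hε).1 hFG (AddCircle.homeomorphCircle'.symm z)
    have e : F (AddCircle.homeomorphCircle'.symm z) = f z := by
      change f (AddCircle.homeomorphCircle' (AddCircle.homeomorphCircle'.symm z)) = f z
      rw [Homeomorph.apply_symm_apply]
    rw [e] at this
    exact this

/-! ### Continuous functions inside `L²(σ)` -/

/-- The class in `L²(σ)` of a continuous function on the circle. -/
def emb (σ : Measure Circle) [IsFiniteMeasure σ] : C(Circle, ℂ) →L[ℂ] Lp ℂ 2 σ :=
  ContinuousMap.toLp 2 σ ℂ

section Embedding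

variable {σ : Measure Circle} [IsFiniteMeasure σ]

theorem inner_emb (f g : C(Circle, ℂ)) :
    inner ℂ (emb σ f) (emb σ g) = ∫ z, g z * conj (f z) ∂σ :=
  ContinuousMap.inner_toLp σ f g

theorem norm_emb_sq (f : C(Circle, ℂ)) : ‖emb σ f‖ ^ 2 = ∫ z, ‖f z‖ ^ 2 ∂σ := by
  have h := inner_self_eq_norm_sq_to_K (𝕜 := ℂ) (emb σ f)
  rw [inner_emb] at h
  have h2 : ∀ z, f z * conj (f z) = ((‖f z‖ ^ 2 : ℝ) : ℂ) := fun z => by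
    rw [Complex.mul_conj, Complex.normSq_eq_norm_sq]
  simp_rw [h2] at h
  rw [integral_complex_ofReal] at h
  exact Complex.ofReal_injective (by simpa using h.symm)

theorem inner_emb_mul_left (f g w : C(Circle, ℂ)) :
    inner ℂ (emb σ (w * f)) (emb σ g) = inner ℂ (emb σ f) (emb σ (star w * g)) := by
  simp only [inner_emb]
  congr 1 with z
  simp
  ring

theorem inner_zeta_mul (k : ℤ) (f g : C(Circle, ℂ)) :
    inner ℂ (emb σ (zeta k * f)) (emb σ (zeta k * g)) = inner ℂ (emb σ f) (emb σ g) := by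
  rw [inner_emb_mul_left, star_zeta, ← mul_assoc, zeta_mul]
  simp

theorem norm_zeta_mul (k : ℤ) (f : C(Circle, ℂ)) : ‖emb σ (zeta k * f)‖ = ‖emb σ f‖ := by
  have h : ‖emb σ (zeta k * f)‖ ^ 2 = ‖emb σ f‖ ^ 2 := by
    simp [norm_emb_sq]
  exact (pow_left_inj₀ (norm_nonneg _) (norm_nonneg _) two_ne_zero).1 h

theorem inner_star (f g : C(Circle, ℂ)) :
    inner ℂ (emb σ (star f)) (emb σ (star g)) = inner ℂ (emb σ g) (emb σ f) := by
  simp only [inner_emb]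
  congr 1 with z
  simp
  ring

theorem norm_star_emb (f : C(Circle, ℂ)) : ‖emb σ (star f)‖ = ‖emb σ f‖ := by
  have h : ‖emb σ (star f)‖ ^ 2 = ‖emb σ f‖ ^ 2 := by
    simp [norm_emb_sq]
  exact (pow_left_inj₀ (norm_nonneg _) (norm_nonneg _) two_ne_zero).1 h

end Embedding

/-! ### Trigonometric polynomials with prescribed frequencies -/

/-- The trigonometric polynomials with frequencies in `[a, b]`. -/
def trigSpan (a b : ℤ) : Submodule ℂ C(Circle, ℂ) := Submodule.span ℂ (zeta '' Set.Icc a b)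

theorem zeta_mem_trigSpan {a b k : ℤ} (h1 : a ≤ k) (h2 : k ≤ b) : zeta k ∈ trigSpan a b :=
  Submodule.subset_span ⟨k, ⟨h1, h2⟩, rfl⟩

theorem trigSpan_mono {a b a' b' : ℤ} (h1 : a' ≤ a) (h2 : b ≤ b') :
    trigSpan a b ≤ trigSpan a' b' :=
  Submodule.span_mono (Set.image_mono (Set.Icc_subset_Icc h1 h2))

theorem zeta_mul_mem_trigSpan {a b : ℤ} {f : C(Circle, ℂ)} (d : ℤ) (hf : f ∈ trigSpan a b) :
    zeta d * f ∈ trigSpan (a + d) (b + d) := by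
  induction hf using Submodule.span_induction with
  | mem x hx =>
    obtain ⟨k, ⟨h1, h2⟩, rfl⟩ := hx
    rw [zeta_mul]
    exact zeta_mem_trigSpan (by lia) (by lia)
  | zero => simp
  | add x y _ _ hx hy => rw [mul_add]; exact add_mem hx hy
  | smul c x _ hx => rw [mul_smul_comm]; exact Submodule.smul_mem _ _ hx

theorem star_mem_trigSpan {a b : ℤ} {f : C(Circle, ℂ)} (hf : f ∈ trigSpan a b) :
    star f ∈ trigSpan (-b) (-a) := by
  induction hf using Submodule.span_induction with
  | mem x hx =>
    obtain ⟨k, ⟨h1, h2⟩, rfl⟩ := hx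
    rw [star_zeta]
    exact zeta_mem_trigSpan (by lia) (by lia)
  | zero => simp
  | add x y _ _ hx hy => rw [star_add]; exact add_mem hx hy
  | smul c x _ hx => rw [star_smul]; exact Submodule.smul_mem _ _ hx

theorem inner_eq_zero_of_mem_trigSpan {σ : Measure Circle} [IsFiniteMeasure σ] {a b : ℤ}
    {v : Lp ℂ 2 σ} (hv : ∀ k, a ≤ k → k ≤ b → inner ℂ (emb σ (zeta k)) v = 0)
    {f : C(Circle, ℂ)} (hf : f ∈ trigSpan a b) : inner ℂ (emb σ f) v = 0 := by
  induction hf using Submodule.span_induction with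
  | mem x hx =>
    obtain ⟨k, ⟨h1, h2⟩, rfl⟩ := hx
    exact hv k h1 h2
  | zero => simp
  | add x y _ _ hx hy => rw [map_add, inner_add_left, hx, hy, add_zero]
  | smul c x _ hx => rw [map_smul, inner_smul_left, hx, mul_zero]

/-- The restriction of a polynomial to the circle. -/
def polC : ℂ[X] →ₐ[ℂ] C(Circle, ℂ) := Polynomial.aeval (zeta 1)

theorem polC_apply (p : ℂ[X]) (z : Circle) : polC p z = p.eval (z : ℂ) := by
  rw [polC, Polynomial.aeval_continuousMap_apply, zeta_apply, zpow_one]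

theorem polC_X_pow (n : ℕ) : polC (X ^ n) = zeta n := by
  ext z
  simp [polC_apply, zeta_apply]

theorem polC_sub_coeff_zero_mem {p : ℂ[X]} {n : ℕ} (hp : p.natDegree ≤ n) :
    polC p - p.coeff 0 • 1 ∈ trigSpan 1 n := by
  have h : polC p = ∑ k ∈ Finset.range (n + 1), p.coeff k • zeta k := by
    ext z
    rw [polC_apply, Polynomial.eval_eq_sum_range' (n := n + 1) (by lia)]
    simp [zeta_apply]
  rw [h, Finset.sum_range_succ']
  simp only [Nat.cast_zero, zeta_zero, add_sub_cancel_right]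
  refine Submodule.sum_mem _ fun k hk => Submodule.smul_mem _ _ (zeta_mem_trigSpan ?_ ?_)
  · lia
  · have := Finset.mem_range.1 hk
    lia

theorem polC_mem {p : ℂ[X]} {n : ℕ} (hp : p.natDegree ≤ n) : polC p ∈ trigSpan 0 n := by
  have h := polC_sub_coeff_zero_mem hp
  have h2 : polC p = (polC p - p.coeff 0 • 1) + p.coeff 0 • zeta 0 := by simp
  rw [h2]
  exact add_mem (trigSpan_mono (by lia) le_rfl h)
    (Submodule.smul_mem _ _ (zeta_mem_trigSpan le_rfl (by lia)))

theorem exists_polC_of_mem_trigSpan {a b : ℤ} {f : C(Circle, ℂ)} (hf : f ∈ trigSpan a b) :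
    ∃ p : ℂ[X], f = zeta a * polC p := by
  induction hf using Submodule.span_induction with
  | mem x hx =>
    obtain ⟨k, ⟨h1, h2⟩, rfl⟩ := hx
    refine ⟨X ^ (k - a).toNat, ?_⟩
    rw [polC_X_pow, zeta_mul]
    congr 1
    lia
  | zero => exact ⟨0, by simp⟩
  | add x y _ _ hx hy =>
    obtain ⟨p, rfl⟩ := hx
    obtain ⟨q, rfl⟩ := hy
    exact ⟨p + q, by rw [map_add, mul_add]⟩
  | smul c x _ hx =>
    obtain ⟨p, rfl⟩ := hx
    exact ⟨c • p, by rw [map_smul, mul_smul_comm]⟩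

/-- For an infinitely supported measure, a trigonometric polynomial that vanishes in `L²(σ)`
vanishes identically. -/
theorem eq_zero_of_emb_eq_zero {σ : Measure Circle} [IsFiniteMeasure σ]
    (hσ : σ.support.Infinite) {a b : ℤ} {f : C(Circle, ℂ)} (hf : f ∈ trigSpan a b)
    (h0 : emb σ f = 0) : f = 0 := by
  obtain ⟨p, rfl⟩ := exists_polC_of_mem_trigSpan hf
  by_cases hp : p = 0
  · simp [hp]
  exfalso
  have hae : ∀ᵐ z ∂σ, (zeta a * polC p) z = 0 := by
    have h1 := (zeta a * polC p).coeFn_toLp (p := 2) (𝕜 := ℂ) σ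
    have h2 : (ContinuousMap.toLp 2 σ ℂ (zeta a * polC p) : Lp ℂ 2 σ) = 0 := h0
    rw [h2] at h1
    filter_upwards [h1, Lp.coeFn_zero ℂ 2 σ] with z hz hz'
    rw [← hz, hz']; rfl
  have hfin : {z : Circle | p.eval (z : ℂ) = 0}.Finite := by
    refine Set.Finite.of_finite_image (f := fun z : Circle => (z : ℂ)) ?_
      Circle.coe_injective.injOn
    refine (p.rootSet_finite ℂ).subset ?_
    rintro _ ⟨z, hz, rfl⟩
    rw [Polynomial.mem_rootSet]
    exact ⟨hp, by simpa using hz⟩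
  refine hσ (hfin.subset (Measure.support_subset_of_isClosed hfin.isClosed ?_))
  filter_upwards [hae] with z hz
  have : (z : ℂ) ^ a ≠ 0 := zpow_ne_zero _ z.coe_ne_zero
  simpa [zeta_apply, polC_apply, this] using hz

/-! ### Orthogonal polynomials -/

/-- The monic orthogonal polynomial `Φ_n` as a function on the circle. -/
def Phi (σ : Measure Circle) (n : ℕ) : C(Circle, ℂ) := polC (monicOP σ n)

/-- The reversed polynomial `Φ_n^*` as a function on the circle. -/
def PhiS (σ : Measure Circle) (n : ℕ) : C(Circle, ℂ) := zeta n * star (Phi σ n)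

/-- The squared norm `‖Φ_n‖²` in `L²(σ)`. -/
def en (σ : Measure Circle) [IsFiniteMeasure σ] (n : ℕ) : ℝ := ‖emb σ (Phi σ n)‖ ^ 2

theorem natDegree_monicOP (σ : Measure Circle) (n : ℕ) : (monicOP σ n).natDegree ≤ n := by
  induction n using Nat.strong_induction_on with
  | _ n ih =>
    rw [monicOP]
    refine (Polynomial.natDegree_sub_le _ _).trans (max_le (by simp) ?_)
    refine Polynomial.natDegree_sum_le_of_forall_le _ _ fun k _ => ?_
    exact (Polynomial.natDegree_C_mul_le _ _).trans ((ih k k.2).trans k.2.le)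

theorem Phi_mem {σ : Measure Circle} (n : ℕ) : Phi σ n ∈ trigSpan 0 n :=
  polC_mem (natDegree_monicOP σ n)

theorem Phi_eq {σ : Measure Circle} (n : ℕ) : Phi σ n = zeta n - ∑ k : Fin n,
    (polyInner σ (X ^ n) (monicOP σ k) / polyInner σ (monicOP σ k) (monicOP σ k)) •
      Phi σ k := by
  rw [Phi, monicOP, map_sub, polC_X_pow, map_sum]
  congr 1
  refine Finset.sum_congr rfl fun k _ => ?_
  rw [← Polynomial.smul_eq_C_mul, map_smul]
  rfl

theorem Phi_sub_zeta_mem {σ : Measure Circle} (n : ℕ) : Phi σ n - zeta n ∈ trigSpan 0 (n - 1) := by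
  rw [Phi_eq, sub_sub_cancel_left]
  refine neg_mem (Submodule.sum_mem _ fun k _ => Submodule.smul_mem _ _ ?_)
  exact trigSpan_mono le_rfl (by have := k.2; lia) (Phi_mem (σ := σ) k)

theorem PhiS_sub_one_mem {σ : Measure Circle} (n : ℕ) : PhiS σ n - 1 ∈ trigSpan 1 n := by
  have h := zeta_mul_mem_trigSpan n (star_mem_trigSpan (Phi_sub_zeta_mem (σ := σ) n))
  rw [star_sub, star_zeta, mul_sub, zeta_mul, add_neg_cancel, zeta_zero] at h
  exact trigSpan_mono (by lia) (by lia) h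

theorem PhiS_sub_mem {σ : Measure Circle} {a b : ℕ} (h : a ≤ b) :
    PhiS σ a - PhiS σ b ∈ trigSpan 1 b := by
  have h1 := trigSpan_mono (a' := 1) (b' := b) le_rfl (by lia) (PhiS_sub_one_mem (σ := σ) a)
  have := sub_mem h1 (PhiS_sub_one_mem (σ := σ) b)
  rwa [sub_sub_sub_cancel_right] at this

theorem Phi_ne_zero {σ : Measure Circle} (n : ℕ) : Phi σ n ≠ 0 := by
  intro h
  have h1 := Phi_sub_zeta_mem (σ := σ) n
  rw [h, zero_sub] at h1
  have h2 : inner ℂ (emb arcMeasure (zeta n)) (emb arcMeasure (zeta n)) = (0 : ℂ) := by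
    have := inner_eq_zero_of_mem_trigSpan (σ := arcMeasure) (v := emb arcMeasure (zeta n))
      (a := 0) (b := n - 1) ?_ h1
    · rwa [map_neg, inner_neg_left, neg_eq_zero] at this
    · intro k hk0 hk
      rw [inner_emb]
      simp_rw [conj_zeta_apply, ← ContinuousMap.mul_apply, zeta_mul]
      rw [integral_zeta, if_neg (by lia)]
  rw [inner_emb] at h2
  simp_rw [conj_zeta_apply, ← ContinuousMap.mul_apply, zeta_mul] at h2
  rw [integral_zeta, if_pos (by lia)] at h2
  exact one_ne_zero h2

section Orthogonality

variable {σ : Measure Circle} [IsFiniteMeasure σ]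

theorem polyInner_eq (p q : ℂ[X]) :
    polyInner σ p q = inner ℂ (emb σ (polC q)) (emb σ (polC p)) := by
  rw [inner_emb, polyInner]
  simp_rw [polC_apply]

theorem inner_Phi_Phi_of_lt (n : ℕ) :
    ∀ k < n, inner ℂ (emb σ (Phi σ k)) (emb σ (Phi σ n)) = 0 := by
  induction n using Nat.strong_induction_on with
  | _ n ih =>
    intro k hk
    have hsymm : ∀ i j : ℕ, i < n → j < n → i ≠ j →
        inner ℂ (emb σ (Phi σ i)) (emb σ (Phi σ j)) = 0 := by
      intro i j hi hj hij
      rcases lt_or_gt_of_ne hij with h | h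
      · exact ih j hj i h
      · rw [← inner_conj_symm, ih i hi j h, map_zero]
    rw [Phi_eq n, map_sub, inner_sub_right, map_sum, inner_sum]
    rw [Finset.sum_eq_single (⟨k, hk⟩ : Fin n)]
    · rw [map_smul, inner_smul_right, polyInner_eq, polyInner_eq, polC_X_pow]
      change _ - inner ℂ (emb σ (Phi σ k)) _ / inner ℂ (emb σ (Phi σ k)) (emb σ (Phi σ k)) * _ = 0
      by_cases h0 : emb σ (Phi σ k) = 0
      · simp [h0]
      · rw [div_mul_cancel₀ _ (inner_self_ne_zero.2 h0), sub_self]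
    · intro b _ hb
      rw [map_smul, inner_smul_right, hsymm k b hk b.2, mul_zero]
      intro h
      exact hb (Fin.ext h.symm)
    · simp

theorem inner_zeta_Phi (n : ℕ) {k : ℤ} (h0 : 0 ≤ k) (h1 : k ≤ n - 1) :
    inner ℂ (emb σ (zeta k)) (emb σ (Phi σ n)) = 0 := by
  obtain ⟨m, rfl⟩ := Int.eq_ofNat_of_zero_le h0
  have h := Phi_eq (σ := σ) m
  rw [eq_sub_iff_add_eq] at h
  rw [← h, map_add, inner_add_left, inner_Phi_Phi_of_lt n m (by lia), zero_add, map_sum,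
    sum_inner]
  refine Finset.sum_eq_zero fun j _ => ?_
  rw [map_smul, inner_smul_left, inner_Phi_Phi_of_lt n j (by have := j.2; lia), mul_zero]

/-- `Φ_n` is orthogonal to `1, z, …, z ^ (n - 1)`. -/
theorem inner_Phi {n : ℕ} {f : C(Circle, ℂ)} (hf : f ∈ trigSpan 0 (n - 1)) :
    inner ℂ (emb σ f) (emb σ (Phi σ n)) = 0 :=
  inner_eq_zero_of_mem_trigSpan (fun _ h0 h1 => inner_zeta_Phi n h0 h1) hf

/-- `Φ_n^*` is orthogonal to `z, …, z ^ n`. -/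
theorem inner_PhiS {n : ℕ} {f : C(Circle, ℂ)} (hf : f ∈ trigSpan 1 n) :
    inner ℂ (emb σ f) (emb σ (PhiS σ n)) = 0 := by
  have h := zeta_mul_mem_trigSpan n (star_mem_trigSpan hf)
  have h2 : inner ℂ (emb σ (zeta n * star f)) (emb σ (Phi σ n)) = 0 :=
    inner_Phi (trigSpan_mono (by lia) (by lia) h)
  rw [inner_emb_mul_left, star_zeta] at h2
  have h3 : zeta (-n) * Phi σ n = star (PhiS σ n) := by
    rw [PhiS, star_mul', star_zeta, star_star]
  rw [h3, inner_star] at h2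
  rw [← inner_conj_symm, h2, map_zero]

theorem norm_PhiS_sq (n : ℕ) : ‖emb σ (PhiS σ n)‖ ^ 2 = en σ n := by
  rw [PhiS, norm_zeta_mul, norm_star_emb, en]

/-- Pythagoras for a vector and a difference orthogonal to it. -/
theorem norm_add_sq_of_inner_eq_zero {H : Type*} [NormedAddCommGroup H] [InnerProductSpace ℂ H]
    {x y : H} (h : inner ℂ x y = 0) : ‖x + y‖ ^ 2 = ‖x‖ ^ 2 + ‖y‖ ^ 2 := by
  rw [norm_add_sq (𝕜 := ℂ), h]
  simp

theorem norm_PhiS_sub_sq {a b : ℕ} (h : a ≤ b) :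
    ‖emb σ (PhiS σ a - PhiS σ b)‖ ^ 2 = en σ a - en σ b := by
  have h1 := norm_add_sq_of_inner_eq_zero (inner_PhiS (σ := σ) (PhiS_sub_mem (σ := σ) h))
  rw [← map_add, sub_add_cancel, norm_PhiS_sq, norm_PhiS_sq] at h1
  linarith

theorem en_antitone : Antitone (en σ) := fun a b h => by
  have := norm_PhiS_sub_sq (σ := σ) h
  nlinarith [sq_nonneg ‖emb σ (PhiS σ a - PhiS σ b)‖]

/-- Among the polynomials of degree at most `n` with value `1` at the origin, `Φ_n^*` has the
least norm. -/
theorem en_le_norm_sq {n : ℕ} {f : C(Circle, ℂ)} (hf : f - 1 ∈ trigSpan 1 n) :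
    en σ n ≤ ‖emb σ f‖ ^ 2 := by
  have h := sub_mem hf (PhiS_sub_one_mem (σ := σ) n)
  rw [sub_sub_sub_cancel_right] at h
  have h1 := norm_add_sq_of_inner_eq_zero (inner_PhiS (σ := σ) h)
  rw [← map_add, sub_add_cancel, norm_PhiS_sq] at h1
  nlinarith [sq_nonneg ‖emb σ (f - PhiS σ n)‖]

theorem en_nonneg (n : ℕ) : 0 ≤ en σ n := sq_nonneg _

theorem en_zero [IsProbabilityMeasure σ] : en σ 0 = 1 := by
  have : Phi σ 0 = 1 := by rw [Phi_eq]; simp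
  rw [en, norm_emb_sq, this]
  simp

theorem en_le_one [IsProbabilityMeasure σ] (n : ℕ) : en σ n ≤ 1 :=
  (en_antitone (Nat.zero_le n)).trans en_zero.le

theorem en_pos (hσ : σ.support.Infinite) (n : ℕ) : 0 < en σ n := by
  refine pow_pos (norm_pos_iff.2 fun h => ?_) 2
  exact Phi_ne_zero n (eq_zero_of_emb_eq_zero hσ (Phi_mem (σ := σ) n) h)

/-- The Szegő recurrence, in the form of the increment of `Φ_n^*`. -/
theorem PhiS_succ (hσ : σ.support.Infinite) (n : ℕ) :
    PhiS σ n - PhiS σ (n + 1) = verblunsky σ n • (zeta 1 * Phi σ n) := by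
  -- the difference of the two sides lies in the span of `z, …, z ^ n` and is orthogonal to it
  set R := PhiS σ n - PhiS σ (n + 1) - verblunsky σ n • (zeta 1 * Phi σ n) with hR
  have hmem : R ∈ trigSpan 1 n := by
    have h1 := PhiS_sub_one_mem (σ := σ) n
    have h2 : PhiS σ (n + 1) - 1 + verblunsky σ n • zeta (n + 1) ∈ trigSpan 1 n := by
      have h3 : Phi σ (n + 1) - (monicOP σ (n + 1)).coeff 0 • 1 - zeta (n + 1 : ℕ) ∈
          trigSpan 1 n := by
        have hdeg : (monicOP σ (n + 1) - X ^ (n + 1)).natDegree ≤ n := by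
          rw [monicOP, sub_sub_cancel_left, Polynomial.natDegree_neg]
          refine Polynomial.natDegree_sum_le_of_forall_le _ _ fun k _ => ?_
          refine (Polynomial.natDegree_C_mul_le _ _).trans ((natDegree_monicOP σ k).trans ?_)
          have := k.2
          lia
        have h4 := polC_sub_coeff_zero_mem hdeg
        rw [map_sub, polC_X_pow, Polynomial.coeff_sub] at h4
        simp only [Polynomial.coeff_X_pow] at h4
        rw [if_neg (by lia), sub_zero, sub_right_comm] at h4
        exact h4
      have h5 := zeta_mul_mem_trigSpan (n + 1 : ℕ) (star_mem_trigSpan h3)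
      have h6 : zeta (n + 1 : ℕ) * star (Phi σ (n + 1) - (monicOP σ (n + 1)).coeff 0 • 1 -
          zeta (n + 1 : ℕ)) = PhiS σ (n + 1) - 1 + verblunsky σ n • zeta (n + 1) := by
        rw [star_sub, star_sub, mul_sub, mul_sub, star_zeta, zeta_mul, add_neg_cancel, zeta_zero,
          star_smul, star_one, mul_smul_comm, mul_one, verblunsky,
          Polynomial.coeff_zero_eq_eval_zero, PhiS]
        simp only [RCLike.star_def, Nat.cast_add, Nat.cast_one, neg_smul]
        abel
      rw [h6] at h5
      exact trigSpan_mono (by push_cast; lia) (by push_cast; lia) h5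
    have h7 : verblunsky σ n • (zeta 1 * (Phi σ n - zeta n)) ∈ trigSpan 1 n := by
      refine Submodule.smul_mem _ _ ?_
      exact trigSpan_mono (by lia) (by lia)
        (zeta_mul_mem_trigSpan 1 (Phi_sub_zeta_mem (σ := σ) n))
    have h8 := sub_mem (sub_mem h1 h2) h7
    convert h8 using 1
    rw [mul_sub, zeta_mul, smul_sub, add_comm (1 : ℤ), hR]
    abel
  have horth : ∀ f ∈ trigSpan 1 (n : ℤ), inner ℂ (emb σ f) (emb σ R) = 0 := by
    intro f hf
    rw [hR, map_sub, map_sub, inner_sub_right, inner_sub_right, inner_PhiS hf,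
      inner_PhiS (trigSpan_mono le_rfl (by push_cast; lia) hf), map_smul, inner_smul_right]
    have h9 := inner_Phi (σ := σ) (n := n)
      (trigSpan_mono (a' := 0) (b' := n - 1) (by lia) (by lia) (zeta_mul_mem_trigSpan (-1) hf))
    rw [inner_emb_mul_left, star_zeta, neg_neg] at h9
    rw [h9]
    simp
  have h0 : R = 0 := eq_zero_of_emb_eq_zero hσ hmem (inner_self_eq_zero.1 (horth R hmem))
  exact sub_eq_zero.1 h0

theorem en_succ (hσ : σ.support.Infinite) (n : ℕ) :
    en σ (n + 1) = (1 - ‖verblunsky σ n‖ ^ 2) * en σ n := by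
  have h := norm_PhiS_sub_sq (σ := σ) (Nat.le_succ n)
  rw [Nat.succ_eq_add_one, PhiS_succ hσ, map_smul, norm_smul, norm_zeta_mul, mul_pow] at h
  change _ * en σ n = _ at h
  linarith

/-- The limit of `‖Φ_n‖²` is positive when the Verblunsky coefficients are square summable. -/
theorem exists_en_limit (hσ : σ.support.Infinite)
    (hS : Summable fun n : ℕ => ‖verblunsky σ n‖ ^ 2) :
    ∃ e : ℝ, 0 < e ∧ (∀ n, e ≤ en σ n) ∧ Tendsto (en σ) atTop (𝓝 e) := by
  set e := ⨅ n, en σ n with he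
  have hbdd : BddBelow (Set.range (en σ)) := ⟨0, by rintro _ ⟨n, rfl⟩; exact en_nonneg n⟩
  refine ⟨e, ?_, fun n => ciInf_le hbdd n, tendsto_atTop_ciInf en_antitone hbdd⟩
  have htail := tendsto_sum_nat_add fun n : ℕ => ‖verblunsky σ n‖ ^ 2
  obtain ⟨N, hN⟩ := (htail.eventually (gt_mem_nhds (show (0 : ℝ) < 1 / 2 by norm_num))).exists
  have hprod : ∀ k, (1 - ∑ i ∈ Finset.range k, ‖verblunsky σ (i + N)‖ ^ 2) * en σ N ≤
      en σ (N + k) := by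
    intro k
    induction k with
    | zero => simp
    | succ k ih =>
      rw [← add_assoc, en_succ hσ, Finset.sum_range_succ, add_comm N k]
      rw [add_comm N k] at ih
      have h1 : en σ (k + N) ≤ en σ N := en_antitone (by lia)
      have h2 : ‖verblunsky σ (k + N)‖ ^ 2 * en σ (k + N) ≤
          ‖verblunsky σ (k + N)‖ ^ 2 * en σ N := by gcongr
      linarith
  have hhalf : ∀ n, 1 / 2 * en σ N ≤ en σ n := by
    intro n
    have h1 : en σ (N + n) ≤ en σ n := en_antitone (by lia)
    have h2 : ∑ i ∈ Finset.range n, ‖verblunsky σ (i + N)‖ ^ 2 ≤ 1 / 2 := by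
      refine (Summable.sum_le_tsum _ (fun _ _ => sq_nonneg _) ?_).trans hN.le
      exact (summable_nat_add_iff N).2 hS
    have h3 := en_pos hσ N
    nlinarith [hprod n]
  exact lt_of_lt_of_le (by have := en_pos hσ N; linarith) (le_ciInf hhalf)

/-- The frequency `d` component of the measure `|Φ_n|² σ` is controlled by the decrease of the
norms between `n - d` and `n + d`: it is the inner product of `Φ_n - z ^ d Φ_{n-d}` and
`z ^ d Φ_n - Φ_{n+d}`, whose norms are such decreases. -/
theorem norm_inner_Phi_zeta_mul_Phi_le {n d : ℕ} (h1 : 1 ≤ d) (h2 : d ≤ n) :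
    ‖inner ℂ (emb σ (Phi σ n)) (emb σ (zeta d * Phi σ n))‖ ≤
      (en σ (n - d) - en σ (n + d)) / 2 := by
  set u := zeta d * Phi σ n - Phi σ (n + d) with hu
  set v := Phi σ n - zeta d * Phi σ (n - d) with hv
  have hcast : ((n - d : ℕ) : ℤ) = n - d := by lia
  have hshift : ∀ m : ℕ, zeta d * Phi σ m - Phi σ (m + d) ∈ trigSpan 0 ((m + d : ℕ) - 1) := by
    intro m
    have h3 := zeta_mul_mem_trigSpan d (Phi_sub_zeta_mem (σ := σ) m)
    rw [mul_sub, zeta_mul] at h3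
    have h4 := sub_mem (trigSpan_mono (a' := 0) (b' := (m + d : ℕ) - 1) (by lia)
      (by push_cast; lia) h3) (Phi_sub_zeta_mem (σ := σ) (m + d))
    convert h4 using 1
    push_cast
    rw [add_comm (d : ℤ)]
    abel
  have hnu : ‖emb σ u‖ ^ 2 = en σ n - en σ (n + d) := by
    have h3 := norm_add_sq_of_inner_eq_zero (inner_Phi (σ := σ) (hshift n))
    rw [← map_add, sub_add_cancel, norm_zeta_mul] at h3
    change en σ n = _ + en σ (n + d) at h3
    linarith
  have hnv : ‖emb σ v‖ ^ 2 = en σ (n - d) - en σ n := by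
    have h3 := hshift (n - d)
    rw [Nat.sub_add_cancel h2] at h3
    have h3 := norm_add_sq_of_inner_eq_zero (inner_Phi (σ := σ) h3)
    rw [← map_add, sub_add_cancel, norm_zeta_mul] at h3
    change en σ (n - d) = _ + en σ n at h3
    rw [hv, ← neg_sub, map_neg, norm_neg]
    linarith
  have hin : inner ℂ (emb σ v) (emb σ u) =
      inner ℂ (emb σ (Phi σ n)) (emb σ (zeta d * Phi σ n)) := by
    rw [hu, hv, map_sub, map_sub, inner_sub_left, inner_sub_right, inner_sub_right,
      inner_zeta_mul, inner_Phi_Phi_of_lt _ _ (by lia), inner_Phi_Phi_of_lt _ _ (by lia),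
      inner_Phi (n := n + d)]
    · simp
    · exact trigSpan_mono (by lia) (by push_cast; lia)
        (zeta_mul_mem_trigSpan d (Phi_mem (σ := σ) (n - d)))
  rw [← hin]
  refine (norm_inner_le_norm _ _).trans ?_
  nlinarith [sq_nonneg (‖emb σ v‖ - ‖emb σ u‖)]

end Orthogonality

/-! ### The absolutely continuous part -/

theorem density_nonneg {σ : Measure Circle} (z : Circle) : 0 ≤ density σ z := ENNReal.toReal_nonneg

theorem measurable_density {σ : Measure Circle} : Measurable (density σ) :=
  (Measure.measurable_rnDeriv _ _).ennreal_toReal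

section AcPart

variable {σ : Measure Circle} [IsFiniteMeasure σ] {E : Set Circle}

/-- On a set as in `IsAcSet` the measure coincides with its absolutely continuous part. -/
theorem restrict_acSet (hE : IsAcSet σ E) :
    σ.restrict E = arcMeasure.withDensity (σ.rnDeriv arcMeasure) := by
  obtain ⟨hm, h1, h2⟩ := hE
  have h := σ.haveLebesgueDecomposition_add arcMeasure
  have h3 : (arcMeasure.withDensity (σ.rnDeriv arcMeasure)).restrict E =
      arcMeasure.withDensity (σ.rnDeriv arcMeasure) := by
    refine Measure.restrict_eq_self_of_ae_mem ?_
    refine (withDensity_absolutelyContinuous _ _).ae_le ?_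
    exact h1
  conv_lhs => rw [h]
  rw [Measure.restrict_add, h3, Measure.restrict_eq_zero.2 h2, zero_add]

theorem setIntegral_acSet {F : Type*} [NormedAddCommGroup F] [NormedSpace ℝ F]
    (hE : IsAcSet σ E) (g : Circle → F) :
    ∫ z in E, g z ∂σ = ∫ z, density σ z • g z ∂arcMeasure := by
  rw [restrict_acSet hE]
  exact integral_withDensity_eq_integral_toReal_smul (Measure.measurable_rnDeriv _ _)
    (Measure.rnDeriv_lt_top _ _) g

theorem integrableOn_acSet_iff {F : Type*} [NormedAddCommGroup F] [NormedSpace ℝ F]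
    (hE : IsAcSet σ E) (g : Circle → F) :
    IntegrableOn g E σ ↔ Integrable (fun z => density σ z • g z) arcMeasure := by
  rw [IntegrableOn, restrict_acSet hE]
  exact integrable_withDensity_iff_integrable_smul' (Measure.measurable_rnDeriv _ _)
    (Measure.rnDeriv_lt_top _ _)

theorem ae_restrict_acSet {p : Circle → Prop} (hE : IsAcSet σ E) (h : ∀ᵐ z ∂arcMeasure, p z) :
    ∀ᵐ z ∂σ.restrict E, p z := by
  rw [restrict_acSet hE]
  exact (withDensity_absolutelyContinuous _ _).ae_le h

theorem integrable_density : Integrable (density σ) arcMeasure :=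
  Measure.integrable_toReal_rnDeriv

theorem integral_density_le_one [IsProbabilityMeasure σ] :
    ∫ z, density σ z ∂arcMeasure ≤ 1 := by
  have h := Measure.setIntegral_toReal_rnDeriv_le (μ := σ) (ν := arcMeasure) (s := Set.univ)
    (measure_ne_top _ _)
  rw [setIntegral_univ] at h
  simpa [density] using h

end AcPart

/-! ### Szegő's lower bound for the entropy -/

section Entropy

variable {σ : Measure Circle} [IsFiniteMeasure σ] {e : ℝ}

theorem le_norm_sq_polC (he : ∀ n, e ≤ en σ n) {p : ℂ[X]} (hp : p.eval 0 = 1) :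
    e ≤ ‖emb σ (polC p)‖ ^ 2 := by
  refine (he p.natDegree).trans (en_le_norm_sq ?_)
  have := polC_sub_coeff_zero_mem (p := p) le_rfl
  rwa [Polynomial.coeff_zero_eq_eval_zero, hp, one_smul] at this

theorem exp_apply (f : C(Circle, ℂ)) (z : Circle) : NormedSpace.exp f z = Complex.exp (f z) := by
  have h := NormedSpace.map_exp (ContinuousMap.evalAlgHom ℂ ℂ z) (continuous_eval_const z) f
  rw [← Complex.exp_eq_exp_ℂ] at h
  exact h

theorem norm_emb_exp_sq (f : C(Circle, ℂ)) :
    ‖emb σ (NormedSpace.exp f)‖ ^ 2 = ∫ z, Real.exp (2 * (f z).re) ∂σ := by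
  rw [norm_emb_sq]
  congr 1 with z
  rw [exp_apply, Complex.norm_exp, two_mul, Real.exp_add, sq]

/-- The lower bound for polynomials passes to exponentials of polynomials, as uniform limits of the
partial sums of the exponential series. -/
theorem le_norm_sq_exp_polC (he : ∀ n, e ≤ en σ n) {q : ℂ[X]} (hq : q.eval 0 = 0) :
    e ≤ ‖emb σ (NormedSpace.exp (polC q))‖ ^ 2 := by
  have h := (NormedSpace.exp_series_hasSum_exp' (𝕂 := ℂ) (polC q)).tendsto_sum_nat
  have h2 := (((emb σ).continuous.tendsto _).comp h).norm.pow 2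
  refine ge_of_tendsto h2 ((eventually_ge_atTop 1).mono fun N hN => ?_)
  have h3 : ∑ i ∈ Finset.range N, ((i.factorial : ℂ)⁻¹) • polC q ^ i =
      polC (∑ i ∈ Finset.range N, ((i.factorial : ℂ)⁻¹) • q ^ i) := by
    simp
  simp only [Function.comp_apply]
  rw [h3]
  refine le_norm_sq_polC he ?_
  rw [Polynomial.eval_finsetSum, Finset.sum_eq_single 0]
  · simp
  · intro i _ hi
    simp [hq, hi]
  · intro h0
    simp at h0
    lia

theorem exists_polC_add_conj {f : C(Circle, ℂ)} (hf : f ∈ Submodule.span ℂ (Set.range zeta)) :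
    ∃ p q : ℂ[X], f = polC p + star (polC q) := by
  induction hf using Submodule.span_induction with
  | mem x hx =>
    obtain ⟨k, rfl⟩ := hx
    rcases le_total 0 k with h | h
    · refine ⟨X ^ k.toNat, 0, ?_⟩
      rw [polC_X_pow, Int.toNat_of_nonneg h]
      simp
    · refine ⟨0, X ^ (-k).toNat, ?_⟩
      rw [polC_X_pow, Int.toNat_of_nonneg (by lia), star_zeta]
      simp
  | zero => exact ⟨0, 0, by simp⟩
  | add x y _ _ hx hy =>
    obtain ⟨p, q, rfl⟩ := hx
    obtain ⟨p', q', rfl⟩ := hy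
    exact ⟨p + p', q + q', by simp; abel⟩
  | smul c x _ hx =>
    obtain ⟨p, q, rfl⟩ := hx
    exact ⟨c • p, (conj c) • q, by simp [star_smul]⟩

theorem integral_polC (p : ℂ[X]) : ∫ z, polC p z ∂arcMeasure = p.eval 0 := by
  have h := polC_sub_coeff_zero_mem (p := p) le_rfl
  have h2 := inner_eq_zero_of_mem_trigSpan (σ := arcMeasure) (v := emb arcMeasure 1) (a := 1)
    (b := p.natDegree) ?_ h
  · rw [← inner_conj_symm, inner_emb] at h2
    simp only [ContinuousMap.sub_apply, ContinuousMap.one_apply, map_one, mul_one,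
      map_eq_zero] at h2
    rw [integral_sub (integrable_continuousMap _) (integrable_continuousMap (p.coeff 0 • 1))] at h2
    simp only [ContinuousMap.smul_apply, ContinuousMap.one_apply, smul_eq_mul, mul_one,
      integral_const, probReal_univ, one_smul] at h2
    rw [← Polynomial.coeff_zero_eq_eval_zero]
    exact sub_eq_zero.1 h2
  · intro k hk _
    rw [inner_emb]
    simp only [ContinuousMap.one_apply, one_mul, conj_zeta_apply]
    rw [integral_zeta, if_neg (by lia)]

theorem integral_complex_re {f : Circle → ℂ} {ν : Measure Circle} (hf : Integrable f ν) :
    ∫ z, (f z).re ∂ν = (∫ z, f z ∂ν).re :=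
  _root_.integral_re hf

/-- Szegő's variational inequality for continuous weights: the real part of a trigonometric
polynomial is that of a polynomial, and trigonometric polynomials are dense. -/
theorem le_integral_exp_continuous (he : ∀ n, e ≤ en σ n) (f : C(Circle, ℂ)) :
    e * Real.exp (2 * ∫ z, (f z).re ∂arcMeasure) ≤ ∫ z, Real.exp (2 * (f z).re) ∂σ := by
  have hcl : IsClosed {f : C(Circle, ℂ) |
      e * Real.exp (2 * (inner ℂ (emb arcMeasure 1) (emb arcMeasure f)).re) ≤
        ‖emb σ (NormedSpace.exp f)‖ ^ 2} := by
    refine isClosed_le ?_ ?_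
    · fun_prop
    · exact (((emb σ).continuous.comp NormedSpace.exp_continuous).norm).pow 2
  have hint : ∀ f : C(Circle, ℂ), (inner ℂ (emb arcMeasure 1) (emb arcMeasure f)).re =
      ∫ z, (f z).re ∂arcMeasure := by
    intro f
    rw [integral_complex_re (integrable_continuousMap f), inner_emb]
    simp
  have hsub : (Submodule.span ℂ (Set.range zeta) : Set C(Circle, ℂ)) ⊆ {f : C(Circle, ℂ) |
      e * Real.exp (2 * (inner ℂ (emb arcMeasure 1) (emb arcMeasure f)).re) ≤
        ‖emb σ (NormedSpace.exp f)‖ ^ 2} := by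
    intro f hf
    obtain ⟨p, q, rfl⟩ := exists_polC_add_conj hf
    set r : ℂ[X] := p + q with hr
    have hre : ∀ z, ((polC p + star (polC q)) z).re = (polC r z).re := by
      intro z
      simp [hr]
    simp only [Set.mem_ofPred_eq]
    rw [hint, norm_emb_exp_sq]
    simp_rw [hre]
    rw [integral_complex_re (integrable_continuousMap _), integral_polC]
    have h := le_norm_sq_exp_polC (q := r - C (r.eval 0)) he (by simp)
    rw [norm_emb_exp_sq] at h
    have h2 : ∀ z, Real.exp (2 * (polC (r - C (r.eval 0)) z).re) =
        Real.exp (-(2 * (r.eval 0).re)) * Real.exp (2 * (polC r z).re) := by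
      intro z
      rw [← Real.exp_add, polC_apply, polC_apply]
      congr 1
      simp
      ring
    simp_rw [h2] at h
    rw [integral_const_mul] at h
    calc _ ≤ _ := mul_le_mul_of_nonneg_right h (Real.exp_pos _).le
      _ = _ := by rw [mul_right_comm, ← Real.exp_add]; simp
  have hd := dense_span_zeta
  have hmem : f ∈ closure (Submodule.span ℂ (Set.range zeta) : Set C(Circle, ℂ)) := by
    rw [← Submodule.topologicalClosure_coe, hd]
    trivial
  have := closure_minimal hsub hcl hmem
  simp only [Set.mem_ofPred_eq] at this
  rwa [hint, norm_emb_exp_sq] at this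

theorem abs_exp_sub_exp_le {a b B : ℝ} (ha : a ≤ B) (hb : b ≤ B) :
    |Real.exp a - Real.exp b| ≤ Real.exp B * |a - b| := by
  wlog h : b ≤ a generalizing a b
  · rw [abs_sub_comm, abs_sub_comm a]
    exact this hb ha (le_of_not_ge h)
  rw [abs_of_nonneg (sub_nonneg.2 (Real.exp_le_exp.2 h)), abs_of_nonneg (sub_nonneg.2 h)]
  have h1 := Real.add_one_le_exp (b - a)
  have h2 : Real.exp b = Real.exp a * Real.exp (b - a) := by rw [← Real.exp_add]; congr 1; ring
  have h3 : Real.exp a ≤ Real.exp B := Real.exp_le_exp.2 ha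
  rw [h2]
  nlinarith [Real.exp_pos a]

/-- Szegő's variational inequality for bounded measurable weights. -/
theorem le_integral_exp_bounded (he : ∀ n, e ≤ en σ n) {t : Circle → ℝ} (ht : Measurable t)
    {B : ℝ} (hB : ∀ z, |t z| ≤ B) (he0 : 0 ≤ e) :
    e * Real.exp (∫ z, t z ∂arcMeasure) ≤ ∫ z, Real.exp (t z) ∂σ := by
  have hti : ∀ ν : Measure Circle, IsFiniteMeasure ν → Integrable t ν := fun ν _ =>
    Integrable.of_bound ht.aestronglyMeasurable B (ae_of_all _ hB)
  have key : ∀ ε : ℝ, 0 < ε → e * Real.exp ((∫ z, t z ∂arcMeasure) - ε) ≤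
      (∫ z, Real.exp (t z) ∂σ) + Real.exp B * ε := by
    intro ε hε
    -- approximation in mean with respect to both measures at once
    obtain ⟨g, hg, hgi⟩ :=
      (hti (σ + arcMeasure) inferInstance).exists_boundedContinuous_integral_sub_le hε
    let g' : C(Circle, ℝ) := ⟨fun z => max (-B) (min B (g z)), by fun_prop⟩
    have hg'B : ∀ z, g' z ≤ B := fun z => by
      have := (abs_nonneg (t z)).trans (hB z)
      exact max_le (by linarith) (min_le_left _ _)
    have hle : ∀ z, |t z - g' z| ≤ ‖t z - g z‖ := by
      intro z
      have h1 : t z = max (-B) (min B (t z)) := by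
        have := abs_le.1 (hB z)
        rw [min_eq_right this.2, max_eq_right this.1]
      rw [Real.norm_eq_abs]
      conv_lhs => rw [h1]
      calc |max (-B) (min B (t z)) - max (-B) (min B (g z))|
          ≤ |min B (t z) - min B (g z)| := by
            simpa using abs_max_sub_max_le_max (-B) (min B (t z)) (-B) (min B (g z))
        _ ≤ _ := by simpa using abs_min_sub_min_le_max B (t z) B (g z)
    have hdi : Integrable (fun z => |t z - g' z|) (σ + arcMeasure) :=
      ((hti _ inferInstance).sub (integrable_continuousMap g')).abs
    have hd : ∫ z, |t z - g' z| ∂(σ + arcMeasure) ≤ ε := by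
      refine le_trans (integral_mono hdi ?_ hle) hg
      exact ((hti _ inferInstance).sub hgi).norm
    rw [integral_add_measure hdi.left_of_add_measure hdi.right_of_add_measure] at hd
    have hp1 : 0 ≤ ∫ z, |t z - g' z| ∂σ := integral_nonneg fun _ => abs_nonneg _
    have hp2 : 0 ≤ ∫ z, |t z - g' z| ∂arcMeasure := integral_nonneg fun _ => abs_nonneg _
    have hm : |(∫ z, t z ∂arcMeasure) - ∫ z, g' z ∂arcMeasure| ≤ ε := by
      rw [← integral_sub (hti _ inferInstance) (integrable_continuousMap g')]
      exact (abs_integral_le_integral_abs).trans (by linarith)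
    have hexpi : Integrable (fun z => Real.exp (t z)) σ := by
      refine Integrable.of_bound (Real.measurable_exp.comp ht).aestronglyMeasurable (Real.exp B)
        (ae_of_all _ fun z => ?_)
      rw [Real.norm_eq_abs, abs_of_pos (Real.exp_pos _)]
      exact Real.exp_le_exp.2 ((le_abs_self _).trans (hB z))
    have hgexp : Integrable (fun z => Real.exp (g' z)) σ :=
      integrable_continuousMap (⟨fun z => Real.exp (g' z), by fun_prop⟩ : C(Circle, ℝ))
    have hs : ∫ z, Real.exp (g' z) ∂σ ≤ (∫ z, Real.exp (t z) ∂σ) + Real.exp B * ε := by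
      have h1 : ∫ z, Real.exp (g' z) ∂σ ≤
          ∫ z, (Real.exp (t z) + Real.exp B * |t z - g' z|) ∂σ := by
        refine integral_mono hgexp (hexpi.add (hdi.left_of_add_measure.const_mul _)) fun z => ?_
        have := abs_exp_sub_exp_le ((le_abs_self _).trans (hB z)) (hg'B z)
        have := (abs_le.1 this).1
        simp only
        linarith
      rw [integral_add hexpi (hdi.left_of_add_measure.const_mul _), integral_const_mul] at h1
      have : Real.exp B * ∫ z, |t z - g' z| ∂σ ≤ Real.exp B * ε := by
        gcongr
        linarith
      linarith
    have hc := le_integral_exp_continuous he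
      (⟨fun z => ((g' z / 2 : ℝ) : ℂ), by fun_prop⟩ : C(Circle, ℂ))
    simp only [ContinuousMap.coe_mk, Complex.ofReal_re] at hc
    simp_rw [mul_div_cancel₀ (G₀ := ℝ) _ (two_ne_zero)] at hc
    rw [integral_div, mul_div_cancel₀ _ (two_ne_zero)] at hc
    refine le_trans ?_ (hc.trans hs)
    gcongr
    have := (abs_le.1 hm).2
    linarith
  have hl : Tendsto (fun ε : ℝ => e * Real.exp ((∫ z, t z ∂arcMeasure) - ε)) (𝓝[>] 0)
      (𝓝 (e * Real.exp ((∫ z, t z ∂arcMeasure) - 0))) := by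
    refine Tendsto.mono_left ?_ nhdsWithin_le_nhds
    exact Continuous.tendsto (by fun_prop) 0
  have hr : Tendsto (fun ε : ℝ => (∫ z, Real.exp (t z) ∂σ) + Real.exp B * ε) (𝓝[>] 0)
      (𝓝 ((∫ z, Real.exp (t z) ∂σ) + Real.exp B * 0)) := by
    refine Tendsto.mono_left ?_ nhdsWithin_le_nhds
    exact Continuous.tendsto (by fun_prop) 0
  have := le_of_tendsto_of_tendsto hl hr (eventually_mem_nhdsWithin.mono fun ε hε => key ε hε)
  simpa using this

/-- The truncation of a nonnegative number to `[1 / K, K]`. -/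
def clip (K x : ℝ) : ℝ := max (min x K) K⁻¹

theorem measurable_clip (K : ℝ) : Measurable (clip K) := by
  unfold clip; fun_prop

theorem inv_le_clip {K x : ℝ} : K⁻¹ ≤ clip K x := le_max_right _ _

theorem clip_le {K x : ℝ} (hK : 1 ≤ K) : clip K x ≤ K :=
  max_le (min_le_right _ _) ((inv_le_one_of_one_le₀ hK).trans hK)

theorem clip_pos {K x : ℝ} (hK : 1 ≤ K) : 0 < clip K x :=
  lt_of_lt_of_le (inv_pos.2 (by linarith)) inv_le_clip

theorem abs_log_clip_le {K x : ℝ} (hK : 1 ≤ K) : |Real.log (clip K x)| ≤ Real.log K := by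
  rw [abs_le, ← Real.log_inv]
  exact ⟨Real.log_le_log (inv_pos.2 (by linarith)) inv_le_clip,
    Real.log_le_log (clip_pos hK) (clip_le hK)⟩

theorem div_clip_le {K x : ℝ} (hK : 1 ≤ K) (hx : 0 ≤ x) : x * (clip K x)⁻¹ ≤ 1 + x / K := by
  rw [← div_eq_mul_inv, div_le_iff₀ (clip_pos hK)]
  have hK0 : 0 < K := by linarith
  rcases le_total x K with h | h
  · have h1 : x ≤ clip K x := by rw [clip, min_eq_left h]; exact le_max_left _ _
    have h2 : 0 ≤ x / K := by positivity
    nlinarith [clip_pos (x := x) hK]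
  · have h1 : K ≤ clip K x := by rw [clip, min_eq_right h]; exact le_max_left _ _
    have h2 : x / K * K = x := div_mul_cancel₀ _ hK0.ne'
    have h3 : 0 ≤ x / K := by positivity
    nlinarith

/-- Testing the variational inequality with the truncated inverse of the density, which is very
small on the carrier of the singular part. -/
theorem log_le_integral_log_clip {σ : Measure Circle} [IsProbabilityMeasure σ] {e : ℝ}
    {E : Set Circle} (hE : IsAcSet σ E) (he : ∀ n, e ≤ en σ n) (he0 : 0 < e) {K : ℝ}
    (hK : 1 ≤ K) :
    Real.log e - Real.log (1 + K⁻¹ + Real.exp (-K)) ≤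
      ∫ z, Real.log (clip K (density σ z)) ∂arcMeasure := by
  classical
  have hK0 : 0 < K := by linarith
  set t : Circle → ℝ := E.piecewise (fun z => -Real.log (clip K (density σ z))) (fun _ => -K)
    with ht
  have htm : Measurable t := by
    refine Measurable.piecewise hE.1 ?_ measurable_const
    exact (Real.measurable_log.comp ((measurable_clip K).comp measurable_density)).neg
  have htB : ∀ z, |t z| ≤ K := by
    intro z
    by_cases hz : z ∈ E
    · rw [ht, Set.piecewise_eq_of_mem _ _ _ hz, abs_neg]
      exact (abs_log_clip_le hK).trans ((Real.log_le_sub_one_of_pos hK0).trans (by linarith))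
    · rw [ht, Set.piecewise_eq_of_notMem _ _ _ hz, abs_neg, abs_of_pos hK0]
  have h := le_integral_exp_bounded he htm htB he0.le
  have h1 : ∫ z, t z ∂arcMeasure = -∫ z, Real.log (clip K (density σ z)) ∂arcMeasure := by
    rw [← integral_neg]
    refine integral_congr_ae ?_
    have : ∀ᵐ z ∂arcMeasure, z ∈ E := hE.2.1
    filter_upwards [this] with z hz
    rw [ht, Set.piecewise_eq_of_mem _ _ _ hz]
  have h2 : ∫ z, Real.exp (t z) ∂σ ≤ 1 + K⁻¹ + Real.exp (-K) := by
    have hi : Integrable (fun z => Real.exp (t z)) σ := by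
      refine Integrable.of_bound (Real.measurable_exp.comp htm).aestronglyMeasurable (Real.exp K)
        (ae_of_all _ fun z => ?_)
      rw [Real.norm_eq_abs, abs_of_pos (Real.exp_pos _)]
      exact Real.exp_le_exp.2 ((le_abs_self _).trans (htB z))
    rw [← integral_add_compl hE.1 hi]
    refine add_le_add ?_ ?_
    · have h3 : ∫ z in E, Real.exp (t z) ∂σ = ∫ z in E, (clip K (density σ z))⁻¹ ∂σ := by
        refine setIntegral_congr_fun hE.1 fun z hz => ?_
        rw [ht, Set.piecewise_eq_of_mem _ _ _ hz, Real.exp_neg, Real.exp_log (clip_pos hK)]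
      rw [h3, setIntegral_acSet hE]
      simp only [smul_eq_mul]
      calc _ ≤ ∫ z, (1 + density σ z / K) ∂arcMeasure := by
            refine integral_mono_of_nonneg (ae_of_all _ fun z => ?_) ?_
              (ae_of_all _ fun z => div_clip_le hK (density_nonneg z))
            · exact mul_nonneg (density_nonneg z) (inv_nonneg.2 (clip_pos hK).le)
            · exact (integrable_const _).add (integrable_density.div_const _)
        _ ≤ _ := by
            rw [integral_add (integrable_const _) (integrable_density.div_const _), integral_div]
            simp only [integral_const, probReal_univ, one_smul]
            rw [inv_eq_one_div]
            gcongr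
            exact integral_density_le_one
    · have h3 : ∫ z in Eᶜ, Real.exp (t z) ∂σ = ∫ z in Eᶜ, Real.exp (-K) ∂σ := by
        refine setIntegral_congr_fun hE.1.compl fun z hz => ?_
        rw [ht, Set.piecewise_eq_of_notMem _ _ _ hz]
      rw [h3, setIntegral_const, smul_eq_mul]
      exact mul_le_of_le_one_left (Real.exp_pos _).le measureReal_le_one
  have h4 := h.trans h2
  rw [h1] at h4
  have h5 := Real.log_le_log (by positivity) h4
  rw [Real.log_mul he0.ne' (Real.exp_pos _).ne', Real.log_exp] at h5
  linarith

/-- Splitting into positive and negative part. -/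
theorem log_clip_decomp {K x : ℝ} (hK : 1 ≤ K) :
    Real.log (clip K x) = Real.log (max (min x K) 1) + Real.log (max (min x 1) K⁻¹) := by
  have hi : K⁻¹ ≤ 1 := inv_le_one_of_one_le₀ hK
  rcases le_total x 1 with h | h
  · rw [clip, min_eq_left (h.trans hK), max_eq_right h, min_eq_left h]
    simp
  · have h1 : (1 : ℝ) ≤ min x K := le_min h hK
    rw [clip, min_eq_right h, max_eq_left h1, max_eq_left hi, max_eq_left (hi.trans h1)]
    simp

theorem abs_log_clip_le_abs_log {K x : ℝ} (hK : 1 ≤ K) (hx : 0 < x) :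
    |Real.log (clip K x)| ≤ |Real.log x| := by
  have hK0 : 0 < K := by linarith
  have hi : K⁻¹ ≤ 1 := inv_le_one_of_one_le₀ hK
  rcases le_total x 1 with h | h
  · have h1 : clip K x ≤ 1 := max_le ((min_le_left _ _).trans h) hi
    have h2 : x ≤ clip K x := by
      rw [clip, min_eq_left (h.trans hK)]; exact le_max_left _ _
    rw [abs_of_nonpos (Real.log_nonpos (clip_pos hK).le h1),
      abs_of_nonpos (Real.log_nonpos hx.le h)]
    exact neg_le_neg (Real.log_le_log hx h2)
  · have h1 : 1 ≤ clip K x := le_max_of_le_left (le_min h hK)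
    have h2 : clip K x ≤ x := max_le (min_le_left _ _) (hi.trans h)
    rw [abs_of_nonneg (Real.log_nonneg h1), abs_of_nonneg (Real.log_nonneg h)]
    exact Real.log_le_log (clip_pos hK) h2

theorem tendsto_clip {x : ℝ} (hx : 0 ≤ x) :
    Tendsto (fun n : ℕ => clip ((n : ℝ) + 1) x) atTop (𝓝 x) := by
  have h1 : Tendsto (fun n : ℕ => ((n : ℝ) + 1)⁻¹) atTop (𝓝 0) := by
    simpa using tendsto_one_div_add_atTop_nhds_zero_nat (𝕜 := ℝ)
  have h2 : Tendsto (fun n : ℕ => max x (((n : ℝ) + 1)⁻¹)) atTop (𝓝 (max x 0)) :=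
    tendsto_const_nhds.max h1
  rw [max_eq_left hx] at h2
  refine h2.congr' ?_
  obtain ⟨N, hN⟩ := exists_nat_ge x
  filter_upwards [eventually_ge_atTop N] with n hn
  have : (N : ℝ) ≤ n := by exact_mod_cast hn
  rw [clip, min_eq_left (by linarith)]

/-- Szegő's theorem: positivity of the limit of `‖Φ_n‖²` forces the density to be log-integrable,
with entropy bounded from below. -/
theorem szego_entropy {σ : Measure Circle} [IsProbabilityMeasure σ] {e : ℝ}
    {E : Set Circle} (hE : IsAcSet σ E) (he : ∀ n, e ≤ en σ n) (he0 : 0 < e) :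
    (∀ᵐ z ∂arcMeasure, 0 < density σ z) ∧
      Integrable (fun z => Real.log (density σ z)) arcMeasure ∧
      Real.log e ≤ ∫ z, Real.log (density σ z) ∂arcMeasure := by
  have hK : ∀ n : ℕ, (1 : ℝ) ≤ (n : ℝ) + 1 := fun n => by
    have := n.cast_nonneg (α := ℝ); linarith
  have hclipi : ∀ n : ℕ, Integrable (fun z => Real.log (clip ((n : ℝ) + 1) (density σ z)))
      arcMeasure := fun n => by
    refine Integrable.of_bound ?_ (Real.log ((n : ℝ) + 1))
      (ae_of_all _ fun z => abs_log_clip_le (hK n))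
    exact (Real.measurable_log.comp
      ((measurable_clip _).comp measurable_density)).aestronglyMeasurable
  -- the positive parts are dominated by the density, so the absolute values are bounded in mean
  have habs : ∀ n : ℕ, ∫ z, |Real.log (clip ((n : ℝ) + 1) (density σ z))| ∂arcMeasure ≤
      2 - Real.log e + Real.log 3 := by
    intro n
    have h1 := log_le_integral_log_clip hE he he0 (hK n)
    have h2 : ∀ z, |Real.log (clip ((n : ℝ) + 1) (density σ z))| ≤
        2 * density σ z - Real.log (clip ((n : ℝ) + 1) (density σ z)) := by
      intro z
      set c := clip ((n : ℝ) + 1) (density σ z) with hc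
      have hd := density_nonneg (σ := σ) z
      have h3 : Real.log c ≤ density σ z := by
        rw [hc, log_clip_decomp (hK n)]
        have h4 : Real.log (max (min (density σ z) ((n : ℝ) + 1)) 1) ≤ density σ z := by
          rcases le_total (density σ z) 1 with h | h
          · rw [max_eq_right ((min_le_left _ _).trans h), Real.log_one]
            exact hd
          · refine (Real.log_le_log (by positivity)
              (max_le (min_le_left _ _) h)).trans ?_
            have := Real.log_le_sub_one_of_pos (x := density σ z) (by linarith)
            linarith
        have h5 : Real.log (max (min (density σ z) 1) ((n : ℝ) + 1)⁻¹) ≤ 0 :=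
          Real.log_nonpos (le_max_of_le_right (by positivity))
            (max_le (min_le_right _ _) (inv_le_one_of_one_le₀ (hK n)))
        linarith
      rw [abs_le]
      constructor <;> linarith
    have h3 : Real.log (1 + ((n : ℝ) + 1)⁻¹ + Real.exp (-((n : ℝ) + 1))) ≤ Real.log 3 := by
      refine Real.log_le_log (by positivity) ?_
      have h4 : ((n : ℝ) + 1)⁻¹ ≤ 1 := inv_le_one_of_one_le₀ (hK n)
      have h5 : Real.exp (-((n : ℝ) + 1)) ≤ 1 := Real.exp_le_one_iff.2 (by have := hK n; linarith)
      linarith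
    calc _ ≤ ∫ z, (2 * density σ z - Real.log (clip ((n : ℝ) + 1) (density σ z))) ∂arcMeasure :=
          integral_mono (hclipi n).abs ((integrable_density.const_mul 2).sub (hclipi n)) h2
      _ ≤ _ := by
          rw [integral_sub (integrable_density.const_mul 2) (hclipi n), integral_const_mul]
          have := integral_density_le_one (σ := σ)
          linarith
  have hfatou : ∫⁻ z, liminf (fun n : ℕ => ENNReal.ofReal
      |Real.log (clip ((n : ℝ) + 1) (density σ z))|) atTop ∂arcMeasure ≤
      ENNReal.ofReal (2 - Real.log e + Real.log 3) := by
    refine (lintegral_liminf_le fun n => ?_).trans ?_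
    · exact (Real.measurable_log.comp
        ((measurable_clip _).comp measurable_density)).abs.ennreal_ofReal
    · refine liminf_le_of_frequently_le' (Frequently.of_forall fun n => ?_)
      rw [← ofReal_integral_eq_lintegral_ofReal (hclipi n).abs (ae_of_all _ fun z => abs_nonneg _)]
      exact ENNReal.ofReal_le_ofReal (habs n)
  have hfin : ∀ᵐ z ∂arcMeasure, liminf (fun n : ℕ => ENNReal.ofReal
      |Real.log (clip ((n : ℝ) + 1) (density σ z))|) atTop < ⊤ := by
    refine ae_lt_top' ?_ (ne_top_of_le_ne_top ENNReal.ofReal_ne_top hfatou)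
    refine (Measurable.liminf fun n => ?_).aemeasurable
    exact (Real.measurable_log.comp
      ((measurable_clip _).comp measurable_density)).abs.ennreal_ofReal
  have hpos : ∀ᵐ z ∂arcMeasure, 0 < density σ z := by
    filter_upwards [hfin] with z hz
    refine lt_of_le_of_ne (density_nonneg z) fun h0 => ?_
    have h1 : Tendsto (fun n : ℕ => ENNReal.ofReal
        |Real.log (clip ((n : ℝ) + 1) (density σ z))|) atTop (𝓝 ⊤) := by
      have h2 : ∀ n : ℕ, |Real.log (clip ((n : ℝ) + 1) (density σ z))| =
          Real.log ((n : ℝ) + 1) := fun n => by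
        rw [← h0, clip, min_eq_left (by positivity), max_eq_right (by positivity), Real.log_inv,
          abs_neg, abs_of_nonneg (Real.log_nonneg (hK n))]
      simp_rw [h2]
      refine ENNReal.tendsto_ofReal_nhds_top.2 ?_
      refine Real.tendsto_log_atTop.comp ?_
      exact tendsto_atTop_add_const_right _ _ tendsto_natCast_atTop_atTop
    rw [h1.liminf_eq] at hz
    exact lt_irrefl _ hz
  have hlim : ∀ᵐ z ∂arcMeasure, Tendsto (fun n : ℕ =>
      Real.log (clip ((n : ℝ) + 1) (density σ z))) atTop (𝓝 (Real.log (density σ z))) := by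
    filter_upwards [hpos] with z hz
    exact (Real.continuousAt_log hz.ne').tendsto.comp (tendsto_clip hz.le)
  have hint : Integrable (fun z => Real.log (density σ z)) arcMeasure := by
    refine ⟨(Real.measurable_log.comp measurable_density).aestronglyMeasurable, ?_⟩
    rw [hasFiniteIntegral_iff_norm]
    refine lt_of_le_of_lt ?_ (lt_of_le_of_lt hfatou ENNReal.ofReal_lt_top)
    refine lintegral_mono_ae ?_
    filter_upwards [hlim] with z hz
    have h1 : Tendsto (fun n : ℕ => ENNReal.ofReal
        |Real.log (clip ((n : ℝ) + 1) (density σ z))|) atTop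
        (𝓝 (ENNReal.ofReal |Real.log (density σ z)|)) :=
      (ENNReal.continuous_ofReal.tendsto _).comp hz.abs
    rw [h1.liminf_eq, Real.norm_eq_abs]
  refine ⟨hpos, hint, ?_⟩
  have hconv : Tendsto (fun n : ℕ => ∫ z, Real.log (clip ((n : ℝ) + 1) (density σ z)) ∂arcMeasure)
      atTop (𝓝 (∫ z, Real.log (density σ z) ∂arcMeasure)) := by
    refine tendsto_integral_of_dominated_convergence (fun z => |Real.log (density σ z)|)
      (fun n => (hclipi n).1) hint.abs (fun n => ?_) hlim
    filter_upwards [hpos] with z hz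
    exact abs_log_clip_le_abs_log (hK n) hz
  have hleft : Tendsto (fun n : ℕ => Real.log e -
      Real.log (1 + ((n : ℝ) + 1)⁻¹ + Real.exp (-((n : ℝ) + 1)))) atTop
      (𝓝 (Real.log e - Real.log (1 + 0 + 0))) := by
    have hn : Tendsto (fun n : ℕ => (n : ℝ) + 1) atTop atTop :=
      tendsto_atTop_add_const_right _ _ tendsto_natCast_atTop_atTop
    refine tendsto_const_nhds.sub ?_
    refine (Real.continuousAt_log (by norm_num)).tendsto.comp ?_
    exact (tendsto_const_nhds.add (tendsto_inv_atTop_zero.comp hn)).add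
      (Real.tendsto_exp_neg_atTop_nhds_zero.comp hn)
  have := le_of_tendsto_of_tendsto' hleft hconv fun n => log_le_integral_log_clip hE he he0 (hK n)
  simpa using this

end Entropy

/-! ### Fatou's theorem for Poisson integrals -/

theorem integral_arcMeasure_eq_circleAverage {F : Type*} [NormedAddCommGroup F] [NormedSpace ℝ F]
    (f : ℂ → F) : ∫ z : Circle, f z ∂arcMeasure = Real.circleAverage f 0 1 := by
  rw [integral_arcMeasure _ 0, Real.circleAverage_def, zero_add]
  simp [circleMap, Circle.coe_exp]

theorem integral_comp_div {F : Type*} [NormedAddCommGroup F] [NormedSpace ℝ F]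
    (f : Circle → F) (z : Circle) :
    ∫ w, f (w / z) ∂arcMeasure = ∫ w, f w ∂arcMeasure := by
  obtain ⟨θ, rfl⟩ := Circle.exp_surjective z
  rw [integral_arcMeasure _ 0, integral_arcMeasure f (-θ)]
  simp_rw [← Circle.exp_sub]
  rw [intervalIntegral.integral_comp_sub_right (fun x => f (Circle.exp x)) θ]
  congr 2 <;> ring

/-- The Poisson kernel of the disk at the point `r` of the radius, on the circle. -/
def pker (r : ℝ) (u : Circle) : ℝ := (1 - r ^ 2) / ‖(u : ℂ) - r‖ ^ 2

theorem pker_nonneg {r : ℝ} (h0 : 0 ≤ r) (h1 : r < 1) (u : Circle) : 0 ≤ pker r u :=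
  div_nonneg (by nlinarith) (sq_nonneg _)

theorem coe_sub_ne_zero {r : ℝ} (h0 : 0 ≤ r) (h1 : r < 1) (u : Circle) : (u : ℂ) - r ≠ 0 := by
  intro h
  have h2 : ‖(u : ℂ)‖ = ‖(r : ℂ)‖ := by rw [sub_eq_zero.1 h]
  rw [Circle.norm_coe, Complex.norm_real, Real.norm_eq_abs, abs_of_nonneg h0] at h2
  linarith

theorem continuous_pker {r : ℝ} (h0 : 0 ≤ r) (h1 : r < 1) : Continuous (pker r) := by
  unfold pker
  refine continuous_const.div (by fun_prop) fun u => ?_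
  exact pow_ne_zero 2 (norm_ne_zero_iff.2 (coe_sub_ne_zero h0 h1 u))

theorem integral_pker {r : ℝ} (h0 : 0 ≤ r) (h1 : r < 1) : ∫ u, pker r u ∂arcMeasure = 1 := by
  have h := DiffContOnCl.circleAverage_poissonKernel_smul (f := fun _ : ℂ => (1 : ℂ)) (c := 0)
    (R := 1) (w := (r : ℂ)) diffContOnCl_const
    (by simp [abs_of_nonneg h0, h1])
  rw [← integral_arcMeasure_eq_circleAverage] at h
  have h2 : ∀ u : Circle, (poissonKernel 0 (r : ℂ) • fun _ : ℂ => (1 : ℂ)) (u : ℂ) =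
      ((pker r u : ℝ) : ℂ) := fun u => by
    simp [poissonKernel, pker, Pi.smul_apply', Circle.norm_coe]
  simp_rw [h2] at h
  rw [integral_complex_ofReal] at h
  exact_mod_cast h

theorem norm_exp_sub_sq (r t : ℝ) :
    ‖((Circle.exp t : Circle) : ℂ) - r‖ ^ 2 = (1 - r) ^ 2 + 4 * r * Real.sin (t / 2) ^ 2 := by
  rw [← Complex.normSq_eq_norm_sq, Circle.coe_exp, Complex.normSq_apply]
  have h1 : Real.cos t = 1 - 2 * Real.sin (t / 2) ^ 2 := by
    have := Real.cos_two_mul (t / 2)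
    rw [mul_div_cancel₀ _ two_ne_zero] at this
    have h2 := Real.sin_sq_add_cos_sq (t / 2)
    linarith
  have h2 := Real.sin_sq_add_cos_sq t
  simp only [Complex.sub_re, Complex.exp_ofReal_mul_I_re, Complex.ofReal_re, Complex.sub_im,
    Complex.exp_ofReal_mul_I_im, Complex.ofReal_im, sub_zero]
  have h3 : r * Real.cos t = r * (1 - 2 * Real.sin (t / 2) ^ 2) := by rw [h1]
  linarith

theorem pker_exp_le_two_div {r t : ℝ} (h0 : 1 / 2 ≤ r) (h1 : r < 1) :
    pker r (Circle.exp t) ≤ 2 / (1 - r) := by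
  have hδ : 0 < 1 - r := by linarith
  rw [pker, norm_exp_sub_sq]
  have h2 : (1 - r) ^ 2 ≤ (1 - r) ^ 2 + 4 * r * Real.sin (t / 2) ^ 2 := by
    have := sq_nonneg (Real.sin (t / 2))
    nlinarith
  calc _ ≤ (1 - r ^ 2) / (1 - r) ^ 2 := by
        gcongr
        nlinarith
    _ ≤ _ := by
        rw [div_le_div_iff₀ (by positivity) hδ]
        nlinarith [pow_pos hδ 2]

theorem pker_exp_le_div_sq {r t : ℝ} (h0 : 1 / 2 ≤ r) (h1 : r < 1) (ht : |t| ≤ Real.pi)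
    (ht0 : t ≠ 0) : pker r (Circle.exp t) ≤ 10 * (1 - r) / t ^ 2 := by
  have hδ : 0 < 1 - r := by linarith
  rw [pker, norm_exp_sub_sq]
  have hs : |t| / Real.pi ≤ |Real.sin (t / 2)| := by
    have h := Real.mul_abs_le_abs_sin (x := t / 2) (by rw [abs_div, abs_two]; linarith)
    rw [abs_div, abs_two] at h
    calc _ = 2 / Real.pi * (|t| / 2) := by ring
      _ ≤ _ := h
  have hs2 : t ^ 2 / Real.pi ^ 2 ≤ Real.sin (t / 2) ^ 2 := by
    have := pow_le_pow_left₀ (by positivity) hs 2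
    rwa [div_pow, sq_abs, sq_abs] at this
  have hpi : Real.pi ^ 2 ≤ 10 := by nlinarith [Real.pi_lt_d2, Real.pi_pos]
  have ht2 : 0 < t ^ 2 := by positivity
  have hs3 : t ^ 2 / 10 ≤ Real.sin (t / 2) ^ 2 := by
    refine le_trans ?_ hs2
    gcongr
  have h2 : t ^ 2 / 5 ≤ (1 - r) ^ 2 + 4 * r * Real.sin (t / 2) ^ 2 := by
    nlinarith [sq_nonneg (1 - r)]
  calc _ ≤ (1 - r ^ 2) / (t ^ 2 / 5) := by
        gcongr
        nlinarith
    _ ≤ _ := by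
        rw [div_le_div_iff₀ (by positivity) ht2]
        nlinarith

/-- The Poisson kernel is dominated by a geometric combination of normalized indicators of
intervals. -/
theorem exists_pker_exp_le {r t : ℝ} (h0 : 1 / 2 ≤ r) (h1 : r < 1) (ht : |t| ≤ Real.pi) :
    ∃ k : ℕ, |t| ≤ 2 ^ k * (1 - r) ∧
      pker r (Circle.exp t) ≤ 40 * (1 / 4) ^ k / (1 - r) := by
  have hδ : 0 < 1 - r := by linarith
  have hex : ∃ k : ℕ, |t| ≤ 2 ^ k * (1 - r) := by
    obtain ⟨k, hk⟩ := pow_unbounded_of_one_lt (|t| / (1 - r)) (one_lt_two (α := ℝ))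
    exact ⟨k, by rw [div_lt_iff₀ hδ] at hk; exact hk.le⟩
  classical
  refine ⟨Nat.find hex, Nat.find_spec hex, ?_⟩
  rcases hk : Nat.find hex with _ | k
  · refine (pker_exp_le_two_div h0 h1).trans ?_
    rw [pow_zero, mul_one]
    gcongr
    norm_num
  · have h2 := Nat.find_min hex (m := k) (by lia)
    push Not at h2
    have ht0 : t ≠ 0 := by
      rintro rfl
      rw [abs_zero] at h2
      have : 0 < 2 ^ k * (1 - r) := by positivity
      linarith
    refine (pker_exp_le_div_sq h0 h1 ht ht0).trans ?_
    have h3 : (2 ^ k * (1 - r)) ^ 2 ≤ t ^ 2 := by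
      rw [← sq_abs t]
      gcongr
    calc _ ≤ 10 * (1 - r) / (2 ^ k * (1 - r)) ^ 2 := by gcongr
      _ = _ := by
        have h4 : ((1 : ℝ) / 4) ^ (k + 1) = (1 / 4) * ((2 : ℝ) ^ k)⁻¹ ^ 2 := by
          rw [pow_succ, mul_comm, ← inv_pow, ← pow_mul, mul_comm k 2, pow_mul]
          norm_num
        rw [h4]
        field_simp
        norm_num

/-- The part of the Poisson average near a Lebesgue point. -/
theorem lintegral_pker_near_le {φ : ℝ → ENNReal} (hφ : AEMeasurable φ) {θ s₀ ε : ℝ}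
    (hs₀ : s₀ ≤ Real.pi) (hs₀' : 0 < s₀) (hε : 0 ≤ ε)
    (h : ∀ s, 0 < s → s ≤ s₀ → ∫⁻ x in Metric.closedBall θ s, φ x ≤ ENNReal.ofReal (ε * s))
    {r : ℝ} (h0 : 1 / 2 ≤ r) (h1 : r < 1) :
    ∫⁻ x in Metric.closedBall θ s₀, ENNReal.ofReal (pker r (Circle.exp (x - θ))) * φ x ≤
      ENNReal.ofReal (80 * ε) := by
  have hδ : 0 < 1 - r := by linarith
  calc _ ≤ ∫⁻ x in Metric.closedBall θ s₀, ∑' k : ℕ, ENNReal.ofReal (40 * (1 / 4) ^ k / (1 - r)) *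
        (Metric.closedBall θ (2 ^ k * (1 - r))).indicator φ x := by
        refine setLIntegral_mono' Metric.isClosed_closedBall.measurableSet fun x hx => ?_
        rw [Metric.mem_closedBall, Real.dist_eq] at hx
        obtain ⟨k, hk, hk'⟩ := exists_pker_exp_le h0 h1 (hx.trans hs₀)
        refine le_trans ?_ (ENNReal.le_tsum k)
        rw [Set.indicator_of_mem (by rwa [Metric.mem_closedBall, Real.dist_eq])]
        gcongr
    _ = ∑' k : ℕ, ENNReal.ofReal (40 * (1 / 4) ^ k / (1 - r)) *
        ∫⁻ x in Metric.closedBall θ s₀, (Metric.closedBall θ (2 ^ k * (1 - r))).indicator φ x := by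
        have hm : ∀ k : ℕ, AEMeasurable ((Metric.closedBall θ (2 ^ k * (1 - r))).indicator φ)
            (volume.restrict (Metric.closedBall θ s₀)) := fun k =>
          (hφ.indicator Metric.isClosed_closedBall.measurableSet).restrict
        rw [lintegral_tsum fun k => (hm k).const_mul _]
        congr 1 with k
        rw [lintegral_const_mul'' _ (hm k)]
    _ ≤ ∑' k : ℕ, ENNReal.ofReal (40 * ε * (1 / 2) ^ k) := by
        refine ENNReal.tsum_le_tsum fun k => ?_
        rw [lintegral_indicator Metric.isClosed_closedBall.measurableSet,
          Measure.restrict_restrict Metric.isClosed_closedBall.measurableSet]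
        have h2 : ∫⁻ x in Metric.closedBall θ (2 ^ k * (1 - r)) ∩ Metric.closedBall θ s₀, φ x ≤
            ENNReal.ofReal (ε * (2 ^ k * (1 - r))) := by
          rcases le_total (2 ^ k * (1 - r)) s₀ with hle | hle
          · exact (lintegral_mono_set Set.inter_subset_left).trans (h _ (by positivity) hle)
          · refine (lintegral_mono_set Set.inter_subset_right).trans ((h _ hs₀' le_rfl).trans ?_)
            gcongr
        calc _ ≤ ENNReal.ofReal (40 * (1 / 4) ^ k / (1 - r)) *
              ENNReal.ofReal (ε * (2 ^ k * (1 - r))) := by gcongr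
          _ = _ := by
            rw [← ENNReal.ofReal_mul (by positivity)]
            congr 1
            have h4 : ((1 : ℝ) / 4) ^ k * 2 ^ k = (1 / 2) ^ k := by
              rw [← mul_pow]; norm_num
            rw [← h4]
            field_simp
    _ = ENNReal.ofReal (80 * ε) := by
        rw [← ENNReal.ofReal_tsum_of_nonneg (fun k => by positivity)
          ((summable_geometric_two).mul_left _), tsum_mul_left, tsum_geometric_two]
        congr 1
        ring

theorem locallyIntegrable_comp_exp {F : Type*} [NormedAddCommGroup F] {f : Circle → F}
    (hf : Integrable f arcMeasure) :
    LocallyIntegrable (fun x : ℝ => f (Circle.exp x)) volume := by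
  rw [locallyIntegrable_iff]
  intro K hK
  obtain ⟨R, hR⟩ := hK.isBounded.subset_closedBall 0
  refine IntegrableOn.mono_set ?_ (hR.trans (Real.closedBall_eq_Icc).subset)
  rcases le_total 0 R with h | h
  · rw [← intervalIntegrable_iff_integrableOn_Icc_of_le (by linarith)]
    exact intervalIntegrable_comp_exp hf _ _
  · refine IntegrableOn.mono_set (t := Set.Icc 0 0) ?_ (Set.Icc_subset_Icc ?_ ?_)
    · simp
    all_goals linarith

theorem integral_pker_mul_eq {F : Type*} [NormedAddCommGroup F] [NormedSpace ℝ F]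
    (g : Circle → F) (r θ : ℝ) :
    ∫ w, pker r (w / Circle.exp θ) • g w ∂arcMeasure =
      (2 * Real.pi)⁻¹ • ∫ x in Set.Ioc (θ - Real.pi) (θ + Real.pi),
        pker r (Circle.exp (x - θ)) • g (Circle.exp x) := by
  rw [integral_arcMeasure _ (θ - Real.pi), intervalIntegral.integral_of_le
    (by linarith [Real.pi_pos])]
  have : θ - Real.pi + 2 * Real.pi = θ + Real.pi := by ring
  rw [this]
  simp_rw [Circle.exp_sub]

/-- Fatou's theorem: Poisson integrals of integrable functions converge radially to the function,
almost everywhere. -/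
theorem fatou {F : Type*} [NormedAddCommGroup F] [NormedSpace ℝ F] [CompleteSpace F]
    {g : Circle → F} (hg : Integrable g arcMeasure) :
    ∀ᵐ z ∂arcMeasure, Tendsto (fun r : ℝ => ∫ w, pker r (w / z) • g w ∂arcMeasure) (𝓝[<] 1)
      (𝓝 (g z)) := by
  refine ae_arcMeasure_of_ae ?_
  set G : ℝ → F := fun x => g (Circle.exp x) with hG
  have hloc : LocallyIntegrable G := locallyIntegrable_comp_exp hg
  filter_upwards [(Besicovitch.vitaliFamily volume).ae_tendsto_average_norm_sub hloc] with θ hθ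
  have hθ := hθ.comp (Besicovitch.tendsto_filterAt volume θ)
  set I := Set.Ioc (θ - Real.pi) (θ + Real.pi) with hI
  have hlocθ : LocallyIntegrable (fun x => G x - G θ) := hloc.sub (locallyIntegrable_const _)
  have hballi : ∀ s, IntegrableOn (fun x => G x - G θ) (Metric.closedBall θ s) := fun s =>
    hlocθ.integrableOn_isCompact (isCompact_closedBall _ _)
  have hIball : I ⊆ Metric.closedBall θ Real.pi := by
    rw [Real.closedBall_eq_Icc]; exact Set.Ioc_subset_Icc_self
  have hIi : IntegrableOn (fun x => G x - G θ) I := (hballi _).mono_set hIball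
  set A := ∫ x in I, ‖G x - G θ‖ with hA
  have hA0 : 0 ≤ A := integral_nonneg fun _ => norm_nonneg _
  rw [Metric.tendsto_nhds]
  intro ε hε
  set η := ε / 200 with hη
  have hη0 : 0 < η := by positivity
  obtain ⟨s₁, hs₁, hs₁'⟩ : ∃ s₁ > 0, ∀ s, 0 < s → s < s₁ →
      ⨍ y in Metric.closedBall θ s, ‖G y - G θ‖ < η := by
    have h2 := hθ.eventually (gt_mem_nhds hη0)
    rw [eventually_nhdsWithin_iff, Metric.eventually_nhds_iff] at h2
    obtain ⟨s₁, hs₁, h3⟩ := h2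
    refine ⟨s₁, hs₁, fun s hs hs' => h3 ?_ hs⟩
    rw [Real.dist_eq, sub_zero, abs_of_pos hs]
    exact hs'
  set s₀ := min (s₁ / 2) 1 with hs₀
  have hs₀0 : 0 < s₀ := lt_min (by linarith) one_pos
  have hs₀pi : s₀ ≤ Real.pi := (min_le_right _ _).trans (by linarith [Real.pi_gt_three])
  have hsmall : ∀ s, 0 < s → s ≤ s₀ →
      ∫⁻ x in Metric.closedBall θ s, ‖G x - G θ‖ₑ ≤ ENNReal.ofReal (2 * η * s) := by
    intro s hs hs'
    rw [← ofReal_integral_norm_eq_lintegral_enorm (hballi s)]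
    refine ENNReal.ofReal_le_ofReal ?_
    have h2 := hs₁' s hs (lt_of_le_of_lt (hs'.trans (min_le_left _ _)) (by linarith))
    rw [setAverage_eq, Real.volume_real_closedBall hs.le, smul_eq_mul,
      inv_mul_lt_iff₀ (by positivity)] at h2
    linarith
  have hlim : Tendsto (fun r : ℝ => 10 * (1 - r) / s₀ ^ 2 * A) (𝓝[<] 1) (𝓝 0) := by
    have : Tendsto (fun r : ℝ => 10 * (1 - r) / s₀ ^ 2 * A) (𝓝 1)
        (𝓝 (10 * (1 - 1) / s₀ ^ 2 * A)) := Continuous.tendsto (by fun_prop) 1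
    rw [sub_self, mul_zero, zero_div, zero_mul] at this
    exact this.mono_left nhdsWithin_le_nhds
  filter_upwards [hlim.eventually (gt_mem_nhds (show (0 : ℝ) < ε / 10 by positivity)),
    Ioo_mem_nhdsLT (show (1 / 2 : ℝ) < 1 by norm_num)] with r hr hr'
  have h0 : 1 / 2 ≤ r := hr'.1.le
  have h00 : 0 ≤ r := by linarith
  have h1 : r < 1 := hr'.2
  have hδ : 0 < 1 - r := by linarith
  -- the kernel has total mass one, so the error is an average of `G x - G θ`
  have hone : (2 * Real.pi)⁻¹ • ∫ x in I, pker r (Circle.exp (x - θ)) • G θ = G θ := by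
    have h2 : ∫ w, pker r (w / Circle.exp θ) • G θ ∂arcMeasure = G θ := by
      rw [integral_smul_const, integral_comp_div, integral_pker h00 h1, one_smul]
    have h3 := integral_pker_mul_eq (fun _ => G θ) r θ
    rw [← h3, h2]
  have hkc : Continuous fun x : ℝ => pker r (Circle.exp (x - θ)) :=
    (continuous_pker h00 h1).comp (Circle.exp.continuous.comp (continuous_id.sub continuous_const))
  have hkb : ∀ x : ℝ, ‖pker r (Circle.exp (x - θ))‖ ≤ 2 / (1 - r) := fun x => by
    rw [Real.norm_eq_abs, abs_of_nonneg (pker_nonneg h00 h1 _)]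
    exact pker_exp_le_two_div h0 h1
  have hki : ∀ u : ℝ → F, IntegrableOn u I →
      IntegrableOn (fun x => pker r (Circle.exp (x - θ)) • u x) I := fun u hu =>
    Integrable.bdd_smul hu (2 / (1 - r)) hkc.aestronglyMeasurable (ae_of_all _ hkb)
  have hGi : IntegrableOn G I :=
    (hloc.integrableOn_isCompact (isCompact_closedBall θ Real.pi)).mono_set hIball
  have hconsti : IntegrableOn (fun _ : ℝ => G θ) I := by
    refine integrableOn_const ?_
    rw [hI, Real.volume_Ioc]
    exact ENNReal.ofReal_ne_top
  have hdiff : (∫ w, pker r (w / Circle.exp θ) • g w ∂arcMeasure) - g (Circle.exp θ) =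
      (2 * Real.pi)⁻¹ • ∫ x in I, pker r (Circle.exp (x - θ)) • (G x - G θ) := by
    rw [integral_pker_mul_eq]
    change _ - G θ = _
    conv_lhs => rw [← hone]
    rw [← smul_sub, ← integral_sub (hki _ hGi) (hki _ hconsti)]
    simp_rw [smul_sub]
  rw [dist_eq_norm, hdiff, norm_smul, Real.norm_eq_abs, abs_of_pos (by positivity)]
  have hnorm : ‖∫ x in I, pker r (Circle.exp (x - θ)) • (G x - G θ)‖ ≤
      160 * η + 10 * (1 - r) / s₀ ^ 2 * A := by
    refine (norm_integral_le_integral_norm _).trans ?_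
    rw [← ENNReal.ofReal_le_ofReal_iff (by positivity),
      ofReal_integral_norm_eq_lintegral_enorm (hki _ hIi)]
    have hen : ∀ x, ‖pker r (Circle.exp (x - θ)) • (G x - G θ)‖ₑ =
        ENNReal.ofReal (pker r (Circle.exp (x - θ))) * ‖G x - G θ‖ₑ := fun x => by
      rw [enorm_smul, Real.enorm_of_nonneg (pker_nonneg h00 h1 _)]
    simp_rw [hen]
    rw [ENNReal.ofReal_add (by positivity) (by positivity)]
    rw [← lintegral_inter_add_sdiff (μ := volume) _ I
      (Metric.isClosed_closedBall (x := θ) (ε := s₀)).measurableSet]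
    refine add_le_add ?_ ?_
    · refine (lintegral_mono_set Set.inter_subset_right).trans ?_
      have := lintegral_pker_near_le (φ := fun x => ‖G x - G θ‖ₑ)
        hlocθ.aestronglyMeasurable.enorm hs₀pi hs₀0 (by positivity) hsmall h0 h1
      refine this.trans (ENNReal.ofReal_le_ofReal ?_)
      linarith
    · calc _ ≤ ∫⁻ x in I \ Metric.closedBall θ s₀,
            ENNReal.ofReal (10 * (1 - r) / s₀ ^ 2) * ‖G x - G θ‖ₑ := by
            refine setLIntegral_mono' (measurableSet_Ioc.diff
              Metric.isClosed_closedBall.measurableSet) fun x hx => ?_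
            have hx1 := hIball hx.1
            have hx2 := hx.2
            rw [Metric.mem_closedBall, Real.dist_eq] at hx1 hx2
            push Not at hx2
            gcongr
            refine (pker_exp_le_div_sq h0 h1 hx1 ?_).trans ?_
            · intro h
              rw [h, abs_zero] at hx2
              linarith
            · rw [← sq_abs (x - θ)]
              gcongr
        _ ≤ ∫⁻ x in I, ENNReal.ofReal (10 * (1 - r) / s₀ ^ 2) * ‖G x - G θ‖ₑ :=
            lintegral_mono_set Set.sdiff_subset
        _ = _ := by
            rw [lintegral_const_mul'' _ hlocθ.aestronglyMeasurable.enorm.restrict,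
              ← ofReal_integral_norm_eq_lintegral_enorm hIi, ← ENNReal.ofReal_mul (by positivity)]
  have hpi : (2 * Real.pi)⁻¹ ≤ 1 := inv_le_one_of_one_le₀ (by linarith [Real.pi_gt_three])
  calc _ ≤ 1 * (160 * η + 10 * (1 - r) / s₀ ^ 2 * A) := by gcongr
    _ < ε := by rw [hη]; linarith

/-! ### Outer functions and their boundary values -/

theorem hasSum_congr_fun {f g : ℕ → ℂ} {a : ℂ} (h : ∀ n, f n = g n) :
    HasSum f a ↔ HasSum g a := by rw [funext h]

/-- The outer function with boundary modulus `exp (L / 2)`. The Szegő function is the case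
`L = log σ'`. -/
def outer (L : Circle → ℝ) (z : ℂ) : ℂ :=
  Complex.exp (1 / 2 * ∫ w : Circle, ((w : ℂ) + z) / ((w : ℂ) - z) * ((L w : ℝ) : ℂ) ∂arcMeasure)

theorem outer_zero {L : Circle → ℝ} :
    outer L 0 = ((Real.exp (1 / 2 * ∫ w, L w ∂arcMeasure) : ℝ) : ℂ) := by
  rw [outer]
  have : ∀ w : Circle, ((w : ℂ) + 0) / ((w : ℂ) - 0) * ((L w : ℝ) : ℂ) = ((L w : ℝ) : ℂ) :=
    fun w => by rw [add_zero, sub_zero, div_self w.coe_ne_zero, one_mul]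
  simp_rw [this]
  rw [integral_complex_ofReal]
  push_cast
  rfl

theorem differentiableOn_outer {L : Circle → ℝ} (hL : Integrable L arcMeasure) :
    DifferentiableOn ℂ (outer L) (Metric.ball 0 1) := by
  set f : ℂ → ℂ := fun ζ => ((L (Circle.exp (Complex.arg ζ)) : ℝ) : ℂ) with hf
  have hfc : ∀ w : Circle, f w = ((L w : ℝ) : ℂ) := fun w => by rw [hf]; simp [Circle.exp_arg]
  have hci : CircleIntegrable f 0 1 := by
    have h1 := intervalIntegrable_comp_exp (f := fun z => ((L z : ℝ) : ℂ)) (Integrable.ofReal hL) 0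
      (2 * Real.pi)
    refine h1.congr fun x _ => ?_
    have h2 := hfc (Circle.exp x)
    rw [Circle.coe_exp] at h2
    simp only [circleMap, Complex.ofReal_one, one_mul, zero_add]
    exact h2.symm
  have h := (analyticOnNhd_circleAverage_herglotzRieszKernel_smul hci).differentiableOn
  have h2 : outer L = fun z => Complex.exp (1 / 2 *
      Real.circleAverage (fun ζ => herglotzRieszKernel 0 z ζ • f ζ) 0 1) := by
    ext z
    rw [outer, ← integral_arcMeasure_eq_circleAverage]
    simp_rw [hfc, herglotzRieszKernel, sub_zero, smul_eq_mul]
  rw [h2]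
  exact (h.const_mul _).cexp

theorem pker_div (r : ℝ) (w z : Circle) :
    pker r (w / z) = (1 - r ^ 2) / ‖(w : ℂ) - r * z‖ ^ 2 := by
  rw [pker]
  congr 2
  have h : (w : ℂ) - r * z = z * (((w / z : Circle) : ℂ) - r) := by
    rw [Circle.coe_div]
    field_simp
  rw [h, norm_mul, Circle.norm_coe, one_mul]

theorem pker_div_comm (r : ℝ) (w z : Circle) : pker r (w / z) = pker r (z / w) := by
  rw [← inv_div z w, pker, pker]
  congr 2
  rw [← Complex.norm_conj, map_sub, Complex.conj_ofReal, ← Circle.coe_inv_eq_conj, inv_inv]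

theorem herglotz_re (r : ℝ) (w z : Circle) :
    (((w : ℂ) + r * z) / ((w : ℂ) - r * z)).re = pker r (w / z) := by
  have h := congrFun (poissonKernel_eq_re_herglotzRieszKernel (c := 0) (w := (r : ℂ) * z)) (w : ℂ)
  simp only [poissonKernel, herglotzRieszKernel, Function.comp_apply, sub_zero] at h
  rw [← h, pker_div]
  simp [Circle.norm_coe]

theorem integrable_pker_mul {F : Type*} [NormedAddCommGroup F] [NormedSpace ℝ F]
    {g : Circle → F} (hg : Integrable g arcMeasure) {r : ℝ} (h0 : 0 ≤ r) (h1 : r < 1)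
    (z : Circle) : Integrable (fun w => pker r (w / z) • g w) arcMeasure := by
  have hc : Continuous fun w : Circle => pker r (w / z) :=
    (continuous_pker h0 h1).comp (continuous_id.div_const z)
  obtain ⟨C, hC⟩ := isCompact_univ.exists_bound_of_continuousOn hc.continuousOn
  exact hg.bdd_smul C hc.aestronglyMeasurable (ae_of_all _ fun w => hC w (Set.mem_univ w))

theorem norm_outer_sq {L : Circle → ℝ} (hL : Integrable L arcMeasure) {r : ℝ} (h0 : 0 ≤ r)
    (h1 : r < 1) (z : Circle) :
    ‖outer L (r * z)‖ ^ 2 = Real.exp (∫ w, pker r (w / z) • L w ∂arcMeasure) := by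
  have hi : Integrable (fun w : Circle => ((w : ℂ) + r * z) / ((w : ℂ) - r * z) * ((L w : ℝ) : ℂ))
      arcMeasure := by
    have hne : ∀ w : Circle, (w : ℂ) - r * z ≠ 0 := by
      intro w h
      have h2 : ‖(w : ℂ)‖ = ‖(r : ℂ) * z‖ := by rw [sub_eq_zero.1 h]
      rw [norm_mul, Circle.norm_coe, Circle.norm_coe, mul_one, Complex.norm_real,
        Real.norm_eq_abs, abs_of_nonneg h0] at h2
      linarith
    have hc : Continuous fun w : Circle => ((w : ℂ) + r * z) / ((w : ℂ) - r * z) :=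
      Continuous.div (by fun_prop) (by fun_prop) hne
    obtain ⟨C, hC⟩ := isCompact_univ.exists_bound_of_continuousOn hc.continuousOn
    exact hL.ofReal.bdd_mul (c := C) hc.aestronglyMeasurable
      (ae_of_all _ fun w => hC w (Set.mem_univ w))
  rw [outer, Complex.norm_exp, sq, ← Real.exp_add]
  congr 1
  have h2 : ∀ x : ℂ, (1 / 2 * x).re + (1 / 2 * x).re = x.re := fun x => by
    simp [Complex.mul_re]
    ring
  rw [h2, ← integral_complex_re hi]
  congr 1 with w
  rw [Complex.re_mul_ofReal, herglotz_re, smul_eq_mul]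

/-- Jensen's inequality for the Poisson average of `L`. -/
theorem norm_outer_sq_le {L : Circle → ℝ} (hL : Integrable L arcMeasure)
    (hE : Integrable (fun w => Real.exp (L w)) arcMeasure) {r : ℝ} (h0 : 0 ≤ r) (h1 : r < 1)
    (z : Circle) :
    ‖outer L (r * z)‖ ^ 2 ≤ ∫ w, pker r (w / z) • Real.exp (L w) ∂arcMeasure := by
  rw [norm_outer_sq hL h0 h1]
  set c := ∫ w, pker r (w / z) • L w ∂arcMeasure with hc
  have hone : ∫ w, pker r (w / z) ∂arcMeasure = 1 := by
    rw [integral_comp_div (fun w => pker r w), integral_pker h0 h1]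
  have hi1 : Integrable (fun w => pker r (w / z) • (1 : ℝ)) arcMeasure :=
    integrable_pker_mul (integrable_const _) h0 h1 z
  have hi2 := integrable_pker_mul hL h0 h1 z
  have hle : ∀ w, Real.exp c * (1 - c) * (pker r (w / z) • (1 : ℝ)) +
      Real.exp c * (pker r (w / z) • L w) ≤ pker r (w / z) • Real.exp (L w) := by
    intro w
    have h2 := Real.add_one_le_exp (L w - c)
    have h3 : Real.exp (L w) = Real.exp c * Real.exp (L w - c) := by
      rw [← Real.exp_add]; congr 1; ring
    have h4 := pker_nonneg h0 h1 (w / z)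
    simp only [smul_eq_mul, mul_one]
    rw [h3]
    have h5 : 0 ≤ pker r (w / z) * Real.exp c := mul_nonneg h4 (Real.exp_pos _).le
    nlinarith
  have h := integral_mono ((hi1.const_mul _).add (hi2.const_mul _))
    (integrable_pker_mul hE h0 h1 z) hle
  simp only [Pi.add_apply] at h
  rw [integral_add (hi1.const_mul _) (hi2.const_mul _), integral_const_mul, integral_const_mul] at h
  simp only [smul_eq_mul, mul_one] at h hc
  rw [hone, ← hc] at h
  simp only [smul_eq_mul]
  linarith

theorem continuous_outer_mul {L : Circle → ℝ} (hL : Integrable L arcMeasure) {r : ℝ} (h0 : 0 ≤ r)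
    (h1 : r < 1) : Continuous fun z : Circle => outer L (r * z) := by
  refine (differentiableOn_outer hL).continuousOn.comp_continuous (by fun_prop) fun z => ?_
  rw [mem_ball_zero_iff, norm_mul, Circle.norm_coe, mul_one, Complex.norm_real, Real.norm_eq_abs,
    abs_of_nonneg h0]
  exact h1

/-- The outer function belongs to the Hardy space `H²`. -/
theorem integral_norm_outer_sq_le {L : Circle → ℝ} (hL : Integrable L arcMeasure)
    (hE : Integrable (fun w => Real.exp (L w)) arcMeasure) {r : ℝ} (h0 : 0 ≤ r) (h1 : r < 1) :
    ∫ z : Circle, ‖outer L (r * z)‖ ^ 2 ∂arcMeasure ≤ ∫ w, Real.exp (L w) ∂arcMeasure := by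
  have hker : Continuous fun p : Circle × Circle => pker r (p.2 / p.1) :=
    (continuous_pker h0 h1).comp (continuous_snd.div' continuous_fst)
  obtain ⟨C, hC⟩ := isCompact_univ.exists_bound_of_continuousOn hker.continuousOn
  have hprod : Integrable (Function.uncurry fun z w : Circle => pker r (w / z) • Real.exp (L w))
      (arcMeasure.prod arcMeasure) :=
    (hE.comp_snd arcMeasure).bdd_smul C hker.aestronglyMeasurable
      (ae_of_all _ fun p => hC p (Set.mem_univ p))
  calc _ ≤ ∫ z : Circle, ∫ w, pker r (w / z) • Real.exp (L w) ∂arcMeasure ∂arcMeasure := by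
        refine integral_mono ?_ hprod.integral_prod_left fun z => norm_outer_sq_le hL hE h0 h1 z
        exact integrable_continuousMap
          (⟨_, (continuous_outer_mul hL h0 h1).norm.pow 2⟩ : C(Circle, ℝ))
    _ = ∫ w : Circle, ∫ z, pker r (w / z) • Real.exp (L w) ∂arcMeasure ∂arcMeasure :=
        integral_integral_swap hprod
    _ = _ := by
        congr 1 with w
        rw [integral_smul_const]
        simp_rw [pker_div_comm r w]
        rw [integral_comp_div (fun w => pker r w), integral_pker h0 h1, one_smul]

theorem inner_zeta_zeta (j k : ℤ) :
    inner ℂ (emb arcMeasure (zeta j)) (emb arcMeasure (zeta k)) = if j = k then 1 else 0 := by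
  rw [inner_emb]
  simp_rw [conj_zeta_apply, ← ContinuousMap.mul_apply, zeta_mul]
  rw [integral_zeta]
  congr 1
  exact propext ⟨fun h => by lia, fun h => by lia⟩

theorem orthonormal_zeta : Orthonormal ℂ fun k : ℤ => emb arcMeasure (zeta k) := by
  rw [orthonormal_iff_ite]
  exact inner_zeta_zeta

/-- The Taylor coefficients at the origin of a function on the disk. -/
def taylorCoeff (f : ℂ → ℂ) (n : ℕ) : ℂ := (n.factorial : ℂ)⁻¹ * iteratedDeriv n f 0

theorem hasSum_taylorCoeff {f : ℂ → ℂ} (hf : DifferentiableOn ℂ f (Metric.ball 0 1)) {z : ℂ}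
    (hz : ‖z‖ < 1) : HasSum (fun n => taylorCoeff f n * z ^ n) (f z) := by
  have h := Complex.hasSum_taylorSeries_on_ball hf (z := z) (by simpa using hz)
  refine (hasSum_congr_fun fun n => ?_).1 h
  simp only [taylorCoeff, sub_zero, smul_eq_mul]
  ring

theorem taylorCoeff_zero (f : ℂ → ℂ) : taylorCoeff f 0 = f 0 := by simp [taylorCoeff]

theorem hasSum_taylorCoeff_zeta {f : ℂ → ℂ} (hf : DifferentiableOn ℂ f (Metric.ball 0 1)) {r : ℝ}
    (h0 : 0 ≤ r) (h1 : r < 1) {g : C(Circle, ℂ)} (hg : ∀ z : Circle, g z = f (r * z)) :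
    HasSum (fun n : ℕ => (taylorCoeff f n * (r : ℂ) ^ n) • zeta n) g := by
  have hr : ‖(r : ℂ)‖ < 1 := by
    rwa [Complex.norm_real, Real.norm_eq_abs, abs_of_nonneg h0]
  have hs : Summable fun n : ℕ => (taylorCoeff f n * (r : ℂ) ^ n) • zeta n := by
    refine Summable.of_norm ?_
    simp_rw [norm_smul, norm_zeta, mul_one]
    exact (hasSum_taylorCoeff hf hr).summable.norm
  have : ∑' n : ℕ, (taylorCoeff f n * (r : ℂ) ^ n) • zeta n = g := by
    ext z
    have h2 := (ContinuousMap.evalCLM ℂ z).hasSum hs.hasSum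
    have h3 := hasSum_taylorCoeff hf (z := r * z) (by rwa [norm_mul, Circle.norm_coe, mul_one])
    rw [hg]
    refine h2.unique ((hasSum_congr_fun fun n => ?_).2 h3)
    simp [zeta_apply, mul_pow, mul_assoc]
  have h2 := hs.hasSum
  rwa [this] at h2

theorem summable_taylorCoeff_sq {f : ℂ → ℂ} (hf : DifferentiableOn ℂ f (Metric.ball 0 1)) {M : ℝ}
    (hM : ∀ r : ℝ, 0 ≤ r → r < 1 → ∫ z : Circle, ‖f (r * z)‖ ^ 2 ∂arcMeasure ≤ M) :
    Summable fun n => ‖taylorCoeff f n‖ ^ 2 := by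
  refine summable_of_sum_range_le (c := M) (fun n => sq_nonneg _) fun N => ?_
  have key : ∀ r : ℝ, 0 ≤ r → r < 1 →
      ∑ n ∈ Finset.range N, ‖taylorCoeff f n‖ ^ 2 * (r ^ n) ^ 2 ≤ M := by
    intro r h0 h1
    have hc : Continuous fun z : Circle => f (r * z) := by
      refine hf.continuousOn.comp_continuous (by fun_prop) fun z => ?_
      rw [mem_ball_zero_iff, norm_mul, Circle.norm_coe, mul_one, Complex.norm_real,
        Real.norm_eq_abs, abs_of_nonneg h0]
      exact h1
    set g : C(Circle, ℂ) := ⟨_, hc⟩ with hg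
    have hsum := (emb arcMeasure).hasSum (hasSum_taylorCoeff_zeta hf h0 h1 (g := g) fun _ => rfl)
    have hcoef : ∀ n : ℕ, inner ℂ (emb arcMeasure (zeta n)) (emb arcMeasure g) =
        taylorCoeff f n * (r : ℂ) ^ n := by
      intro n
      have h2 := (innerSL ℂ (emb arcMeasure (zeta n))).hasSum hsum
      refine h2.unique ((hasSum_congr_fun fun m => ?_).2
        (hasSum_ite_eq n (taylorCoeff f n * (r : ℂ) ^ n)))
      simp only [map_smul, innerSL_apply_apply, smul_eq_mul, inner_zeta_zeta, Nat.cast_inj]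
      split_ifs with h3 h4 h4
      · rw [h3, mul_one]
      · exact absurd h3.symm h4
      · exact absurd h4.symm h3
      · rw [mul_zero]
    have hb := (orthonormal_zeta.comp _ (Nat.cast_injective (R := ℤ))).sum_inner_products_le
      (emb arcMeasure g) (s := Finset.range N)
    rw [norm_emb_sq] at hb
    refine le_trans (le_of_eq ?_) (hb.trans (hM r h0 h1))
    refine Finset.sum_congr rfl fun n _ => ?_
    rw [Function.comp_apply, hcoef, norm_mul, mul_pow, norm_pow, Complex.norm_real,
      Real.norm_eq_abs, abs_of_nonneg h0]
  have hlim : Tendsto (fun r : ℝ => ∑ n ∈ Finset.range N, ‖taylorCoeff f n‖ ^ 2 * (r ^ n) ^ 2)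
      (𝓝[<] 1) (𝓝 (∑ n ∈ Finset.range N, ‖taylorCoeff f n‖ ^ 2 * ((1 : ℝ) ^ n) ^ 2)) := by
    refine Tendsto.mono_left ?_ nhdsWithin_le_nhds
    exact Continuous.tendsto (by fun_prop) 1
  have := le_of_tendsto hlim (by
    filter_upwards [Ioo_mem_nhdsLT (show (0 : ℝ) < 1 by norm_num)] with r hr
    exact key r hr.1.le hr.2)
  simpa using this

theorem integral_pker_zeta {r : ℝ} (h0 : 0 ≤ r) (h1 : r < 1) (n : ℕ) (z : Circle) :
    ∫ w, pker r (w / z) • zeta n w ∂arcMeasure = ((r : ℂ) * z) ^ n := by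
  have h := DiffContOnCl.circleAverage_poissonKernel_smul (f := fun ζ : ℂ => ζ ^ n) (c := 0)
    (R := 1) (w := (r : ℂ)) (Differentiable.diffContOnCl (by fun_prop))
    (by simp [abs_of_nonneg h0, h1])
  rw [← integral_arcMeasure_eq_circleAverage] at h
  have h2 : ∀ u : Circle, (poissonKernel 0 (r : ℂ) • fun ζ : ℂ => ζ ^ n) (u : ℂ) =
      pker r u • (u : ℂ) ^ n := fun u => by
    simp [poissonKernel, pker, Pi.smul_apply', Circle.norm_coe]
  simp_rw [h2] at h
  have h3 : ∀ w : Circle, pker r (w / z) • zeta n w =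
      (fun u : Circle => pker r u • ((u : ℂ) ^ n * (z : ℂ) ^ n)) (w / z) := by
    intro w
    simp only [zeta_apply, zpow_natCast]
    rw [← mul_pow, Circle.coe_div, div_mul_cancel₀ _ z.coe_ne_zero]
  rw [integral_congr_ae (ae_of_all _ h3)]
  refine (integral_comp_div (fun u : Circle => pker r u • ((u : ℂ) ^ n * (z : ℂ) ^ n)) z).trans ?_
  simp_rw [← smul_mul_assoc]
  rw [integral_mul_const, h, mul_pow]

/-- A function on the disk whose `L²` means over circles are bounded is the Poisson integral of
a square integrable function with the same Taylor coefficients and no negative frequencies. -/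
theorem exists_hardy_boundary {f : ℂ → ℂ} (hf : DifferentiableOn ℂ f (Metric.ball 0 1)) {M : ℝ}
    (hM : ∀ r : ℝ, 0 ≤ r → r < 1 → ∫ z : Circle, ‖f (r * z)‖ ^ 2 ∂arcMeasure ≤ M) :
    ∃ B : Circle → ℂ, MemLp B 2 arcMeasure ∧ (∫ z, B z ∂arcMeasure = f 0) ∧
      (∀ n : ℕ, n ≠ 0 → ∫ z, (z : ℂ) ^ n * B z ∂arcMeasure = 0) ∧
      ∀ r : ℝ, 0 ≤ r → r < 1 → ∀ z : Circle,
        ∫ w, pker r (w / z) • B w ∂arcMeasure = f (r * z) := by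
  have hs := summable_taylorCoeff_sq hf hM
  have horth := orthonormal_zeta.comp _ (Nat.cast_injective (R := ℤ))
  have hsum : Summable fun n : ℕ => taylorCoeff f n • emb arcMeasure (zeta n) :=
    (horth.orthogonalFamily.summable_iff_norm_sq_summable fun n => taylorCoeff f n).2 hs
  obtain ⟨B, hB⟩ := hsum
  have hin : ∀ g : C(Circle, ℂ), inner ℂ (emb arcMeasure g) B =
      ∫ z, conj (g z) * B z ∂arcMeasure := by
    intro g
    rw [L2.inner_def]
    refine integral_congr_ae ?_
    filter_upwards [g.coeFn_toLp (p := 2) (𝕜 := ℂ) arcMeasure] with z hz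
    change inner ℂ ((ContinuousMap.toLp 2 arcMeasure ℂ g : Lp ℂ 2 arcMeasure) z) _ = _
    rw [hz]
    simp [mul_comm]
  have hco : ∀ k : ℤ, HasSum (fun n : ℕ => if (n : ℤ) = k then taylorCoeff f n else 0)
      (∫ z, zeta (-k) z * B z ∂arcMeasure) := by
    intro k
    have h2 := (innerSL ℂ (emb arcMeasure (zeta k))).hasSum hB
    rw [innerSL_apply_apply, hin] at h2
    simp_rw [conj_zeta_apply] at h2
    refine (hasSum_congr_fun fun n => ?_).1 h2
    simp only [map_smul, innerSL_apply_apply, smul_eq_mul, inner_zeta_zeta]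
    split_ifs with h3 h4 h4
    · rw [mul_one]
    · exact absurd h3.symm h4
    · exact absurd h4.symm h3
    · rw [mul_zero]
  refine ⟨B, Lp.memLp B, ?_, fun n hn => ?_, fun r h0 h1 z => ?_⟩
  · have h2 := hco 0
    simp only [neg_zero, zeta_zero, ContinuousMap.one_apply, one_mul] at h2
    rw [← taylorCoeff_zero f]
    refine h2.unique ((hasSum_congr_fun fun m => ?_).2 (hasSum_ite_eq 0 (taylorCoeff f 0)))
    split_ifs with h3 h4 h4
    · rw [h4]
    · exact absurd (by exact_mod_cast h3) h4
    · exact absurd (by exact_mod_cast h4) h3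
    · rfl
  · have h2 := hco (-n)
    rw [neg_neg] at h2
    simp_rw [zeta_apply, zpow_natCast] at h2
    refine h2.unique ((hasSum_congr_fun fun m => ?_).2 hasSum_zero)
    rw [if_neg (by lia)]
  · have hkc : Continuous fun w : Circle => ((pker r (w / z) : ℝ) : ℂ) :=
      Complex.continuous_ofReal.comp ((continuous_pker h0 h1).comp (continuous_id.div_const z))
    set k : C(Circle, ℂ) := ⟨_, hkc⟩ with hk
    have h2 := (innerSL ℂ (emb arcMeasure k)).hasSum hB
    rw [innerSL_apply_apply, hin] at h2
    have h3 := hasSum_taylorCoeff hf (z := r * z) (by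
      rwa [norm_mul, Circle.norm_coe, mul_one, Complex.norm_real, Real.norm_eq_abs,
        abs_of_nonneg h0])
    have h4 : ∀ w, conj (k w) * B w = pker r (w / z) • B w := fun w => by
      rw [hk]
      simp [Complex.conj_ofReal]
    simp_rw [h4] at h2
    refine h2.unique ((hasSum_congr_fun fun n => ?_).2 h3)
    rw [map_smul, innerSL_apply_apply, smul_eq_mul, inner_emb]
    congr 1
    rw [← integral_pker_zeta h0 h1]
    congr 1 with w
    rw [hk]
    simp [Complex.conj_ofReal, mul_comm]

/-- An outer function has radial limits almost everywhere, of the prescribed modulus. -/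
theorem outer_boundary {L : Circle → ℝ} (hL : Integrable L arcMeasure)
    (hE : Integrable (fun w => Real.exp (L w)) arcMeasure) :
    ∃ B : Circle → ℂ, MemLp B 2 arcMeasure ∧ (∫ z, B z ∂arcMeasure = outer L 0) ∧
      (∀ n : ℕ, n ≠ 0 → ∫ z, (z : ℂ) ^ n * B z ∂arcMeasure = 0) ∧
      (∀ᵐ z : Circle ∂arcMeasure, Tendsto (fun r : ℝ => outer L ((r : ℂ) * z)) (𝓝[<] 1) (𝓝 (B z))) ∧
      ∀ᵐ z ∂arcMeasure, ‖B z‖ ^ 2 = Real.exp (L z) := by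
  obtain ⟨B, hB2, hB0, hBn, hBP⟩ := exists_hardy_boundary (differentiableOn_outer hL)
    fun r h0 h1 => integral_norm_outer_sq_le hL hE h0 h1
  have hr : ∀ᶠ r : ℝ in 𝓝[<] 1, 0 ≤ r ∧ r < 1 := by
    filter_upwards [Ioo_mem_nhdsLT (show (0 : ℝ) < 1 by norm_num)] with r hr
    exact ⟨hr.1.le, hr.2⟩
  have hlim : ∀ᵐ z : Circle ∂arcMeasure,
      Tendsto (fun r : ℝ => outer L ((r : ℂ) * z)) (𝓝[<] 1) (𝓝 (B z)) := by
    filter_upwards [fatou (hB2.integrable one_le_two)] with z hz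
    exact hz.congr' (hr.mono fun r hr => hBP r hr.1 hr.2 z)
  refine ⟨B, hB2, hB0, hBn, hlim, ?_⟩
  filter_upwards [hlim, fatou hL] with z hz hz'
  refine tendsto_nhds_unique (hz.norm.pow 2) ?_
  refine ((Real.continuous_exp.tendsto _).comp hz').congr' (hr.mono fun r hr => ?_)
  exact (norm_outer_sq hL hr.1 hr.2 z).symm

/-! ### Mean square convergence of the reversed orthonormal polynomials -/

/-- The reversed orthonormal polynomial `φ_n^*` as a continuous function. -/
def phiS (σ : Measure Circle) [IsFiniteMeasure σ] (n : ℕ) : C(Circle, ℂ) :=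
  (((Real.sqrt (en σ n))⁻¹ : ℝ) : ℂ) • PhiS σ n

section

variable {σ : Measure Circle}

theorem revOP_eq [IsFiniteMeasure σ] (n : ℕ) (z : Circle) : revOP σ n z = phiS σ n z := by
  have h : ∫ z : Circle, ‖(monicOP σ n).eval (z : ℂ)‖ ^ 2 ∂σ = en σ n := by
    rw [en, norm_emb_sq]
    simp_rw [Phi, polC_apply]
  rw [revOP, orthonormalOP, h, Polynomial.eval_mul, Polynomial.eval_C, map_mul,
    Complex.conj_ofReal, phiS, PhiS]
  simp only [ContinuousMap.smul_apply, ContinuousMap.mul_apply, ContinuousMap.star_apply,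
    zeta_apply, zpow_natCast, smul_eq_mul, Phi, polC_apply, RCLike.star_def]
  ring

theorem integral_mul_eq_zero_of_mem_trigSpan {B : Circle → ℂ} (hB : Integrable B arcMeasure)
    (hBn : ∀ n : ℕ, n ≠ 0 → ∫ z, (z : ℂ) ^ n * B z ∂arcMeasure = 0) {n : ℕ} {f : C(Circle, ℂ)}
    (hf : f ∈ trigSpan 1 n) : ∫ z, f z * B z ∂arcMeasure = 0 := by
  have hi : ∀ f : C(Circle, ℂ), Integrable (fun z => f z * B z) arcMeasure := fun f =>
    hB.bdd_mul (c := ‖f‖) f.continuous.aestronglyMeasurable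
      (ae_of_all _ fun z => f.norm_coe_le_norm z)
  induction hf using Submodule.span_induction with
  | mem x hx =>
    obtain ⟨k, ⟨h1, h2⟩, rfl⟩ := hx
    obtain ⟨m, rfl⟩ := Int.eq_ofNat_of_zero_le (by lia : 0 ≤ k)
    simp_rw [zeta_apply, zpow_natCast]
    exact hBn m (by lia)
  | zero => simp
  | add x y _ _ hx hy =>
    simp_rw [ContinuousMap.add_apply, add_mul]
    rw [integral_add (hi x) (hi y), hx, hy, add_zero]
  | smul c x _ hx =>
    simp_rw [ContinuousMap.smul_apply, smul_mul_assoc]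
    rw [integral_smul, hx, smul_zero]

/-- The function `Π` is square integrable, and its distance to `φ_n^*` is governed by the quotient
of the limit of `‖Φ_n‖` and `‖Φ_n‖`. -/
theorem memLp_szegoPi_and_integral_le [IsProbabilityMeasure σ] {E : Set Circle}
    (hE : IsAcSet σ E) {e : ℝ} (he : ∀ n, e ≤ en σ n) (he0 : 0 < e) :
    MemLp (szegoPi σ E) 2 σ ∧ ∀ n, ∫ z, ‖phiS σ n z - szegoPi σ E z‖ ^ 2 ∂σ ≤
      2 - 2 * (Real.sqrt e / Real.sqrt (en σ n)) := by
  obtain ⟨hpos, hL, hint⟩ := szego_entropy hE he he0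
  have hexp : ∀ᵐ z ∂arcMeasure, Real.exp (Real.log (density σ z)) = density σ z := by
    filter_upwards [hpos] with z hz
    exact Real.exp_log hz
  have hEi : Integrable (fun z => Real.exp (Real.log (density σ z))) arcMeasure :=
    (integrable_congr hexp).2 integrable_density
  obtain ⟨B, hB2, hB0, hBn, hlim, hBsq⟩ := outer_boundary hL hEi
  have hBi := hB2.integrable one_le_two
  have hbd : ∀ᵐ z ∂arcMeasure, szegoBoundary σ z = B z := by
    filter_upwards [hlim] with z hz
    exact hz.limUnder_eq
  have hBu : ∀ᵐ z ∂arcMeasure, ‖B z‖ ^ 2 = density σ z ∧ B z ≠ 0 := by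
    filter_upwards [hBsq, hexp, hpos] with z h1 h2 h3
    rw [h2] at h1
    refine ⟨h1, fun h0 => ?_⟩
    rw [h0] at h1
    simp at h1
    exact h3.ne h1
  have hPiE : ∀ᵐ z ∂σ.restrict E, szegoPi σ E z = (B z)⁻¹ := by
    filter_upwards [ae_restrict_acSet hE hbd, ae_restrict_mem hE.1] with z h1 h2
    rw [szegoPi, Set.indicator_of_mem h2, h1]
  have hac : σ.restrict E ≪ arcMeasure := by
    rw [restrict_acSet hE]; exact withDensity_absolutelyContinuous _ _
  have hBinvm : AEStronglyMeasurable (fun z => (B z)⁻¹) (σ.restrict E) :=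
    (hB2.1.mono_ac hac).aemeasurable.inv.aestronglyMeasurable
  have hPim : AEStronglyMeasurable (szegoPi σ E) σ := by
    have h1 : AEStronglyMeasurable (E.indicator fun z => (B z)⁻¹) σ :=
      (aestronglyMeasurable_indicator_iff hE.1).2 hBinvm
    refine h1.congr ?_
    have h2 := (ae_restrict_iff' hE.1).1 hPiE
    filter_upwards [h2] with z hz
    by_cases hzE : z ∈ E
    · rw [Set.indicator_of_mem hzE, hz hzE]
    · rw [szegoPi, Set.indicator_of_notMem hzE, Set.indicator_of_notMem hzE]
  have hPiL : MemLp (szegoPi σ E) 2 σ := by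
    rw [memLp_two_iff_integrable_sq_norm hPim, ← integrableOn_univ, ← Set.union_compl_self E]
    refine IntegrableOn.union ?_ ?_
    · rw [integrableOn_acSet_iff hE]
      refine (integrable_congr ?_).2 (integrable_const (1 : ℝ))
      have hmem : ∀ᵐ z ∂arcMeasure, z ∈ E := hE.2.1
      filter_upwards [hbd, hBu, hmem] with z h1 h2 h3
      rw [szegoPi, Set.indicator_of_mem h3, h1, ← h2.1, norm_inv, inv_pow, smul_eq_mul]
      exact mul_inv_cancel₀ (pow_ne_zero 2 (norm_ne_zero_iff.2 h2.2))
    · refine (integrableOn_zero (ε' := ℝ)).congr_fun (fun z hz => ?_) hE.1.compl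
      rw [szegoPi, Set.indicator_of_notMem hz]
      simp
  refine ⟨hPiL, fun n => ?_⟩
  have hen : 0 < en σ n := he0.trans_le (he n)
  have hs : 0 < Real.sqrt (en σ n) := Real.sqrt_pos.2 hen
  -- the pairing of `φ_n^*` with the boundary function sees only the values at the origin
  have hpair : ∫ z, phiS σ n z * B z ∂arcMeasure =
      (((Real.sqrt (en σ n))⁻¹ *
        Real.exp (1 / 2 * ∫ w, Real.log (density σ w) ∂arcMeasure) : ℝ) : ℂ) := by
    have h1 := integral_mul_eq_zero_of_mem_trigSpan hBi hBn (PhiS_sub_one_mem (σ := σ) n)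
    have hi : Integrable (fun z => PhiS σ n z * B z) arcMeasure :=
      hBi.bdd_mul (c := ‖PhiS σ n‖) (PhiS σ n).continuous.aestronglyMeasurable
        (ae_of_all _ fun z => (PhiS σ n).norm_coe_le_norm z)
    simp_rw [ContinuousMap.sub_apply, ContinuousMap.one_apply, sub_mul, one_mul] at h1
    rw [integral_sub hi hBi, sub_eq_zero, hB0, outer_zero] at h1
    simp_rw [phiS, ContinuousMap.smul_apply, smul_mul_assoc]
    rw [integral_smul, h1, smul_eq_mul]
    push_cast
    rfl
  have hphi : ∫ z, ‖phiS σ n z‖ ^ 2 ∂σ = 1 := by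
    rw [← norm_emb_sq, phiS, map_smul, norm_smul, mul_pow, norm_PhiS_sq, Complex.norm_real,
      Real.norm_eq_abs, sq_abs, inv_pow, Real.sq_sqrt hen.le]
    exact inv_mul_cancel₀ hen.ne'
  have hphii : Integrable (fun z => ‖phiS σ n z‖ ^ 2) σ :=
    integrable_continuousMap (⟨_, (phiS σ n).continuous.norm.pow 2⟩ : C(Circle, ℝ))
  have hphim : Integrable (fun z => density σ z • ‖phiS σ n z‖ ^ 2) arcMeasure :=
    (integrableOn_acSet_iff hE _).1 hphii.integrableOn
  have hprodi : Integrable (fun z => phiS σ n z * B z) arcMeasure :=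
    hBi.bdd_mul (c := ‖phiS σ n‖) (phiS σ n).continuous.aestronglyMeasurable
      (ae_of_all _ fun z => (phiS σ n).norm_coe_le_norm z)
  have hphiL : MemLp (fun z => phiS σ n z) 2 σ :=
    (memLp_two_iff_integrable_sq_norm (phiS σ n).continuous.aestronglyMeasurable).2 hphii
  have hdiffi : Integrable (fun z => ‖phiS σ n z - szegoPi σ E z‖ ^ 2) σ :=
    (memLp_two_iff_integrable_sq_norm (hphiL.sub hPiL).1).1 (hphiL.sub hPiL)
  have hEpart : ∫ z in E, ‖phiS σ n z - szegoPi σ E z‖ ^ 2 ∂σ =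
      (∫ z in E, ‖phiS σ n z‖ ^ 2 ∂σ) - 2 * (∫ z, phiS σ n z * B z ∂arcMeasure).re + 1 := by
    have h1 : ∫ z in E, ‖phiS σ n z - szegoPi σ E z‖ ^ 2 ∂σ =
        ∫ z in E, ‖phiS σ n z - (B z)⁻¹‖ ^ 2 ∂σ := by
      refine integral_congr_ae ?_
      filter_upwards [hPiE] with z hz
      rw [hz]
    rw [h1, setIntegral_acSet hE, setIntegral_acSet hE]
    have h2 : ∀ᵐ z ∂arcMeasure, density σ z • ‖phiS σ n z - (B z)⁻¹‖ ^ 2 =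
        density σ z • ‖phiS σ n z‖ ^ 2 - 2 * (phiS σ n z * B z).re + 1 := by
      filter_upwards [hBu] with z hz
      rw [← hz.1, smul_eq_mul, smul_eq_mul, ← mul_pow, ← mul_pow, ← norm_mul, ← norm_mul, mul_sub,
        mul_inv_cancel₀ hz.2, mul_comm (B z), ← Complex.normSq_eq_norm_sq,
        ← Complex.normSq_eq_norm_sq, Complex.normSq_sub]
      simp
      ring
    have hre : Integrable (fun z => (phiS σ n z * B z).re) arcMeasure := hprodi.re
    have hsubi : Integrable (fun z => density σ z • ‖phiS σ n z‖ ^ 2 -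
        2 * (phiS σ n z * B z).re) arcMeasure := hphim.sub (hre.const_mul 2)
    rw [integral_congr_ae h2, integral_add hsubi (integrable_const _),
      integral_sub hphim (hre.const_mul 2), integral_const_mul, integral_complex_re hprodi]
    simp
  have hcpart : ∫ z in Eᶜ, ‖phiS σ n z - szegoPi σ E z‖ ^ 2 ∂σ =
      ∫ z in Eᶜ, ‖phiS σ n z‖ ^ 2 ∂σ := by
    refine setIntegral_congr_fun hE.1.compl fun z hz => ?_
    rw [szegoPi, Set.indicator_of_notMem hz, sub_zero]
  have hsplit := integral_add_compl hE.1 hphii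
  rw [← integral_add_compl hE.1 hdiffi, hEpart, hcpart, hpair, Complex.ofReal_re]
  have hsq : Real.sqrt e ≤ Real.exp (1 / 2 * ∫ w, Real.log (density σ w) ∂arcMeasure) := by
    rw [Real.sqrt_eq_rpow, Real.rpow_def_of_pos he0]
    exact Real.exp_le_exp.2 (by linarith)
  have hfin : Real.sqrt e / Real.sqrt (en σ n) ≤ (Real.sqrt (en σ n))⁻¹ *
      Real.exp (1 / 2 * ∫ w, Real.log (density σ w) ∂arcMeasure) := by
    rw [div_eq_inv_mul]
    gcongr
  linarith

end

/-! ### Fourier coefficients of the bumps -/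

open scoped FourierTransform SchwartzMap

/-- The Fourier transform of `v ↦ h (2πv)`; the Fourier coefficients of `ω_0` are its
values at the points `d / κ`, divided by `κ`. -/
def profileFT (h : ℝ → ℝ) (ξ : ℝ) : ℂ :=
  ∫ v : ℝ, Complex.exp (-(2 * Real.pi * v * ξ * Complex.I)) * (h (2 * Real.pi * v) : ℂ)

namespace IsProfile

variable {h : ℝ → ℝ} (hh : IsProfile h)

include hh

theorem eq_zero_of_lt {x : ℝ} (hx : 2 * Real.pi < |x|) : h x = 0 := by
  by_contra hne
  have := hh.support_subset hne
  exact absurd (abs_le.2 this) (not_le.2 hx)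

theorem exists_schwartzMap : ∃ G : 𝓢(ℝ, ℂ), ∀ ξ, G ξ = profileFT h ξ := by
  have hcs : HasCompactSupport fun v : ℝ => (h (2 * Real.pi * v) : ℂ) := by
    refine HasCompactSupport.intro (K := Set.Icc (-1) 1) isCompact_Icc fun v hv => ?_
    rw [hh.eq_zero_of_lt, Complex.ofReal_zero]
    rw [abs_mul, abs_of_pos Real.two_pi_pos]
    have : 1 < |v| := by
      by_contra! hle
      exact hv (abs_le.1 hle)
    nlinarith [Real.pi_pos]
  have hsm : ContDiff ℝ ∞ fun v : ℝ => (h (2 * Real.pi * v) : ℂ) :=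
    Complex.ofRealCLM.contDiff.comp (hh.smooth.comp (contDiff_const.mul contDiff_id))
  refine ⟨𝓕 (hcs.toSchwartzMap hsm), fun ξ => ?_⟩
  rw [SchwartzMap.fourier_coe, Real.fourier_real_eq_integral_exp_smul]
  refine integral_congr_ae (ae_of_all _ fun v => ?_)
  simp only [HasCompactSupport.toSchwartzMap_toFun, smul_eq_mul]
  congr 2
  push_cast
  ring

theorem bump_eq_zero {κ j : ℕ} (hκ : 3 ≤ κ) {z : Circle}
    (hz : ((z / Circle.exp (2 * Real.pi * j / κ) : Circle) : ℂ).re < -1 / 2) :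
    bump h κ j z = 0 := by
  refine hh.eq_zero_of_lt ?_
  set w : Circle := z / Circle.exp (2 * Real.pi * j / κ)
  by_contra! hle
  have hκ' : (3 : ℝ) ≤ κ := by exact_mod_cast hκ
  rw [abs_mul, Nat.abs_cast] at hle
  have h1 : |Complex.arg w| ≤ 2 * Real.pi / 3 := by
    rw [le_div_iff₀ (by norm_num)]
    nlinarith [abs_nonneg (Complex.arg w)]
  have h2 : Real.cos (2 * Real.pi / 3) = -1 / 2 := by
    rw [show 2 * Real.pi / 3 = Real.pi - Real.pi / 3 by ring, Real.cos_pi_sub,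
      Real.cos_pi_div_three]
    norm_num
  have h3 := Real.cos_le_cos_of_nonneg_of_le_pi (abs_nonneg _) (by linarith [Real.pi_pos]) h1
  rw [Real.cos_abs, h2, Complex.cos_arg (Circle.coe_ne_zero w), Circle.norm_coe, div_one] at h3
  linarith

theorem continuous_bump {κ : ℕ} (hκ : 3 ≤ κ) (j : ℕ) : Continuous (bump h κ j) := by
  rw [continuous_iff_continuousAt]
  intro z
  have hc : Continuous fun z : Circle => ((z / Circle.exp (2 * Real.pi * j / κ) : Circle) : ℂ) :=
    continuous_subtype_val.comp (continuous_id.div_const _)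
  by_cases hs : ((z / Circle.exp (2 * Real.pi * j / κ) : Circle) : ℂ) ∈ Complex.slitPlane
  · unfold bump
    exact hh.smooth.continuous.continuousAt.comp
      (((Complex.continuousAt_arg hs).comp_of_eq hc.continuousAt rfl).const_mul (κ : ℝ))
  · have hre : ((z / Circle.exp (2 * Real.pi * j / κ) : Circle) : ℂ).re < -1 / 2 := by
      rw [Complex.mem_slitPlane_iff_arg] at hs
      have hpi : Complex.arg ((z / Circle.exp (2 * Real.pi * j / κ) : Circle) : ℂ) = Real.pi := by
        by_contra hne
        exact hs ⟨hne, Circle.coe_ne_zero _⟩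
      have h3 := Complex.cos_arg (Circle.coe_ne_zero (z / Circle.exp (2 * Real.pi * j / κ)))
      rw [hpi, Real.cos_pi, Circle.norm_coe, div_one] at h3
      linarith
    have hev : ∀ᶠ w in 𝓝 z, bump h κ j w = 0 :=
      ((Complex.continuous_re.comp hc).continuousAt.eventually_lt continuousAt_const hre).mono
        fun w hw => hh.bump_eq_zero hκ hw
    exact (continuousAt_const (y := (0 : ℝ))).congr (hev.mono fun w hw => hw.symm)

/-- For `κ ≥ 3` the support of `ω_0` stays away from `-1`, and the Fourier integral of `ω_0` is an
integral over the line. -/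
theorem coeffC_bump {κ : ℕ} (hκ : 3 ≤ κ) (j : ℕ) (d : ℤ) :
    coeffC (fun z => (bump h κ j z : ℂ)) d =
      Complex.exp (-(2 * Real.pi * (d / κ : ℝ) * Complex.I)) ^ j *
        (profileFT h (d / κ) / κ) := by
  have hκ' : (3 : ℝ) ≤ κ := by exact_mod_cast hκ
  have hκ0 : (κ : ℝ) ≠ 0 := by positivity
  have hκc : (κ : ℂ) ≠ 0 := by exact_mod_cast hκ0
  -- rotation to the bump at `1`
  have h1 : coeffC (fun z => (bump h κ j z : ℂ)) d =
      zeta (-d) (Circle.exp (2 * Real.pi * j / κ)) *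
        ∫ z : Circle, zeta (-d) z * (h (κ * Complex.arg z) : ℂ) ∂arcMeasure := by
    rw [coeffC, ← integral_comp_div (fun z => zeta (-d) z * (h (κ * Complex.arg z) : ℂ))
      (Circle.exp (2 * Real.pi * j / κ)), ← integral_const_mul]
    refine integral_congr_ae (ae_of_all _ fun z => ?_)
    simp only [bump, zeta_apply, ← mul_assoc, ← mul_zpow, ← Circle.coe_mul]
    rw [mul_div_cancel (Circle.exp (2 * Real.pi * j / κ)) z]
  have h2 : zeta (-d) (Circle.exp (2 * Real.pi * j / κ)) =
      Complex.exp (-(2 * Real.pi * (d / κ : ℝ) * Complex.I)) ^ j := by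
    rw [zeta_apply, Circle.coe_exp, ← Complex.exp_int_mul, ← Complex.exp_nat_mul]
    congr 1
    push_cast
    ring
  have h3 : ∫ z : Circle, zeta (-d) z * (h (κ * Complex.arg z) : ℂ) ∂arcMeasure =
      (2 * Real.pi)⁻¹ • ∫ x in (-Real.pi)..Real.pi,
        Complex.exp (-(d * x * Complex.I)) * (h (κ * x) : ℂ) := by
    rw [integral_arcMeasure _ (-Real.pi), show -Real.pi + 2 * Real.pi = Real.pi by ring]
    congr 1
    refine intervalIntegral.integral_congr_ae (ae_of_all _ fun x hx => ?_)
    rw [Set.uIoc_of_le (by linarith [Real.pi_pos])] at hx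
    rw [Circle.arg_exp hx.1 hx.2, zeta_apply, Circle.coe_exp, ← Complex.exp_int_mul]
    congr 2
    push_cast
    ring
  have h4 : ∫ x in (-Real.pi)..Real.pi, Complex.exp (-(d * x * Complex.I)) * (h (κ * x) : ℂ) =
      ∫ x : ℝ, Complex.exp (-(d * x * Complex.I)) * (h (κ * x) : ℂ) := by
    refine intervalIntegral.integral_eq_integral_of_support_subset fun x hx => ?_
    have hx' : h (κ * x) ≠ 0 := fun h0 => hx (by simp [h0])
    have hle := abs_le.2 (hh.support_subset hx')
    rw [abs_mul, Nat.abs_cast] at hle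
    have : |x| < Real.pi := by nlinarith [abs_nonneg x, Real.pi_pos]
    exact ⟨(abs_lt.1 this).1, (abs_lt.1 this).2.le⟩
  have h5 := Measure.integral_comp_mul_left
    (fun x : ℝ => Complex.exp (-(d * x * Complex.I)) * (h (κ * x) : ℂ)) (2 * Real.pi / κ)
  have h6 : ∫ x : ℝ, Complex.exp (-(d * x * Complex.I)) * (h (κ * x) : ℂ) =
      (2 * Real.pi / κ) • profileFT h (d / κ) := by
    have h7 : profileFT h (d / κ) = ∫ x : ℝ, Complex.exp (-(d * ((2 * Real.pi / κ * x : ℝ) : ℂ)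
        * Complex.I)) * (h (κ * (2 * Real.pi / κ * x)) : ℂ) := by
      refine integral_congr_ae (ae_of_all _ fun v => ?_)
      beta_reduce
      congr 2
      · congr 1
        push_cast
        ring
      · congr 1
        field_simp
    rw [h7, h5, smul_smul, abs_of_pos (by positivity), mul_inv_cancel₀ (by positivity), one_smul]
  rw [h1, h2, h3, h4, h6, smul_smul]
  congr 1
  rw [show (2 * Real.pi)⁻¹ * (2 * Real.pi / κ) = ((κ : ℝ))⁻¹ by field_simp, Complex.real_smul]
  push_cast
  ring

theorem coeffC_sum_bump {κ : ℕ} (hκ : 3 ≤ κ) (s : Finset ℕ) (d : ℤ) :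
    coeffC (fun z => ∑ j ∈ s, (bump h κ j z : ℂ)) d =
      (∑ j ∈ s, Complex.exp (-(2 * Real.pi * (d / κ : ℝ) * Complex.I)) ^ j) *
        (profileFT h (d / κ) / κ) := by
  rw [Finset.sum_mul]
  simp_rw [← hh.coeffC_bump hκ, coeffC, Finset.mul_sum]
  refine integral_finsetSum s fun j _ => ?_
  exact integrable_continuousMap (ν := arcMeasure)
    (zeta (-d) * ⟨_, Complex.continuous_ofReal.comp (hh.continuous_bump hκ j)⟩)

/-- Comparing Fourier coefficients in the partition of unity at frequency `κm`. -/
theorem profileFT_int (m : ℤ) : profileFT h m = if m = 0 then 1 else 0 := by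
  obtain ⟨κ, hκ1, hκ⟩ := (hh.sum_eq_one.and (eventually_ge_atTop 3)).exists
  have hκ0 : (κ : ℝ) ≠ 0 := by positivity
  have hκc : (κ : ℂ) ≠ 0 := by exact_mod_cast hκ0
  have h1 := hh.coeffC_sum_bump hκ (Finset.range κ) (κ * m)
  have h2 : (((κ * m : ℤ) : ℝ) / κ) = m := by
    push_cast
    field_simp
  have h3 : Complex.exp (-(2 * Real.pi * (m : ℝ) * Complex.I)) = 1 := by
    rw [Complex.exp_eq_one_iff]
    exact ⟨-m, by push_cast; ring⟩
  rw [h2, h3] at h1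
  simp only [one_pow, Finset.sum_const, Finset.card_range, nsmul_eq_mul, mul_one] at h1
  rw [mul_div_cancel₀ _ hκc] at h1
  rw [← h1, coeffC]
  have h4 : ∀ z, zeta (-(κ * m)) z * ∑ j ∈ Finset.range κ, (bump h κ j z : ℂ) =
      zeta (-(κ * m)) z := fun z => by
    rw [← Complex.ofReal_sum, hκ1 z, Complex.ofReal_one, mul_one]
  simp_rw [h4, integral_zeta]
  have : κ ≠ 0 := by omega
  simp [this]

/-- Decay of the Fourier transform, with a zero at each nonzero integer: the factor
`exp (-2πiξ) - 1` is the denominator of the geometric sums over the centres of the bumps. -/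
theorem exists_norm_profileFT_le : ∃ K : ℝ, 0 < K ∧
    (∀ ξ : ℝ, (1 + |ξ|) ^ 4 * ‖profileFT h ξ‖ ≤ K) ∧
    ∀ ξ : ℝ, ‖profileFT h ξ‖ * (|ξ| * (1 + |ξ|)) ≤
      K * ‖Complex.exp (-(2 * Real.pi * ξ * Complex.I)) - 1‖ := by
  obtain ⟨G, hG⟩ := hh.exists_schwartzMap
  have hdec : ∀ (F : 𝓢(ℝ, ℂ)) (k : ℕ), ∃ C, ∀ ξ, (1 + |ξ|) ^ k * ‖F ξ‖ ≤ C := fun F k =>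
    ⟨_, fun ξ => by
      simpa using SchwartzMap.one_add_le_sup_seminorm_apply (𝕜 := ℝ) (m := (k, 0)) (k := k) (n := 0)
        le_rfl le_rfl F ξ⟩
  obtain ⟨C₁, hC₁⟩ := hdec G 4
  obtain ⟨C₂, hC₂⟩ := hdec (SchwartzMap.derivCLM ℝ ℂ G) 2
  have hC₁0 : 0 ≤ C₁ := le_trans (by positivity) (hC₁ 0)
  have hC₂0 : 0 ≤ C₂ := le_trans (by positivity) (hC₂ 0)
  simp_rw [hG] at hC₁
  refine ⟨C₁ + C₂ + 1, by positivity, fun ξ => (hC₁ ξ).trans (by linarith), fun ξ => ?_⟩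
  set m : ℤ := round ξ with hm
  have hδ : |ξ - m| ≤ 1 / 2 := abs_sub_round ξ
  -- the right side is comparable with the distance to the nearest integer
  have hexp : 4 * |ξ - m| ≤ ‖Complex.exp (-(2 * Real.pi * ξ * Complex.I)) - 1‖ := by
    have h1 : Complex.exp (-(2 * Real.pi * ξ * Complex.I)) =
        Complex.exp (Complex.I * ((-(2 * Real.pi * (ξ - m)) : ℝ) : ℂ)) := by
      rw [Complex.exp_eq_exp_iff_exists_int]
      exact ⟨-m, by push_cast; ring⟩
    rw [h1, Complex.norm_exp_I_mul_ofReal_sub_one, Real.norm_eq_abs, abs_mul,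
      show -(2 * Real.pi * (ξ - m)) / 2 = -(Real.pi * (ξ - m)) by ring, Real.sin_neg, abs_neg,
      abs_two]
    have h2 := Real.mul_abs_le_abs_sin (x := Real.pi * (ξ - m)) (by
      rw [abs_mul, abs_of_pos Real.pi_pos]
      nlinarith [Real.pi_pos])
    rw [abs_mul, abs_of_pos Real.pi_pos, ← mul_assoc, div_mul_cancel₀ _ Real.pi_ne_zero] at h2
    linarith
  have hkey : ‖profileFT h ξ‖ * (|ξ| * (1 + |ξ|)) ≤ (C₁ + 2 * C₂) * |ξ - m| := by
    by_cases hm0 : m = 0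
    · rw [hm0, Int.cast_zero, sub_zero]
      have h1 : (1 + |ξ|) * ‖profileFT h ξ‖ ≤ C₁ := by
        refine le_trans ?_ (hC₁ ξ)
        gcongr
        exact le_self_pow₀ (by linarith [abs_nonneg ξ]) (by norm_num)
      calc ‖profileFT h ξ‖ * (|ξ| * (1 + |ξ|)) = ((1 + |ξ|) * ‖profileFT h ξ‖) * |ξ| := by ring
        _ ≤ (C₁ + 2 * C₂) * |ξ| := by gcongr; linarith
    · have hGm : profileFT h m = 0 := by rw [hh.profileFT_int, if_neg hm0]
      have hmv : ‖G ξ - G m‖ ≤ 2 * C₂ / (|ξ| * (1 + |ξ|)) * ‖ξ - m‖ := by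
        refine Convex.norm_image_sub_le_of_norm_deriv_le (s := Set.uIcc (m : ℝ) ξ)
          (fun y _ => G.differentiableAt) (fun y hy => ?_) (convex_uIcc _ _)
          Set.left_mem_uIcc Set.right_mem_uIcc
        have h2 := hC₂ y
        rw [SchwartzMap.derivCLM_apply] at h2
        have h3 : |ξ| ≤ |y| + 1 / 2 := by
          have h4 : |ξ - y| ≤ |ξ - m| := Set.abs_sub_right_of_mem_uIcc hy
          have h5 := abs_sub_abs_le_abs_sub ξ y
          linarith
        have hξ : 0 < |ξ| := by
          rw [abs_pos]
          rintro rfl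
          simp at hm
          exact hm0 hm
        rw [le_div_iff₀ (by positivity)]
        calc ‖deriv G y‖ * (|ξ| * (1 + |ξ|))
            ≤ ‖deriv G y‖ * ((1 + |y|) * (2 * (1 + |y|))) := by
              gcongr <;> linarith [abs_nonneg y]
          _ = 2 * ((1 + |y|) ^ 2 * ‖deriv G y‖) := by ring
          _ ≤ 2 * C₂ := by linarith
      rw [hG, hG, hGm, sub_zero, Real.norm_eq_abs] at hmv
      rcases (abs_nonneg ξ).eq_or_lt with h0 | h0
      · rw [← h0]
        simp only [zero_mul, mul_zero]
        positivity
      · calc ‖profileFT h ξ‖ * (|ξ| * (1 + |ξ|))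
            ≤ 2 * C₂ / (|ξ| * (1 + |ξ|)) * |ξ - m| * (|ξ| * (1 + |ξ|)) := by gcongr
          _ = 2 * C₂ * |ξ - m| := by field_simp
          _ ≤ (C₁ + 2 * C₂) * |ξ - m| := by gcongr; linarith
  calc _ ≤ (C₁ + 2 * C₂) * |ξ - m| := hkey
    _ ≤ (C₁ + C₂ + 1) * (4 * |ξ - m|) := by nlinarith [abs_nonneg (ξ - m)]
    _ ≤ _ := by gcongr

end IsProfile

/-! ### Bounds for the Fourier coefficients of partial sums of bumps -/

theorem exists_hasSum_int_le {f : ℤ → ℝ} (h0 : ∀ d, 0 ≤ f d) (hs : ∀ d, f (-d) = f d) {c : ℝ}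
    (hc : ∀ n, ∑ i ∈ Finset.range n, f (i + 1) ≤ c) : ∃ b, HasSum f b ∧ b ≤ f 0 + 2 * c := by
  have hsum : Summable fun n : ℕ => f (n + 1) :=
    summable_of_sum_range_le (fun n => h0 _) hc
  have hle : ∑' n : ℕ, f (n + 1) ≤ c := hsum.tsum_le_of_sum_range_le hc
  have h1 : HasSum (fun n : ℕ => f n) (∑' n : ℕ, f (n + 1) + f 0) := by
    have := (hasSum_nat_add_iff (f := fun n : ℕ => f n) 1).1 (by simpa using hsum.hasSum)
    simpa using this
  have h2 : HasSum (fun n : ℕ => f (-(n + 1))) (∑' n : ℕ, f (n + 1)) := by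
    simp_rw [hs]
    exact hsum.hasSum
  exact ⟨_, h1.of_nat_of_neg_add_one h2, by linarith⟩

theorem exists_hasSum_inv_sq {κ : ℕ} (hκ : 1 ≤ κ) :
    ∃ b, HasSum (fun d : ℤ => (κ : ℝ) / (κ + |(d : ℝ)|) ^ 2) b ∧ b ≤ 3 := by
  have hκ' : (1 : ℝ) ≤ κ := by exact_mod_cast hκ
  have hsum : ∀ n : ℕ, ∑ i ∈ Finset.range n, (κ : ℝ) / (κ + |(((i : ℤ) + 1 : ℤ) : ℝ)|) ^ 2 ≤
      1 - κ / (κ + n) := by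
    intro n
    induction n with
    | zero => simp [show (κ : ℝ) ≠ 0 by positivity]
    | succ n ih =>
      rw [Finset.sum_range_succ]
      have h1 : |((((n : ℤ) + 1 : ℤ)) : ℝ)| = n + 1 := by
        push_cast
        exact abs_of_pos (by positivity)
      rw [h1]
      push_cast at ih ⊢
      have h2 : (κ : ℝ) / (κ + (n + 1)) ^ 2 ≤ κ / (κ + n) - κ / (κ + (n + 1)) := by
        rw [div_sub_div _ _ (by positivity) (by positivity),
          div_le_div_iff₀ (by positivity) (by positivity)]
        have h3 : (0 : ℝ) ≤ n := by positivity
        nlinarith [mul_nonneg (mul_nonneg (by positivity : (0 : ℝ) ≤ κ)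
          (by positivity : (0 : ℝ) ≤ κ + (n + 1))) h3, mul_pos (by positivity : (0 : ℝ) < κ)
          (by positivity : (0 : ℝ) < κ + (n + 1))]
      linarith
  obtain ⟨b, hb, hle⟩ := exists_hasSum_int_le (f := fun d : ℤ => (κ : ℝ) / (κ + |(d : ℝ)|) ^ 2)
    (fun d => by positivity) (fun d => by simp)
    (fun n => (hsum n).trans (sub_le_self 1 (by positivity)))
  refine ⟨b, hb, hle.trans ?_⟩
  have : (κ : ℝ) / (κ + |((0 : ℤ) : ℝ)|) ^ 2 ≤ 1 := by
    simp only [Int.cast_zero, abs_zero, add_zero]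
    rw [div_le_one (by positivity)]
    nlinarith
  linarith

theorem exists_hasSum_inv_mul {κ : ℕ} (hκ : 1 ≤ κ) :
    ∃ b, HasSum (fun d : ℤ => (κ : ℝ) / (|(d : ℝ)| * (κ + |(d : ℝ)|))) b ∧
      b ≤ 2 * (1 + Real.log κ) := by
  have hκ' : (1 : ℝ) ≤ κ := by exact_mod_cast hκ
  have hsum : ∀ n : ℕ, ∑ i ∈ Finset.range n,
      (κ : ℝ) / (|(((i : ℤ) + 1 : ℤ) : ℝ)| * (κ + |(((i : ℤ) + 1 : ℤ) : ℝ)|)) ≤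
      1 + Real.log κ := by
    intro n
    have hH : ∑ i ∈ Finset.range κ, ((i : ℝ) + 1)⁻¹ ≤ 1 + Real.log κ := by
      have := harmonic_le_one_add_log κ
      rw [harmonic] at this
      push_cast at this
      exact this
    have h1 : ∀ i : ℕ, (κ : ℝ) / (|(((i : ℤ) + 1 : ℤ) : ℝ)| * (κ + |(((i : ℤ) + 1 : ℤ) : ℝ)|)) =
        ((i : ℝ) + 1)⁻¹ - (((κ + i : ℕ) : ℝ) + 1)⁻¹ := fun i => by
      have h2 : |((((i : ℤ) + 1 : ℤ)) : ℝ)| = i + 1 := by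
        push_cast
        exact abs_of_pos (by positivity)
      rw [h2]
      push_cast
      field_simp
      ring
    simp_rw [h1]
    rw [Finset.sum_sub_distrib]
    have h2 := Finset.sum_range_add (fun i : ℕ => ((i : ℝ) + 1)⁻¹) κ n
    have h3 : ∑ i ∈ Finset.range n, ((i : ℝ) + 1)⁻¹ ≤
        ∑ i ∈ Finset.range (κ + n), ((i : ℝ) + 1)⁻¹ :=
      Finset.sum_le_sum_of_subset_of_nonneg (Finset.range_mono (Nat.le_add_left n κ))
        fun i _ _ => by positivity
    linarith
  obtain ⟨b, hb, hle⟩ := exists_hasSum_int_le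
    (f := fun d : ℤ => (κ : ℝ) / (|(d : ℝ)| * (κ + |(d : ℝ)|)))
    (fun d => by positivity) (fun d => by simp) hsum
  exact ⟨b, hb, by simpa using hle⟩

namespace IsProfile

variable {h : ℝ → ℝ}

/-- The bump `ω_j` as a complex valued continuous function; for `κ < 3` the bumps may be
discontinuous at the point opposite to their centre. -/
def bumpC (hh : IsProfile h) {κ : ℕ} (hκ : 3 ≤ κ) (j : ℕ) : C(Circle, ℂ) :=
  ⟨fun z => (bump h κ j z : ℂ), Complex.continuous_ofReal.comp (hh.continuous_bump hκ j)⟩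

theorem bumpC_apply (hh : IsProfile h) {κ : ℕ} (hκ : 3 ≤ κ) (j : ℕ) (z : Circle) :
    hh.bumpC hκ j z = (bump h κ j z : ℂ) := rfl

theorem coeffC_bumpC_zero (hh : IsProfile h) {κ : ℕ} (hκ : 3 ≤ κ) (j : ℕ) :
    coeffC (hh.bumpC hκ j) 0 = 1 / κ := by
  have h1 := hh.coeffC_bump hκ j 0
  change coeffC (hh.bumpC hκ j) 0 = _ at h1
  have h2 := hh.profileFT_int 0
  rw [if_pos rfl, Int.cast_zero] at h2
  rw [Int.cast_zero, zero_div, h2] at h1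
  simpa using h1

/-- Bounds, uniform in `κ`, for the Fourier coefficients of a single bump and of a partial sum of
bumps. In the second bound the number of bumps does not matter. -/
theorem exists_norm_coeffC_le (hh : IsProfile h) : ∃ K : ℝ, 0 < K ∧
    ∀ (κ : ℕ) (hκ : 3 ≤ κ), (∀ (j : ℕ) (d : ℤ),
      ‖coeffC (hh.bumpC hκ j) d‖ ≤ K * (κ ^ 3 / (κ + |(d : ℝ)|) ^ 4)) ∧
    ∀ (J : ℕ) (d : ℤ), d ≠ 0 → ‖coeffC (∑ j ∈ Finset.range J, hh.bumpC hκ j : C(Circle, ℂ)) d‖ ≤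
      K * (κ / (|(d : ℝ)| * (κ + |(d : ℝ)|))) := by
  obtain ⟨K, hK, hK1, hK2⟩ := hh.exists_norm_profileFT_le
  refine ⟨2 * K, by positivity, fun κ hκ => ?_⟩
  have hκ0 : (0 : ℝ) < κ := by
    have : (3 : ℝ) ≤ κ := by exact_mod_cast hκ
    linarith
  have habs : ∀ d : ℤ, |(d / κ : ℝ)| = |(d : ℝ)| / κ := fun d => by rw [abs_div, Nat.abs_cast]
  have hq : ∀ d : ℤ, ‖Complex.exp (-(2 * Real.pi * (d / κ : ℝ) * Complex.I))‖ = 1 := fun d => by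
    rw [show -(2 * Real.pi * (d / κ : ℝ) * Complex.I) =
      ((-(2 * Real.pi * (d / κ)) : ℝ) : ℂ) * Complex.I by push_cast; ring]
    exact Complex.norm_exp_ofReal_mul_I _
  constructor
  · intro j d
    have h1 := hh.coeffC_bump hκ j d
    change coeffC (hh.bumpC hκ j) d = _ at h1
    have h2 := hK1 (d / κ)
    rw [habs] at h2
    rw [h1, norm_mul, norm_pow, hq, one_pow, one_mul, norm_div, Complex.norm_natCast]
    have h3 : (1 + |(d : ℝ)| / κ) ^ 4 = (κ + |(d : ℝ)|) ^ 4 / κ ^ 4 := by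
      rw [← div_pow]
      congr 1
      field_simp
    rw [h3] at h2
    have h4 : ‖profileFT h (d / κ)‖ ≤ K * (κ ^ 4 / (κ + |(d : ℝ)|) ^ 4) := by
      rw [← mul_div_assoc, le_div_iff₀ (by positivity)]
      rw [div_mul_eq_mul_div, div_le_iff₀ (by positivity)] at h2
      linarith
    rw [div_le_iff₀ hκ0]
    refine h4.trans ?_
    rw [mul_assoc, div_mul_eq_mul_div, ← pow_succ]
    have : 0 ≤ K * ((κ : ℝ) ^ 4 / (κ + |(d : ℝ)|) ^ 4) := by positivity
    linarith
  · intro J d hd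
    have hd0 : 0 < |(d : ℝ)| := by
      rw [abs_pos]
      exact_mod_cast hd
    have h1 := hh.coeffC_sum_bump hκ (Finset.range J) d
    have h1' : coeffC (∑ j ∈ Finset.range J, hh.bumpC hκ j : C(Circle, ℂ)) d =
        coeffC (fun z => ∑ j ∈ Finset.range J, (bump h κ j z : ℂ)) d := by
      congr 1 with z
      simp [bumpC_apply]
    rw [h1', h1]
    set q := Complex.exp (-(2 * Real.pi * (d / κ : ℝ) * Complex.I)) with hqdef
    have h2 := hK2 (d / κ)
    rw [habs, ← hqdef] at h2
    have hpos : 0 < |(d : ℝ)| / κ * (1 + |(d : ℝ)| / κ) := by positivity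
    have hid : |(d : ℝ)| / κ * (1 + |(d : ℝ)| / κ) =
        (|(d : ℝ)| * (κ + |(d : ℝ)|)) / κ ^ 2 := by field_simp
    by_cases hq1 : q = 1
    · rw [hq1, sub_self, norm_zero, mul_zero] at h2
      have h3 : ‖profileFT h (d / κ)‖ = 0 := by
        by_contra hne
        exact absurd h2 (not_le.2 (mul_pos (lt_of_le_of_ne (norm_nonneg _) (Ne.symm hne)) hpos))
      rw [norm_eq_zero.1 h3, zero_div, mul_zero, norm_zero]
      positivity
    · have hq1' : 0 < ‖q - 1‖ := norm_pos_iff.2 (sub_ne_zero.2 hq1)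
      have h3 : ‖q ^ J - 1‖ ≤ 2 := (norm_sub_le _ _).trans (by
        rw [norm_pow, hq, one_pow, norm_one]; norm_num)
      rw [geom_sum_eq hq1, norm_mul, norm_div, norm_div, Complex.norm_natCast]
      rw [hid] at h2
      have h4 : ‖profileFT h (d / κ)‖ ≤
          K * ‖q - 1‖ * (κ ^ 2 / (|(d : ℝ)| * (κ + |(d : ℝ)|))) := by
        rw [← mul_div_assoc, le_div_iff₀ (by positivity)]
        rw [← mul_div_assoc, div_le_iff₀ (by positivity)] at h2
        exact h2
      calc ‖q ^ J - 1‖ / ‖q - 1‖ * (‖profileFT h (d / κ)‖ / κ)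
          ≤ 2 / ‖q - 1‖ * (K * ‖q - 1‖ * (κ ^ 2 / (|(d : ℝ)| * (κ + |(d : ℝ)|))) / κ) := by
            gcongr
        _ = 2 * K * (κ / (|(d : ℝ)| * (κ + |(d : ℝ)|))) := by field_simp

theorem summable_norm_coeffC (hh : IsProfile h) {κ : ℕ} (hκ : 3 ≤ κ) (s : Finset ℕ) :
    Summable fun d => ‖coeffC (∑ j ∈ s, hh.bumpC hκ j : C(Circle, ℂ)) d‖ := by
  obtain ⟨K, hK, hK1⟩ := hh.exists_norm_coeffC_le
  obtain ⟨b, hb, -⟩ := exists_hasSum_inv_sq (κ := κ) (by omega)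
  have hκ0 : (0 : ℝ) < κ := by
    have : (3 : ℝ) ≤ κ := by exact_mod_cast hκ
    linarith
  refine Summable.of_nonneg_of_le (fun d => norm_nonneg _) (fun d => ?_)
    (hb.summable.mul_left (s.card * K))
  have h1 : coeffC (∑ j ∈ s, hh.bumpC hκ j : C(Circle, ℂ)) d =
      ∑ j ∈ s, coeffC (hh.bumpC hκ j) d := by
    simp_rw [coeffC, ContinuousMap.coe_sum, Finset.sum_apply, Finset.mul_sum]
    exact integral_finsetSum s fun j _ =>
      integrable_continuousMap (ν := arcMeasure) (zeta (-d) * hh.bumpC hκ j)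
  rw [h1, mul_assoc, ← nsmul_eq_mul]
  refine (norm_sum_le _ _).trans (Finset.sum_le_card_nsmul _ _ _ fun j _ => ?_)
  refine ((hK1 κ hκ).1 j d).trans ?_
  gcongr K * ?_
  have h2 : (0 : ℝ) ≤ |(d : ℝ)| := abs_nonneg _
  rw [div_le_div_iff₀ (by positivity) (by positivity)]
  have h3 : (κ : ℝ) ^ 2 ≤ (κ + |(d : ℝ)|) ^ 2 := by gcongr; linarith
  calc (κ : ℝ) ^ 3 * (κ + |(d : ℝ)|) ^ 2 = κ * (κ ^ 2 * (κ + |(d : ℝ)|) ^ 2) := by ring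
    _ ≤ κ * ((κ + |(d : ℝ)|) ^ 2 * (κ + |(d : ℝ)|) ^ 2) := by gcongr
    _ = κ * (κ + |(d : ℝ)|) ^ 4 := by ring

end IsProfile

/-- Expansion of a multiplication operator into shifts. -/
theorem hasSum_inner_mul {σ : Measure Circle} [IsFiniteMeasure σ] {W : C(Circle, ℂ)}
    (hW : Summable fun d => ‖coeffC W d‖) (f g : C(Circle, ℂ)) :
    HasSum (fun d => coeffC W d * inner ℂ (emb σ f) (emb σ (zeta d * g)))
      (inner ℂ (emb σ f) (emb σ (W * g))) := by
  let L : C(Circle, ℂ) →L[ℂ] ℂ := (innerSL ℂ (emb σ f)) ∘L (emb σ) ∘L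
    (ContinuousLinearMap.mul ℂ C(Circle, ℂ) g)
  have h1 := (hasSum_coeffC W hW).mapL L
  simpa [L, mul_comm g] using h1

/-! ### Localized differences of the reversed polynomials -/

section Orthogonality

variable {σ : Measure Circle} [IsProbabilityMeasure σ]

theorem en_sub_le_sum (hσ : σ.support.Infinite) {a b : ℕ} (hab : a ≤ b) :
    en σ a - en σ b ≤ ∑ s ∈ Finset.Ico a b, ‖verblunsky σ s‖ ^ 2 := by
  induction b, hab using Nat.le_induction with
  | base => simp
  | succ b hab ih =>
    rw [Finset.sum_Ico_succ_top hab, en_succ hσ]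
    nlinarith [en_le_one (σ := σ) b, sq_nonneg ‖verblunsky σ b‖, en_nonneg (σ := σ) b]

/-- Bessel's inequality for the monic orthogonal polynomials, whose norms are at most `1`. -/
theorem sum_norm_inner_Phi_sq_le (hσ : σ.support.Infinite) (x : Lp ℂ 2 σ) (s : Finset ℕ) :
    ∑ n ∈ s, ‖inner ℂ x (emb σ (Phi σ n))‖ ^ 2 ≤ ‖x‖ ^ 2 := by
  have hv : Orthonormal ℂ fun n => (((Real.sqrt (en σ n))⁻¹ : ℝ) : ℂ) • emb σ (Phi σ n) := by
    refine ⟨fun n => ?_, fun n m hnm => ?_⟩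
    · have h1 : ‖emb σ (Phi σ n)‖ = Real.sqrt (en σ n) := by
        rw [en, Real.sqrt_sq (norm_nonneg _)]
      have h2 : 0 < Real.sqrt (en σ n) := Real.sqrt_pos.2 (en_pos hσ n)
      rw [norm_smul, h1, Complex.norm_real, Real.norm_eq_abs, abs_of_pos (inv_pos.2 h2)]
      exact inv_mul_cancel₀ h2.ne'
    · beta_reduce
      rw [inner_smul_left, inner_smul_right]
      rcases lt_or_gt_of_ne hnm with h | h
      · rw [inner_Phi_Phi_of_lt m n h, mul_zero, mul_zero]
      · rw [← inner_conj_symm, inner_Phi_Phi_of_lt n m h, map_zero, mul_zero, mul_zero]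
  refine le_trans (Finset.sum_le_sum fun n _ => ?_) (hv.sum_inner_products_le (x := x) (s := s))
  have h2 : 0 < Real.sqrt (en σ n) := Real.sqrt_pos.2 (en_pos hσ n)
  have h3 : 1 ≤ (Real.sqrt (en σ n))⁻¹ :=
    (one_le_inv₀ h2).2 (Real.sqrt_le_one.2 (en_le_one n))
  rw [inner_smul_left, norm_mul, norm_inner_symm (emb σ (Phi σ n)), Complex.norm_conj,
    Complex.norm_real, Real.norm_eq_abs, abs_of_pos (inv_pos.2 h2)]
  gcongr
  exact le_mul_of_one_le_left (norm_nonneg _) h3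

/-- Bessel's inequality for the frequency `-d` modulation of `Φ_N^*`. -/
theorem sum_norm_inner_PhiS_le_one (hσ : σ.support.Infinite) (N : ℕ) (d : ℤ) (s : Finset ℕ) :
    ∑ n ∈ s, ‖inner ℂ (emb σ (PhiS σ N)) (emb σ (zeta d * Phi σ n))‖ ^ 2 ≤ 1 := by
  have h : ∀ n, inner ℂ (emb σ (PhiS σ N)) (emb σ (zeta d * Phi σ n)) =
      inner ℂ (emb σ (zeta (-d) * PhiS σ N)) (emb σ (Phi σ n)) := fun n => by
    rw [inner_emb_mul_left, star_zeta, neg_neg]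
  simp_rw [h]
  refine (sum_norm_inner_Phi_sq_le hσ _ s).trans ?_
  rw [norm_zeta_mul, norm_PhiS_sq]
  exact en_le_one N

/-- The polynomials `Φ_s` with `s` large see only the difference of `z ^ k Φ_N^*` and
`z ^ k Φ_a^*`, as the latter has low degree. -/
theorem sum_norm_inner_PhiS_le (hσ : σ.support.Infinite) {N a k n m : ℕ} (ha : a + k + 1 ≤ n)
    (haN : a ≤ N) :
    ∑ s ∈ Finset.Ico n m, ‖inner ℂ (emb σ (PhiS σ N)) (emb σ (zeta (-k) * Phi σ s))‖ ^ 2 ≤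
      en σ a - en σ N := by
  have h : ∀ s ∈ Finset.Ico n m, inner ℂ (emb σ (PhiS σ N)) (emb σ (zeta (-k) * Phi σ s)) =
      -inner ℂ (emb σ (zeta k * (PhiS σ a - PhiS σ N))) (emb σ (Phi σ s)) := fun s hs => by
    rw [Finset.mem_Ico] at hs
    have hmem : PhiS σ a ∈ trigSpan 0 a := by
      have h1 := add_mem (trigSpan_mono (a' := 0) (by lia) le_rfl (PhiS_sub_one_mem (σ := σ) a))
        (zeta_mem_trigSpan (k := 0) le_rfl (by lia : (0 : ℤ) ≤ a))
      rwa [zeta_zero, sub_add_cancel] at h1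
    have h0 : inner ℂ (emb σ (zeta k * PhiS σ a)) (emb σ (Phi σ s)) = 0 :=
      inner_Phi (trigSpan_mono (by lia) (by lia) (zeta_mul_mem_trigSpan k hmem))
    rw [mul_sub, map_sub, inner_sub_left, h0, zero_sub, neg_neg, inner_emb_mul_left, star_zeta]
  rw [Finset.sum_congr rfl fun s hs => by rw [h s hs, norm_neg]]
  refine (sum_norm_inner_Phi_sq_le hσ _ _).trans ?_
  rw [norm_zeta_mul, norm_PhiS_sub_sq haN]

theorem norm_inner_Phi_zeta_mul_le_one (n : ℕ) (d : ℤ) :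
    ‖inner ℂ (emb σ (Phi σ n)) (emb σ (zeta d * Phi σ n))‖ ≤ 1 := by
  refine (norm_inner_le_norm _ _).trans ?_
  rw [norm_zeta_mul, ← sq]
  exact en_le_one n

theorem norm_inner_Phi_zeta_mul_le {n : ℕ} {d : ℤ} (h1 : d ≠ 0) (h2 : d.natAbs ≤ n) :
    ‖inner ℂ (emb σ (Phi σ n)) (emb σ (zeta d * Phi σ n))‖ ≤
      (en σ (n - d.natAbs) - en σ (n + d.natAbs)) / 2 := by
  have h := norm_inner_Phi_zeta_mul_Phi_le (σ := σ) (n := n) (d := d.natAbs)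
    (Int.natAbs_pos.2 h1) h2
  rcases Int.natAbs_eq d with hd | hd
  · rw [← hd] at h
    exact h
  · rw [norm_inner_symm, inner_emb_mul_left, star_zeta]
    rwa [← neg_eq_iff_eq_neg.2 hd] at h

/-- On the circle `|Φ_n^*| = |Φ_n|`. -/
theorem inner_PhiS_mul (n : ℕ) (w : C(Circle, ℂ)) :
    inner ℂ (emb σ (PhiS σ n)) (emb σ (w * PhiS σ n)) =
      inner ℂ (emb σ (Phi σ n)) (emb σ (w * Phi σ n)) := by
  have h : w * star (Phi σ n) = star (star w * Phi σ n) := by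
    rw [star_mul', star_star]
  rw [PhiS, mul_left_comm, inner_zeta_mul, h, inner_star, inner_emb_mul_left, star_star]

theorem PhiS_sub_PhiS (hσ : σ.support.Infinite) {a b : ℕ} (hab : a ≤ b) :
    PhiS σ a - PhiS σ b =
      ∑ s ∈ Finset.Ico a b, verblunsky σ s • (zeta 1 * Phi σ s) := by
  induction b, hab using Nat.le_induction with
  | base => simp
  | succ b hab ih => rw [Finset.sum_Ico_succ_top hab, ← PhiS_succ hσ, ← ih, sub_add_sub_cancel]

end Orthogonality

/-- Long differences of a monotone sequence telescope, up to their length. -/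
theorem sum_sub_shift_le {a : ℕ → ℝ} (ha : Antitone a) {p L : ℕ} (hL : L ≤ p) (κ : ℕ) :
    ∑ j ∈ Finset.range κ, (a (p + j - L) - a (p + j + L)) ≤
      2 * L * (a (p - L) - a (p + κ + L)) := by
  have h1 : ∀ j, a (p + j - L) - a (p + j + L) =
      ∑ i ∈ Finset.range (2 * L), (a (p - L + i + j) - a (p - L + i + (j + 1))) := fun j => by
    have := Finset.sum_range_sub' (fun i => a (p - L + i + j)) (2 * L)
    rw [show p - L + 0 + j = p + j - L by omega, show p - L + 2 * L + j = p + j + L by omega]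
      at this
    rw [← this]
    refine Finset.sum_congr rfl fun i _ => ?_
    rw [show p - L + (i + 1) + j = p - L + i + (j + 1) by omega]
  simp_rw [h1]
  rw [Finset.sum_comm]
  simp_rw [Finset.sum_range_sub']
  refine (Finset.sum_le_card_nsmul _ _ (a (p - L) - a (p + κ + L)) fun i hi => ?_).trans ?_
  · rw [Finset.mem_range] at hi
    exact sub_le_sub (ha (by omega)) (ha (by omega))
  · rw [Finset.card_range, nsmul_eq_mul]
    push_cast
    rfl

/-- The energy of the Verblunsky coefficients in the range `[κ²/2, 3κ²)` of indices. It contains all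
indices `N_j ± d` with `|d|` at most about `κ²/2`. -/
def energy (σ : Measure Circle) (κ : ℕ) : ℝ :=
  ∑ s ∈ Finset.Ico (κ ^ 2 / 2) (3 * κ ^ 2), ‖verblunsky σ s‖ ^ 2

theorem energy_nonneg {σ : Measure Circle} (κ : ℕ) : 0 ≤ energy σ κ :=
  Finset.sum_nonneg fun _ _ => sq_nonneg _

section Estimates

variable {σ : Measure Circle} [IsProbabilityMeasure σ]

theorem en_sub_le_energy (hσ : σ.support.Infinite) {κ a b : ℕ} (ha : κ ^ 2 / 2 ≤ a)
    (hb : b ≤ 3 * κ ^ 2) : en σ a - en σ b ≤ energy σ κ := by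
  have h1 := en_sub_le_sum hσ (a := κ ^ 2 / 2) (b := 3 * κ ^ 2) (by omega)
  have h2 := en_antitone (σ := σ) ha
  have h3 := en_antitone (σ := σ) hb
  unfold energy
  linarith

/-- The frequency `d` components of the measures `|Φ_{N_j}|² σ`, summed over `j`. For `|d|` of order
`κ²` or larger the trivial bound `κ` is already dominated by the term with `4 / κ`. -/
theorem sum_norm_inner_shift_le (hσ : σ.support.Infinite) {κ : ℕ} (hκ : 3 ≤ κ) {d : ℤ}
    (hd : d ≠ 0) :
    ∑ j ∈ Finset.range κ, ‖inner ℂ (emb σ (Phi σ (κ ^ 2 + κ * j)))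
        (emb σ (zeta d * Phi σ (κ ^ 2 + κ * j)))‖ ≤
      ((κ + |(d : ℝ)|) / κ) ^ 2 * (energy σ κ + 4 / κ) := by
  have hκ0 : (0 : ℝ) < κ := by
    have : (3 : ℝ) ≤ κ := by exact_mod_cast hκ
    linarith
  set D := d.natAbs with hD
  have hDr : |(d : ℝ)| = D := by rw [hD, Nat.cast_natAbs, Int.cast_abs]
  -- a shift by `D` is dominated by `L` steps of length `κ`
  set L := D / κ + 1 with hL
  have hDL : D ≤ κ * L := by
    rw [hL]
    have := Nat.div_add_mod D κ
    have := Nat.mod_lt D (by omega : 0 < κ)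
    rw [mul_add]
    omega
  rw [hDr]
  set x := ((κ : ℝ) + D) / κ with hx
  have hx1 : 1 ≤ x := by
    rw [hx, le_div_iff₀ hκ0]
    linarith [(Nat.cast_nonneg D : (0 : ℝ) ≤ D)]
  have hLx : (L : ℝ) ≤ x := by
    have h1 : ((D / κ : ℕ) : ℝ) ≤ D / κ := Nat.cast_div_le
    rw [hL, hx, add_div, div_self hκ0.ne']
    push_cast
    linarith
  have hE := energy_nonneg (σ := σ) κ
  by_cases hLκ : 2 * L ≤ κ
  · have hterm : ∀ j, ‖inner ℂ (emb σ (Phi σ (κ ^ 2 + κ * j)))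
        (emb σ (zeta d * Phi σ (κ ^ 2 + κ * j)))‖ ≤
        1 / 2 * (en σ (κ * (κ + j - L)) - en σ (κ * (κ + j + L))) := fun j => by
      have h0 : κ * L ≤ κ * κ := Nat.mul_le_mul_left κ (by omega)
      have h1 : κ * (κ + j - L) = κ ^ 2 + κ * j - κ * L := by
        rw [Nat.mul_sub, mul_add, sq]
      have h2 : κ * (κ + j + L) = κ ^ 2 + κ * j + κ * L := by ring
      have h3 := norm_inner_Phi_zeta_mul_le (σ := σ) (n := κ ^ 2 + κ * j) hd
        (by rw [← hD]; nlinarith)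
      have h4 : en σ (κ ^ 2 + κ * j - D) ≤ en σ (κ * (κ + j - L)) := en_antitone (by omega)
      have h5 : en σ (κ * (κ + j + L)) ≤ en σ (κ ^ 2 + κ * j + D) := en_antitone (by omega)
      rw [← hD] at h3
      linarith
    refine (Finset.sum_le_sum fun j _ => hterm j).trans ?_
    rw [← Finset.mul_sum]
    have hanti : Antitone fun i => en σ (κ * i) := fun i j hij =>
      en_antitone (Nat.mul_le_mul_left κ hij)
    have h1 := sum_sub_shift_le hanti (p := κ) (L := L) (by omega) κ
    have h2 : en σ (κ * (κ - L)) - en σ (κ * (κ + κ + L)) ≤ energy σ κ := by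
      refine en_sub_le_energy hσ ?_ ?_
      · have h4 : κ * κ ≤ κ * (2 * (κ - L)) := Nat.mul_le_mul_left κ (by omega)
        rw [sq]
        have h5 : κ * (2 * (κ - L)) = 2 * (κ * (κ - L)) := by ring
        omega
      · have h4 : κ * (κ + κ + L) ≤ κ * (3 * κ) := Nat.mul_le_mul_left κ (by omega)
        calc _ ≤ _ := h4
          _ = _ := by ring
    calc 1 / 2 * ∑ j ∈ Finset.range κ, (en σ (κ * (κ + j - L)) - en σ (κ * (κ + j + L)))
        ≤ 1 / 2 * (2 * L * (en σ (κ * (κ - L)) - en σ (κ * (κ + κ + L)))) := by gcongr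
      _ = L * (en σ (κ * (κ - L)) - en σ (κ * (κ + κ + L))) := by ring
      _ ≤ x ^ 2 * (energy σ κ + 4 / κ) := by
        have h6 : (L : ℝ) ≤ x ^ 2 := by nlinarith
        have h7 : (0 : ℝ) ≤ 4 / κ := by positivity
        calc _ ≤ L * energy σ κ := by gcongr
          _ ≤ x ^ 2 * (energy σ κ + 4 / κ) := by gcongr; linarith
  · refine (Finset.sum_le_card_nsmul _ _ 1 fun j _ => norm_inner_Phi_zeta_mul_le_one _ d).trans ?_
    rw [Finset.card_range, nsmul_eq_mul, mul_one]
    have h1 : (κ : ℝ) ≤ 2 * x := by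
      have : (κ : ℝ) ≤ 2 * L := by exact_mod_cast (by omega : κ ≤ 2 * L)
      linarith
    have h2 : (κ : ℝ) ≤ x ^ 2 * (4 / κ) := by
      rw [← mul_div_assoc, le_div_iff₀ hκ0]
      nlinarith
    have h3 : 0 ≤ x ^ 2 * energy σ κ := by positivity
    linarith

end Estimates

section Pairings

variable {σ : Measure Circle} [IsProbabilityMeasure σ]

/-- The averages of `ω_j` against `|Φ_{N_j}|² σ` see, up to a small error, only the total masses. -/
theorem norm_sum_inner_Phi_bump_le (hσ : σ.support.Infinite) {h : ℝ → ℝ} (hh : IsProfile h)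
    {κ : ℕ} (hκ : 3 ≤ κ) {K : ℝ} (hK : 0 < K) (hK1 : ∀ (j : ℕ) (d : ℤ),
      ‖coeffC (hh.bumpC hκ j) d‖ ≤ K * (κ ^ 3 / (κ + |(d : ℝ)|) ^ 4)) :
    ‖∑ j ∈ Finset.range κ, inner ℂ (emb σ (Phi σ (κ ^ 2 + κ * j)))
        (emb σ (hh.bumpC hκ j * Phi σ (κ ^ 2 + κ * j))) -
      ∑ j ∈ Finset.range κ, (1 / κ : ℂ) * (en σ (κ ^ 2 + κ * j) : ℂ)‖ ≤
      3 * K * (energy σ κ + 4 / κ) := by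
  have hκ0 : (0 : ℝ) < κ := by
    have : (3 : ℝ) ≤ κ := by exact_mod_cast hκ
    linarith
  have hs : ∀ j, HasSum (fun d : ℤ => coeffC (hh.bumpC hκ j) d *
      inner ℂ (emb σ (Phi σ (κ ^ 2 + κ * j))) (emb σ (zeta d * Phi σ (κ ^ 2 + κ * j))))
      (inner ℂ (emb σ (Phi σ (κ ^ 2 + κ * j)))
        (emb σ (hh.bumpC hκ j * Phi σ (κ ^ 2 + κ * j)))) := fun j => by
    refine hasSum_inner_mul ?_ _ _
    have := hh.summable_norm_coeffC hκ {j}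
    simpa using this
  have h1 := hasSum_ite_sub_hasSum (hasSum_sum fun j (_ : j ∈ Finset.range κ) => hs j) 0
  have h0 : ∑ j ∈ Finset.range κ, coeffC (hh.bumpC hκ j) 0 *
      inner ℂ (emb σ (Phi σ (κ ^ 2 + κ * j))) (emb σ (zeta 0 * Phi σ (κ ^ 2 + κ * j))) =
      ∑ j ∈ Finset.range κ, (1 / κ : ℂ) * (en σ (κ ^ 2 + κ * j) : ℂ) := by
    refine Finset.sum_congr rfl fun j _ => ?_
    rw [hh.coeffC_bumpC_zero, zeta_zero, one_mul, inner_self_eq_norm_sq_to_K, en]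
    push_cast
    rfl
  rw [h0] at h1
  obtain ⟨b, hb, hb3⟩ := exists_hasSum_inv_sq (κ := κ) (by omega)
  have hE := energy_nonneg (σ := σ) κ
  refine (h1.norm_le_of_bounded (hb.mul_left (K * (energy σ κ + 4 / κ))) fun d => ?_).trans ?_
  · split_ifs with hd
    · rw [norm_zero]
      positivity
    · calc _ ≤ ∑ j ∈ Finset.range κ, (K * (κ ^ 3 / (κ + |(d : ℝ)|) ^ 4)) *
            ‖inner ℂ (emb σ (Phi σ (κ ^ 2 + κ * j)))
              (emb σ (zeta d * Phi σ (κ ^ 2 + κ * j)))‖ := by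
            refine (norm_sum_le _ _).trans (Finset.sum_le_sum fun j _ => ?_)
            rw [norm_mul]
            gcongr
            exact hK1 j d
        _ ≤ (K * (κ ^ 3 / (κ + |(d : ℝ)|) ^ 4)) *
            (((κ + |(d : ℝ)|) / κ) ^ 2 * (energy σ κ + 4 / κ)) := by
          rw [← Finset.mul_sum]
          gcongr
          exact sum_norm_inner_shift_le hσ hκ hd
        _ = K * (energy σ κ + 4 / κ) * (κ / (κ + |(d : ℝ)|) ^ 2) := by
          have : 0 < (κ : ℝ) + |(d : ℝ)| := by positivity
          field_simp
  · calc K * (energy σ κ + 4 / κ) * b ≤ K * (energy σ κ + 4 / κ) * 3 := by gcongr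
      _ = _ := by ring

/-- The pairing of `Φ_N^*` with the localized increments of `Φ^*`. Frequencies
`0 ≤ d < κ²` do not contribute, by orthogonality. For low negative `d` Bessel's inequality is
combined with the decay `1 / |d|` of the coefficients of partial sums of bumps, which costs
a logarithm; at high frequencies the decay `κ / d²` suffices. -/
theorem norm_sum_inner_PhiS_bump_le (hσ : σ.support.Infinite) {h : ℝ → ℝ} (hh : IsProfile h)
    {κ : ℕ} (hκ : 3 ≤ κ) {K : ℝ} (hK : 0 < K)
    (hK2 : ∀ (J : ℕ) (d : ℤ), d ≠ 0 →
      ‖coeffC (∑ j ∈ Finset.range J, hh.bumpC hκ j : C(Circle, ℂ)) d‖ ≤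
      K * (κ / (|(d : ℝ)| * (κ + |(d : ℝ)|)))) :
    ‖∑ j ∈ Finset.range κ, inner ℂ (emb σ (PhiS σ (3 * κ ^ 2)))
        (emb σ (hh.bumpC hκ j * (PhiS σ (κ ^ 2 + κ * j) - PhiS σ (2 * κ ^ 2))))‖ ≤
      K * (2 * energy σ κ * (1 + Real.log κ) + 6 * Real.sqrt (energy σ κ)) := by
  have hκ0 : (0 : ℝ) < κ := by
    have : (3 : ℝ) ≤ κ := by exact_mod_cast hκ
    linarith
  have hκκ : κ ^ 2 = κ * κ := sq κ
  have hκ3 : 3 * κ ≤ κ * κ := Nat.mul_le_mul_right κ hκ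
  have hE := energy_nonneg (σ := σ) κ
  set N := 3 * κ ^ 2 with hN
  set W : ℕ → C(Circle, ℂ) := fun s =>
    ∑ j ∈ Finset.range ((s - κ ^ 2) / κ + 1), hh.bumpC hκ j with hW
  -- summation by parts: `W s` collects the bumps with `κ ^ 2 + κ * j ≤ s`
  have hT : ∑ j ∈ Finset.range κ, inner ℂ (emb σ (PhiS σ N))
      (emb σ (hh.bumpC hκ j * (PhiS σ (κ ^ 2 + κ * j) - PhiS σ (2 * κ ^ 2)))) =
      ∑ s ∈ Finset.Ico (κ ^ 2) (2 * κ ^ 2), verblunsky σ s *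
        inner ℂ (emb σ (PhiS σ N)) (emb σ (W s * (zeta 1 * Phi σ s))) := by
    have h1 : ∀ j ∈ Finset.range κ, inner ℂ (emb σ (PhiS σ N))
        (emb σ (hh.bumpC hκ j * (PhiS σ (κ ^ 2 + κ * j) - PhiS σ (2 * κ ^ 2)))) =
        ∑ s ∈ Finset.Ico (κ ^ 2 + κ * j) (2 * κ ^ 2), verblunsky σ s *
          inner ℂ (emb σ (PhiS σ N)) (emb σ (hh.bumpC hκ j * (zeta 1 * Phi σ s))) := by
      intro j hj
      rw [Finset.mem_range] at hj
      have hle : κ * j ≤ κ * κ := Nat.mul_le_mul_left κ hj.le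
      rw [PhiS_sub_PhiS hσ (by omega), Finset.mul_sum, map_sum, inner_sum]
      refine Finset.sum_congr rfl fun s _ => ?_
      rw [mul_smul_comm, map_smul, inner_smul_right]
    rw [Finset.sum_congr rfl h1]
    have h2 : ∀ s, verblunsky σ s *
        inner ℂ (emb σ (PhiS σ N)) (emb σ (W s * (zeta 1 * Phi σ s))) =
        ∑ j ∈ Finset.range ((s - κ ^ 2) / κ + 1), verblunsky σ s *
          inner ℂ (emb σ (PhiS σ N)) (emb σ (hh.bumpC hκ j * (zeta 1 * Phi σ s))) := fun s => by
      rw [hW]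
      simp only []
      rw [Finset.sum_mul, map_sum, inner_sum, Finset.mul_sum]
    simp_rw [h2]
    refine Finset.sum_comm' fun j s => ?_
    rw [Finset.mem_range, Finset.mem_Ico, Finset.mem_Ico, Finset.mem_range, Nat.lt_succ_iff,
      Nat.le_div_iff_mul_le (by omega), mul_comm j κ]
    constructor
    · rintro ⟨h3, h4, h5⟩
      omega
    · rintro ⟨h3, h4, h5⟩
      refine ⟨?_, by omega, h5⟩
      by_contra! hcon
      have := Nat.mul_le_mul_left κ hcon
      omega
  have hs := hasSum_sum fun s (_ : s ∈ Finset.Ico (κ ^ 2) (2 * κ ^ 2)) =>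
    (hasSum_inner_mul (σ := σ) (hh.summable_norm_coeffC hκ
      (Finset.range ((s - κ ^ 2) / κ + 1))) (PhiS σ N) (zeta 1 * Phi σ s)).mul_left
        (verblunsky σ s)
  rw [hT]
  obtain ⟨b₁, hb₁, hb₁'⟩ := exists_hasSum_inv_sq (κ := κ) (by omega)
  obtain ⟨b₂, hb₂, hb₂'⟩ := exists_hasSum_inv_mul (κ := κ) (by omega)
  refine (hs.norm_le_of_bounded (((hb₂.mul_left (Real.sqrt (energy σ κ))).add
    (hb₁.mul_left 2)).mul_left (K * Real.sqrt (energy σ κ))) fun d => ?_).trans ?_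
  · simp_rw [← mul_assoc (zeta d), zeta_mul]
    by_cases hd : 0 ≤ d ∧ d < κ ^ 2
    · rw [Finset.sum_eq_zero, norm_zero]
      · positivity
      · intro s hs
        rw [Finset.mem_Ico] at hs
        have hmem : zeta (d + 1) * Phi σ s ∈ trigSpan 1 N :=
          trigSpan_mono (by lia) (by push_cast [hN]; lia)
            (zeta_mul_mem_trigSpan (d + 1) (Phi_mem (σ := σ) s))
        rw [← inner_conj_symm, inner_PhiS hmem, map_zero, mul_zero, mul_zero]
    · have hd0 : d ≠ 0 := by
        rintro rfl
        exact hd ⟨le_rfl, by positivity⟩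
      set Q := ∑ s ∈ Finset.Ico (κ ^ 2) (2 * κ ^ 2),
        ‖inner ℂ (emb σ (PhiS σ N)) (emb σ (zeta (d + 1) * Phi σ s))‖ ^ 2 with hQ
      set w := (κ : ℝ) / (|(d : ℝ)| * (κ + |(d : ℝ)|)) with hw
      have hw0 : 0 ≤ w := by positivity
      have hbound : ‖∑ s ∈ Finset.Ico (κ ^ 2) (2 * κ ^ 2), verblunsky σ s *
          (coeffC (∑ j ∈ Finset.range ((s - κ ^ 2) / κ + 1), hh.bumpC hκ j : C(Circle, ℂ)) d *
            inner ℂ (emb σ (PhiS σ N)) (emb σ (zeta (d + 1) * Phi σ s)))‖ ≤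
          K * w * (Real.sqrt (energy σ κ) * Real.sqrt Q) := by
        calc _ ≤ ∑ s ∈ Finset.Ico (κ ^ 2) (2 * κ ^ 2), K * w * (‖verblunsky σ s‖ *
              ‖inner ℂ (emb σ (PhiS σ N)) (emb σ (zeta (d + 1) * Phi σ s))‖) := by
              refine (norm_sum_le _ _).trans (Finset.sum_le_sum fun s _ => ?_)
              rw [norm_mul, norm_mul, mul_left_comm]
              gcongr
              exact hK2 _ d hd0
          _ ≤ K * w * (Real.sqrt (∑ s ∈ Finset.Ico (κ ^ 2) (2 * κ ^ 2), ‖verblunsky σ s‖ ^ 2) *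
              Real.sqrt Q) := by
              rw [← Finset.mul_sum]
              gcongr
              exact Real.sum_mul_le_sqrt_mul_sqrt _ _ _
          _ ≤ K * w * (Real.sqrt (energy σ κ) * Real.sqrt Q) := by
              gcongr
              exact Finset.sum_le_sum_of_subset_of_nonneg
                (Finset.Ico_subset_Ico (by omega) (by omega)) fun _ _ _ => sq_nonneg _
      refine hbound.trans ?_
      rw [show K * w * (Real.sqrt (energy σ κ) * Real.sqrt Q) =
        K * Real.sqrt (energy σ κ) * (Real.sqrt Q * w) by ring]
      gcongr K * Real.sqrt (energy σ κ) * ?_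
      have hv : (0 : ℝ) ≤ 2 * (κ / (κ + |(d : ℝ)|) ^ 2) := by positivity
      by_cases hdd : d < 0 ∧ 2 * d.natAbs ≤ κ ^ 2
      · -- low negative frequencies
        have hQE : Q ≤ energy σ κ := by
          have h1 := sum_norm_inner_PhiS_le hσ (N := N) (a := κ ^ 2 - d.natAbs)
            (k := d.natAbs - 1) (n := κ ^ 2) (m := 2 * κ ^ 2) (by omega) (by omega)
          rw [show -((d.natAbs - 1 : ℕ) : ℤ) = d + 1 by omega] at h1
          exact h1.trans (en_sub_le_energy hσ (by omega) le_rfl)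
        have : Real.sqrt Q * w ≤ Real.sqrt (energy σ κ) * w := by gcongr
        linarith
      · -- high frequencies
        have hQ1 : Real.sqrt Q ≤ 1 := Real.sqrt_le_one.2 (sum_norm_inner_PhiS_le_one hσ _ _ _)
        have hdκ : κ ≤ d.natAbs := by
          by_contra! hcon
          rcases lt_or_ge d 0 with h1 | h1
          · exact hdd ⟨h1, by nlinarith⟩
          · refine hd ⟨h1, ?_⟩
            have h2 : (κ : ℤ) ^ 2 = κ * κ := sq _
            have h3 : (3 : ℤ) * κ ≤ κ * κ := by exact_mod_cast hκ3
            omega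
        have hdκ' : (κ : ℝ) ≤ |(d : ℝ)| := by
          have h1 : |(d : ℝ)| = d.natAbs := by rw [Nat.cast_natAbs, Int.cast_abs]
          rw [h1]
          exact_mod_cast hdκ
        have hdp : 0 < |(d : ℝ)| := hκ0.trans_le hdκ'
        have h1 : w ≤ 2 * (κ / (κ + |(d : ℝ)|) ^ 2) := by
          rw [hw, ← mul_div_assoc, div_le_div_iff₀ (by positivity) (by positivity)]
          have : (κ : ℝ) + |(d : ℝ)| ≤ 2 * |(d : ℝ)| := by linarith
          calc (κ : ℝ) * (κ + |(d : ℝ)|) ^ 2 = κ * (κ + |(d : ℝ)|) * (κ + |(d : ℝ)|) := by ring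
            _ ≤ κ * (κ + |(d : ℝ)|) * (2 * |(d : ℝ)|) := by gcongr
            _ = _ := by ring
        have h2 : Real.sqrt Q * w ≤ w := mul_le_of_le_one_left hw0 hQ1
        have h3 : 0 ≤ Real.sqrt (energy σ κ) * w := by positivity
        linarith
  · have h1 := Real.mul_self_sqrt hE
    calc K * Real.sqrt (energy σ κ) * (Real.sqrt (energy σ κ) * b₂ + 2 * b₁)
        ≤ K * Real.sqrt (energy σ κ) * (Real.sqrt (energy σ κ) * (2 * (1 + Real.log κ)) +
          2 * 3) := by gcongr
      _ = K * (2 * (Real.sqrt (energy σ κ) * Real.sqrt (energy σ κ)) * (1 + Real.log κ) +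
          6 * Real.sqrt (energy σ κ)) := by ring
      _ = _ := by rw [h1]

end Pairings

/-! ### Vanishing of the localized differences -/

section Limits

variable {σ : Measure Circle}

theorem tendsto_energy
    (hlog : Tendsto
      (fun n : ℕ => Real.log n * ∑ s ∈ Finset.Icc n (2 * n), ‖verblunsky σ s‖ ^ 2)
      atTop (𝓝 0)) :
    Tendsto (fun κ : ℕ => energy σ κ) atTop (𝓝 0) ∧
      Tendsto (fun κ : ℕ => Real.log κ * energy σ κ) atTop (𝓝 0) := by
  set g : ℕ → ℝ := fun n => ∑ s ∈ Finset.Icc n (2 * n), ‖verblunsky σ s‖ ^ 2 with hg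
  have hg0 : ∀ n, 0 ≤ g n := fun n => Finset.sum_nonneg fun _ _ => sq_nonneg _
  have hm : Tendsto (fun κ : ℕ => κ ^ 2 / 2) atTop atTop := by
    refine tendsto_atTop_mono' atTop ?_ tendsto_id
    filter_upwards [eventually_ge_atTop 2] with κ hκ
    rw [id, Nat.le_div_iff_mul_le (by norm_num)]
    nlinarith
  have hlim : ∀ c : ℕ, 0 < c → Tendsto (fun κ : ℕ => Real.log ((c * (κ ^ 2 / 2) : ℕ) : ℝ) *
      g (c * (κ ^ 2 / 2))) atTop (𝓝 0) := fun c hc =>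
    hlog.comp ((tendsto_id.const_mul_atTop' hc).comp hm)
  have h2 : Tendsto (fun κ : ℕ => Real.log κ * energy σ κ) atTop (𝓝 0) := by
    have hmaj := ((hlim 1 one_pos).add (hlim 2 two_pos)).add (hlim 4 four_pos)
    rw [add_zero, add_zero] at hmaj
    refine squeeze_zero' ?_ ?_ hmaj
    · filter_upwards with κ
      exact mul_nonneg (Real.log_natCast_nonneg κ) (energy_nonneg κ)
    · filter_upwards [eventually_ge_atTop 3] with κ hκ
      set m := κ ^ 2 / 2 with hm
      have hκκ : κ ^ 2 = κ * κ := sq κ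
      have hκ3 : 3 * κ ≤ κ * κ := Nat.mul_le_mul_right κ hκ
      -- three dyadic blocks cover the range of indices
      have hsum : energy σ κ ≤ g (1 * m) + g (2 * m) + g (4 * m) := by
        have hsub : Finset.Ico m (3 * κ ^ 2) ⊆
            (Finset.Icc (1 * m) (2 * (1 * m)) ∪ Finset.Icc (2 * m) (2 * (2 * m))) ∪
              Finset.Icc (4 * m) (2 * (4 * m)) := fun s hs => by
          simp only [Finset.mem_union, Finset.mem_Icc, Finset.mem_Ico] at hs ⊢
          omega
        refine (Finset.sum_le_sum_of_subset_of_nonneg hsub fun _ _ _ => sq_nonneg _).trans ?_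
        have hun : ∀ A B : Finset ℕ, ∑ s ∈ A ∪ B, ‖verblunsky σ s‖ ^ 2 ≤
            ∑ s ∈ A, ‖verblunsky σ s‖ ^ 2 + ∑ s ∈ B, ‖verblunsky σ s‖ ^ 2 := fun A B => by
          rw [← Finset.sum_union_inter]
          exact le_add_of_nonneg_right (Finset.sum_nonneg fun _ _ => sq_nonneg _)
        exact (hun _ _).trans (add_le_add_left (hun _ _) _)
      have hκ0 : (0 : ℝ) < κ := by
        have : (3 : ℝ) ≤ κ := by exact_mod_cast hκ
        linarith
      have hl : ∀ c : ℕ, 0 < c → Real.log κ ≤ Real.log ((c * m : ℕ) : ℝ) := fun c hc => by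
        refine Real.log_le_log hκ0 ?_
        have h1 : κ ≤ m := by omega
        exact_mod_cast h1.trans (Nat.le_mul_of_pos_left m hc)
      have h1 := mul_le_mul_of_nonneg_left hsum (Real.log_natCast_nonneg κ)
      have h2 := mul_le_mul_of_nonneg_right (hl 1 one_pos) (hg0 (1 * m))
      have h3 := mul_le_mul_of_nonneg_right (hl 2 two_pos) (hg0 (2 * m))
      have h4 := mul_le_mul_of_nonneg_right (hl 4 four_pos) (hg0 (4 * m))
      linarith
  refine ⟨squeeze_zero' (Eventually.of_forall fun κ => energy_nonneg κ) ?_ h2, h2⟩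
  have hlog1 : ∀ᶠ κ : ℕ in atTop, 1 ≤ Real.log κ :=
    (Real.tendsto_log_atTop.comp tendsto_natCast_atTop_atTop).eventually_ge_atTop 1
  filter_upwards [hlog1] with κ hκ
  exact le_mul_of_one_le_left (energy_nonneg κ) hκ

variable [IsProbabilityMeasure σ]

theorem integral_bump_mul_norm_sub_sq {h : ℝ → ℝ} (hh : IsProfile h) {κ : ℕ} (hκ : 3 ≤ κ) (j : ℕ)
    (A B : C(Circle, ℂ)) :
    ∫ z, bump h κ j z * ‖A z - B z‖ ^ 2 ∂σ =
      (inner ℂ (emb σ A) (emb σ (hh.bumpC hκ j * A)) +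
        inner ℂ (emb σ B) (emb σ (hh.bumpC hκ j * B)) -
        2 * inner ℂ (emb σ B) (emb σ (hh.bumpC hκ j * A))).re := by
  have hi : ∀ f g : C(Circle, ℂ), Integrable (fun z => g z * conj (f z)) σ := fun f g =>
    integrable_continuousMap (g * star f)
  have h1 : (2 : ℂ) * inner ℂ (emb σ B) (emb σ (hh.bumpC hκ j * A)) =
      inner ℂ (emb σ B) (emb σ (hh.bumpC hκ j * (A + A))) := by
    rw [mul_add, map_add, inner_add_right, two_mul]
  have hi2 : Integrable (fun z => (hh.bumpC hκ j * A) z * conj (A z) +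
      (hh.bumpC hκ j * B) z * conj (B z)) σ := (hi _ _).add (hi _ _)
  have hi3 : Integrable (fun z => (hh.bumpC hκ j * A) z * conj (A z) +
      (hh.bumpC hκ j * B) z * conj (B z) - (hh.bumpC hκ j * (A + A)) z * conj (B z)) σ :=
    hi2.sub (hi _ _)
  rw [h1, inner_emb, inner_emb, inner_emb, ← integral_add (hi _ _) (hi _ _),
    ← integral_sub hi2 (hi _ _), ← integral_complex_re hi3]
  refine integral_congr_ae (ae_of_all _ fun z => ?_)
  simp only [ContinuousMap.mul_apply, ContinuousMap.add_apply, IsProfile.bumpC_apply]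
  rw [← Complex.normSq_eq_norm_sq, Complex.normSq_apply]
  simp
  ring

/-- The polynomials `Φ_{N_j}^*` are close to `Φ_N^*` in mean square on the supports of the bumps. -/
theorem tendsto_sum_integral_bump (hσ : σ.support.Infinite)
    (hlog : Tendsto
      (fun n : ℕ => Real.log n * ∑ s ∈ Finset.Icc n (2 * n), ‖verblunsky σ s‖ ^ 2)
      atTop (𝓝 0)) {h : ℝ → ℝ} (hh : IsProfile h) :
    Tendsto (fun κ : ℕ => ∑ j ∈ Finset.range κ,
      ∫ z, bump h κ j z * ‖PhiS σ (κ ^ 2 + κ * j) z - PhiS σ (3 * κ ^ 2) z‖ ^ 2 ∂σ)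
      atTop (𝓝 0) := by
  obtain ⟨K, hK, hK'⟩ := hh.exists_norm_coeffC_le
  obtain ⟨hE, hEl⟩ := tendsto_energy hlog
  have hmaj : Tendsto (fun κ : ℕ => energy σ κ + 3 * K * (energy σ κ + 4 / κ) +
      2 * (K * (2 * (energy σ κ + Real.log κ * energy σ κ) + 6 * Real.sqrt (energy σ κ))))
      atTop (𝓝 0) := by
    have h4 : Tendsto (fun κ : ℕ => (4 : ℝ) / κ) atTop (𝓝 0) :=
      tendsto_const_div_atTop_nhds_zero_nat 4
    have := (hE.add ((hE.add h4).const_mul (3 * K))).add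
      (((((hE.add hEl).const_mul 2).add (hE.sqrt.const_mul 6)).const_mul K).const_mul 2)
    simpa using this
  refine squeeze_zero' (Eventually.of_forall fun κ => Finset.sum_nonneg fun j _ =>
    integral_nonneg fun z => mul_nonneg (hh.nonneg _) (sq_nonneg _)) ?_ hmaj
  filter_upwards [hh.sum_eq_one, eventually_ge_atTop 3] with κ hκ1 hκ
  have hκ0 : (0 : ℝ) < κ := by
    have : (3 : ℝ) ≤ κ := by exact_mod_cast hκ
    linarith
  have hone : ∑ j ∈ Finset.range κ, hh.bumpC hκ j = 1 := by
    ext z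
    simp only [ContinuousMap.sum_apply, IsProfile.bumpC_apply, ContinuousMap.one_apply]
    rw [← Complex.ofReal_sum, hκ1 z, Complex.ofReal_one]
  have hb1 := norm_sum_inner_Phi_bump_le hσ hh hκ hK (hK' κ hκ).1
  have hb2 := norm_sum_inner_PhiS_bump_le hσ hh hκ hK (hK' κ hκ).2
  set N := 3 * κ ^ 2 with hN
  simp_rw [integral_bump_mul_norm_sub_sq hh hκ, inner_PhiS_mul (κ ^ 2 + κ * _)]
  rw [← Complex.re_sum, Finset.sum_sub_distrib, Finset.sum_add_distrib, ← Finset.mul_sum]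
  have hB : ∑ j ∈ Finset.range κ, inner ℂ (emb σ (PhiS σ N)) (emb σ (hh.bumpC hκ j * PhiS σ N)) =
      (en σ N : ℂ) := by
    rw [← inner_sum, ← map_sum, ← Finset.sum_mul, hone, one_mul, inner_self_eq_norm_sq_to_K,
      ← norm_PhiS_sq]
    push_cast
    rfl
  have hcross : ∑ j ∈ Finset.range κ, inner ℂ (emb σ (PhiS σ N))
      (emb σ (hh.bumpC hκ j * PhiS σ (κ ^ 2 + κ * j))) =
      ∑ j ∈ Finset.range κ, inner ℂ (emb σ (PhiS σ N))
        (emb σ (hh.bumpC hκ j * (PhiS σ (κ ^ 2 + κ * j) - PhiS σ (2 * κ ^ 2)))) +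
        (en σ N : ℂ) := by
    have h1 : inner ℂ (emb σ (PhiS σ N)) (emb σ (PhiS σ (2 * κ ^ 2))) = (en σ N : ℂ) := by
      have h2 := inner_PhiS (σ := σ) (PhiS_sub_mem (σ := σ) (a := 2 * κ ^ 2) (b := N) (by omega))
      rw [map_sub, inner_sub_left, sub_eq_zero] at h2
      rw [← inner_conj_symm, h2, inner_self_eq_norm_sq_to_K, ← norm_PhiS_sq]
      simp
    simp_rw [mul_sub, map_sub, inner_sub_right]
    rw [Finset.sum_sub_distrib, ← inner_sum _ fun j => emb σ (hh.bumpC hκ j * PhiS σ (2 * κ ^ 2)),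
      ← map_sum, ← Finset.sum_mul, hone, one_mul, h1, sub_add_cancel]
  rw [hB, hcross]
  set S₁ := ∑ j ∈ Finset.range κ, inner ℂ (emb σ (Phi σ (κ ^ 2 + κ * j)))
        (emb σ (hh.bumpC hκ j * Phi σ (κ ^ 2 + κ * j)))
  set T := ∑ j ∈ Finset.range κ, inner ℂ (emb σ (PhiS σ N))
        (emb σ (hh.bumpC hκ j * (PhiS σ (κ ^ 2 + κ * j) - PhiS σ (2 * κ ^ 2))))
  have hav : (∑ j ∈ Finset.range κ, (1 / κ : ℂ) * (en σ (κ ^ 2 + κ * j) : ℂ)) =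
      ((∑ j ∈ Finset.range κ, (1 / κ : ℝ) * en σ (κ ^ 2 + κ * j) : ℝ) : ℂ) := by
    push_cast
    rfl
  have hav2 : ∑ j ∈ Finset.range κ, (1 / κ : ℝ) * en σ (κ ^ 2 + κ * j) ≤ en σ (κ ^ 2) := by
    refine (Finset.sum_le_card_nsmul _ _ ((1 / κ : ℝ) * en σ (κ ^ 2)) fun j _ => ?_).trans ?_
    · gcongr
      exact en_antitone (Nat.le_add_right _ _)
    · rw [Finset.card_range, nsmul_eq_mul, ← mul_assoc, mul_one_div_cancel hκ0.ne', one_mul]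
  rw [hav] at hb1
  have h1 := (Complex.re_le_norm _).trans hb1
  rw [Complex.sub_re, Complex.ofReal_re] at h1
  have h2 := (abs_le.1 ((Complex.abs_re_le_norm T).trans hb2)).1
  have h3 : en σ (κ ^ 2) - en σ N ≤ energy σ κ := en_sub_le_energy hσ (by omega) le_rfl
  simp only [Complex.sub_re, Complex.add_re, Complex.mul_re, Complex.ofReal_re, Complex.re_ofNat,
    Complex.im_ofNat, zero_mul, sub_zero]
  nlinarith

end Limits

/-! ### Comparison of the packets with the Szegő function -/

theorem norm_add_add_sq_le (a b c : ℂ) :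
    ‖a + b + c‖ ^ 2 ≤ 3 * (‖a‖ ^ 2 + ‖b‖ ^ 2 + ‖c‖ ^ 2) := by
  have h := norm_add₃_le (a := a) (b := b) (c := c)
  nlinarith [norm_nonneg (a + b + c), sq_nonneg (‖a‖ - ‖b‖), sq_nonneg (‖a‖ - ‖c‖),
    sq_nonneg (‖b‖ - ‖c‖), norm_nonneg a, norm_nonneg b, norm_nonneg c]

/-- Jensen's inequality for a partition of unity. -/
theorem norm_sum_mul_sq_le {s : Finset ℕ} {f a : ℕ → ℂ} {w : ℕ → ℝ} {M : ℝ}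
    (hf : ∀ j ∈ s, ‖f j‖ ≤ M) (hw : ∀ j ∈ s, 0 ≤ w j) (hw1 : ∑ j ∈ s, w j = 1) :
    ‖∑ j ∈ s, f j * w j * a j‖ ^ 2 ≤ M ^ 2 * ∑ j ∈ s, w j * ‖a j‖ ^ 2 := by
  have h1 : ‖∑ j ∈ s, f j * w j * a j‖ ≤ M * ∑ j ∈ s, w j * ‖a j‖ := by
    rw [Finset.mul_sum]
    refine (norm_sum_le _ _).trans (Finset.sum_le_sum fun j hj => ?_)
    rw [norm_mul, norm_mul, Complex.norm_real, Real.norm_eq_abs, abs_of_nonneg (hw j hj), mul_assoc]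
    have := mul_nonneg (hw j hj) (norm_nonneg (a j))
    gcongr
    exact hf j hj
  have h2 := Finset.sum_sq_le_sum_mul_sum_of_sq_le_mul s (r := fun j => w j * ‖a j‖) (f := w)
    (g := fun j => w j * ‖a j‖ ^ 2) hw (fun j hj => mul_nonneg (hw j hj) (sq_nonneg _))
    (fun j _ => le_of_eq (by ring))
  rw [hw1, one_mul] at h2
  calc ‖∑ j ∈ s, f j * w j * a j‖ ^ 2 ≤ (M * ∑ j ∈ s, w j * ‖a j‖) ^ 2 := by gcongr
    _ = M ^ 2 * (∑ j ∈ s, w j * ‖a j‖) ^ 2 := by ring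
    _ ≤ _ := by gcongr

theorem IsProfile.measurable_bump {h : ℝ → ℝ} (hh : IsProfile h) (κ j : ℕ) :
    Measurable (bump h κ j) := by
  have h1 : Continuous fun z : Circle => ((z / Circle.exp (2 * Real.pi * j / κ) : Circle) : ℂ) :=
    continuous_subtype_val.comp (continuous_id.div_const _)
  exact hh.smooth.continuous.measurable.comp
    ((Complex.measurable_arg.comp h1.measurable).const_mul (κ : ℝ))

theorem IsProfile.exists_abs_le {h : ℝ → ℝ} (hh : IsProfile h) : ∃ C : ℝ, ∀ x, |h x| ≤ C := by
  obtain ⟨C, hC⟩ := isCompact_Icc.exists_bound_of_continuousOn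
    (s := Set.Icc (-(2 * Real.pi)) (2 * Real.pi)) hh.smooth.continuous.continuousOn
  refine ⟨max C 0, fun x => ?_⟩
  by_cases hx : x ∈ Function.support h
  · exact (hC x (hh.support_subset hx)).trans (le_max_left _ _)
  · rw [Function.notMem_support.1 hx, abs_zero]
    exact le_max_right _ _

section Packets

variable {σ : Measure Circle} [IsProbabilityMeasure σ]

theorem packetSum_sub_eq (h : ℝ → ℝ) (f : ℕ → ℕ → ℂ) (κ : ℕ) (P : ℂ) (z : Circle) :
    packetSum σ h f κ z - P * ∑ j ∈ Finset.range κ, f j κ * (bump h κ j z : ℂ) =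
      ∑ j ∈ Finset.range κ, f j κ * (bump h κ j z : ℂ) * (phiS σ (κ ^ 2 + κ * j) z - P) := by
  rw [packetSum, Finset.mul_sum, ← Finset.sum_sub_distrib]
  refine Finset.sum_congr rfl fun j _ => ?_
  rw [revOP_eq]
  ring

theorem memLp_phiS (n : ℕ) : MemLp (fun z => phiS σ n z) 2 σ :=
  (memLp_two_iff_integrable_sq_norm (phiS σ n).continuous.aestronglyMeasurable).2
    (integrable_continuousMap (⟨_, (phiS σ n).continuous.norm.pow 2⟩ : C(Circle, ℝ)))

theorem memLp_packetSum_sub {h : ℝ → ℝ} (hh : IsProfile h) (f : ℕ → ℕ → ℂ) (κ : ℕ)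
    {P : Circle → ℂ} (hP : MemLp P 2 σ) :
    MemLp (fun z => packetSum σ h f κ z -
      P z * ∑ j ∈ Finset.range κ, f j κ * (bump h κ j z : ℂ)) 2 σ := by
  obtain ⟨C, hC⟩ := hh.exists_abs_le
  simp_rw [packetSum_sub_eq]
  refine memLp_finsetSum _ fun j _ => ?_
  have h1 : MemLp (fun z => phiS σ (κ ^ 2 + κ * j) z - P z) 2 σ := (memLp_phiS _).sub hP
  have hm : Measurable fun z => f j κ * (bump h κ j z : ℂ) :=
    (Complex.measurable_ofReal.comp (hh.measurable_bump κ j)).const_mul _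
  refine h1.of_le_mul (c := ‖f j κ‖ * C) (hm.aestronglyMeasurable.mul h1.1)
    (ae_of_all _ fun z => ?_)
  rw [norm_mul, norm_mul, Complex.norm_real]
  gcongr
  exact hC _

/-- The error is controlled by the localized differences, the variation of the norms `‖Φ_n‖` and
the distance of `φ_N^*` to the limit, where `N = 3κ²`. -/
theorem integral_norm_packetSum_sub_sq_le {h : ℝ → ℝ} (hh : IsProfile h) {f : ℕ → ℕ → ℂ} {κ : ℕ}
    (hκ : 3 ≤ κ) (hκ1 : ∀ z : Circle, ∑ j ∈ Finset.range κ, bump h κ j z = 1) {M : ℝ}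
    (hf : ∀ j < κ, ‖f j κ‖ ≤ M) {P : Circle → ℂ} (hP : MemLp P 2 σ) {e : ℝ} (he0 : 0 < e)
    (he : ∀ n, e ≤ en σ n) :
    ∫ z, ‖packetSum σ h f κ z - P z * ∑ j ∈ Finset.range κ, f j κ * (bump h κ j z : ℂ)‖ ^ 2 ∂σ ≤
      3 * M ^ 2 * (e⁻¹ * ∑ j ∈ Finset.range κ,
          ∫ z, bump h κ j z * ‖PhiS σ (κ ^ 2 + κ * j) z - PhiS σ (3 * κ ^ 2) z‖ ^ 2 ∂σ +
        ((Real.sqrt (en σ (3 * κ ^ 2)))⁻¹ - (Real.sqrt (en σ (κ ^ 2)))⁻¹) ^ 2 +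
        ∫ z, ‖phiS σ (3 * κ ^ 2) z - P z‖ ^ 2 ∂σ) := by
  set N := 3 * κ ^ 2 with hN
  set t := (Real.sqrt (en σ N))⁻¹ - (Real.sqrt (en σ (κ ^ 2)))⁻¹ with ht
  have hκκ : κ ^ 2 = κ * κ := sq κ
  have hpos : ∀ n, 0 < Real.sqrt (en σ n) := fun n => Real.sqrt_pos.2 (he0.trans_le (he n))
  have hanti : ∀ {a b : ℕ}, a ≤ b → (Real.sqrt (en σ a))⁻¹ ≤ (Real.sqrt (en σ b))⁻¹ :=
    fun {a b} hab => inv_anti₀ (hpos b) (Real.sqrt_le_sqrt (en_antitone hab))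
  have hi1 : ∀ j, Integrable
      (fun z => bump h κ j z * ‖PhiS σ (κ ^ 2 + κ * j) z - PhiS σ N z‖ ^ 2) σ := fun j =>
    integrable_continuousMap (⟨_, (hh.continuous_bump hκ j).mul
      ((PhiS σ (κ ^ 2 + κ * j) - PhiS σ N).continuous.norm.pow 2)⟩ : C(Circle, ℝ))
  have hi2 : Integrable (fun z => ‖PhiS σ N z‖ ^ 2) σ :=
    integrable_continuousMap (⟨_, (PhiS σ N).continuous.norm.pow 2⟩ : C(Circle, ℝ))
  have hL : MemLp (fun z => phiS σ N z - P z) 2 σ := (memLp_phiS N).sub hP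
  have hi3 : Integrable (fun z => ‖phiS σ N z - P z‖ ^ 2) σ :=
    (memLp_two_iff_integrable_sq_norm hL.1).1 hL
  have hi4 := (integrable_finsetSum (Finset.range κ) fun j _ => hi1 j).const_mul e⁻¹
  have hi5 : Integrable (fun z => e⁻¹ * ∑ j ∈ Finset.range κ,
      bump h κ j z * ‖PhiS σ (κ ^ 2 + κ * j) z - PhiS σ N z‖ ^ 2 + t ^ 2 * ‖PhiS σ N z‖ ^ 2) σ :=
    hi4.add (hi2.const_mul _)
  have hi6 : Integrable (fun z => e⁻¹ * ∑ j ∈ Finset.range κ,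
      bump h κ j z * ‖PhiS σ (κ ^ 2 + κ * j) z - PhiS σ N z‖ ^ 2 + t ^ 2 * ‖PhiS σ N z‖ ^ 2 +
      ‖phiS σ N z - P z‖ ^ 2) σ := hi5.add hi3
  have hF := memLp_packetSum_sub hh f κ hP
  have hpt : ∀ z, ‖packetSum σ h f κ z -
      P z * ∑ j ∈ Finset.range κ, f j κ * (bump h κ j z : ℂ)‖ ^ 2 ≤
      3 * M ^ 2 * (e⁻¹ * ∑ j ∈ Finset.range κ,
        bump h κ j z * ‖PhiS σ (κ ^ 2 + κ * j) z - PhiS σ N z‖ ^ 2 + t ^ 2 * ‖PhiS σ N z‖ ^ 2 +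
        ‖phiS σ N z - P z‖ ^ 2) := by
    intro z
    rw [packetSum_sub_eq]
    refine (norm_sum_mul_sq_le (fun j hj => hf j (Finset.mem_range.1 hj))
      (fun j _ => hh.nonneg _) (hκ1 z)).trans ?_
    rw [mul_comm 3 (M ^ 2), mul_assoc]
    gcongr M ^ 2 * ?_
    have hterm : ∀ j ∈ Finset.range κ,
        bump h κ j z * ‖phiS σ (κ ^ 2 + κ * j) z - P z‖ ^ 2 ≤
        3 * e⁻¹ * (bump h κ j z * ‖PhiS σ (κ ^ 2 + κ * j) z - PhiS σ N z‖ ^ 2) +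
          bump h κ j z * (3 * (t ^ 2 * ‖PhiS σ N z‖ ^ 2 + ‖phiS σ N z - P z‖ ^ 2)) := by
      intro j hj
      have hj' : κ * j ≤ κ * κ := Nat.mul_le_mul_left κ (Finset.mem_range.1 hj).le
      set c := (Real.sqrt (en σ (κ ^ 2 + κ * j)))⁻¹ with hc
      have hdec : phiS σ (κ ^ 2 + κ * j) z - P z =
          (c : ℂ) * (PhiS σ (κ ^ 2 + κ * j) z - PhiS σ N z) +
            ((c - (Real.sqrt (en σ N))⁻¹ : ℝ) : ℂ) * PhiS σ N z + (phiS σ N z - P z) := by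
        simp only [phiS, ContinuousMap.smul_apply, smul_eq_mul, ← hc]
        push_cast
        ring
      have h1 := norm_add_add_sq_le ((c : ℂ) * (PhiS σ (κ ^ 2 + κ * j) z - PhiS σ N z))
        (((c - (Real.sqrt (en σ N))⁻¹ : ℝ) : ℂ) * PhiS σ N z) (phiS σ N z - P z)
      rw [← hdec, norm_mul, norm_mul, Complex.norm_real, Complex.norm_real, Real.norm_eq_abs,
        Real.norm_eq_abs, mul_pow, mul_pow, sq_abs, sq_abs] at h1
      have hc2 : c ^ 2 ≤ e⁻¹ := by
        rw [hc, inv_pow, Real.sq_sqrt (en_nonneg _)]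
        exact inv_anti₀ he0 (he _)
      have ht2 : (c - (Real.sqrt (en σ N))⁻¹) ^ 2 ≤ t ^ 2 := by
        rw [← neg_sq, neg_sub]
        have h2 : c ≤ (Real.sqrt (en σ N))⁻¹ := hanti (by omega)
        have h3 : (Real.sqrt (en σ (κ ^ 2)))⁻¹ ≤ c := hanti (Nat.le_add_right _ _)
        exact pow_le_pow_left₀ (by linarith) (by linarith) 2
      have hb : 0 ≤ bump h κ j z := hh.nonneg _
      calc bump h κ j z * ‖phiS σ (κ ^ 2 + κ * j) z - P z‖ ^ 2
          ≤ bump h κ j z * (3 * (e⁻¹ * ‖PhiS σ (κ ^ 2 + κ * j) z - PhiS σ N z‖ ^ 2 +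
            t ^ 2 * ‖PhiS σ N z‖ ^ 2 + ‖phiS σ N z - P z‖ ^ 2)) := by
            gcongr
            refine h1.trans ?_
            gcongr
        _ = _ := by ring
    refine (Finset.sum_le_sum hterm).trans ?_
    rw [Finset.sum_add_distrib, ← Finset.mul_sum, ← Finset.sum_mul, hκ1 z]
    linarith
  refine (integral_mono ((memLp_two_iff_integrable_sq_norm hF.1).1 hF)
    (hi6.const_mul _) hpt).trans ?_
  rw [integral_const_mul]
  have h1 : ∫ z, ‖PhiS σ N z‖ ^ 2 ∂σ ≤ 1 := by
    rw [← norm_emb_sq, norm_PhiS_sq]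
    exact en_le_one N
  rw [integral_add hi5 hi3, integral_add hi4 (hi2.const_mul _), integral_const_mul,
    integral_const_mul, integral_finsetSum _ fun j _ => hi1 j]
  have h2 := mul_le_of_le_one_right (sq_nonneg t) h1
  gcongr

end Packets

end OPUC

end

theorem theorem2p6 (σ : Measure Circle) [IsProbabilityMeasure σ]
    (hσ : σ.support.Infinite)
    (hSzego : Summable fun n : ℕ => ‖OPUC.verblunsky σ n‖ ^ 2)
    (hlog : Tendsto
      (fun n : ℕ => Real.log n * ∑ s ∈ Finset.Icc n (2 * n), ‖OPUC.verblunsky σ s‖ ^ 2)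
      atTop (𝓝 0))
    (E : Set Circle) (hE : OPUC.IsAcSet σ E)
    (h : ℝ → ℝ) (hh : OPUC.IsProfile h)
    (f : ℕ → ℕ → ℂ) (hf : ∃ M : ℝ, ∀ κ j : ℕ, j < κ → ‖f j κ‖ ≤ M) :
    (∀ κ : ℕ, MemLp (fun z : Circle => OPUC.packetSum σ h f κ z -
        OPUC.szegoPi σ E z * ∑ j ∈ Finset.range κ, f j κ * (OPUC.bump h κ j z : ℂ)) 2 σ) ∧
    Tendsto
      (fun κ : ℕ => eLpNorm (fun z : Circle => OPUC.packetSum σ h f κ z -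
        OPUC.szegoPi σ E z * ∑ j ∈ Finset.range κ, f j κ * (OPUC.bump h κ j z : ℂ)) 2 σ)
      atTop (𝓝 0) := by
  obtain ⟨e, he0, he, hlim⟩ := OPUC.exists_en_limit hσ hSzego
  obtain ⟨hP, hPn⟩ := OPUC.memLp_szegoPi_and_integral_le hE he he0
  have hmem := fun κ => OPUC.memLp_packetSum_sub hh f κ hP
  refine ⟨hmem, ?_⟩
  obtain ⟨M, hM⟩ := hf
  have hsq : Tendsto (fun κ : ℕ => κ ^ 2) atTop atTop := tendsto_pow_atTop two_ne_zero
  have hsq3 : Tendsto (fun κ : ℕ => 3 * κ ^ 2) atTop atTop := hsq.const_mul_atTop' three_pos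
  have hsqrt : Tendsto (fun n => Real.sqrt (OPUC.en σ n)) atTop (𝓝 (Real.sqrt e)) := hlim.sqrt
  have hse : Real.sqrt e ≠ 0 := (Real.sqrt_pos.2 he0).ne'
  have hPlim : Tendsto (fun κ : ℕ => ∫ z, ‖OPUC.phiS σ (3 * κ ^ 2) z - OPUC.szegoPi σ E z‖ ^ 2 ∂σ)
      atTop (𝓝 0) := by
    refine squeeze_zero (fun κ => integral_nonneg fun z => sq_nonneg _)
      (fun κ => hPn (3 * κ ^ 2)) ?_
    have h1 := (((tendsto_const_nhds (x := Real.sqrt e)).div (hsqrt.comp hsq3) hse).const_mul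
      2).const_sub 2
    rw [div_self hse, mul_one, sub_self] at h1
    exact h1
  have htlim : Tendsto (fun κ : ℕ => ((Real.sqrt (OPUC.en σ (3 * κ ^ 2)))⁻¹ -
      (Real.sqrt (OPUC.en σ (κ ^ 2)))⁻¹) ^ 2) atTop (𝓝 0) := by
    have h1 := (((hsqrt.comp hsq3).inv₀ hse).sub ((hsqrt.comp hsq).inv₀ hse)).pow 2
    simpa using h1
  have hint : Tendsto (fun κ : ℕ => ∫ z, ‖OPUC.packetSum σ h f κ z -
      OPUC.szegoPi σ E z * ∑ j ∈ Finset.range κ, f j κ * (OPUC.bump h κ j z : ℂ)‖ ^ 2 ∂σ)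
      atTop (𝓝 0) := by
    refine squeeze_zero' (Eventually.of_forall fun κ => integral_nonneg fun z => sq_nonneg _) ?_
      (by simpa using ((((OPUC.tendsto_sum_integral_bump hσ hlog hh).const_mul e⁻¹).add
        htlim).add hPlim).const_mul (3 * M ^ 2))
    filter_upwards [hh.sum_eq_one, eventually_ge_atTop 3] with κ hκ1 hκ
    exact OPUC.integral_norm_packetSum_sub_sq_le hh hκ hκ1 (hM κ) hP he0 he
  have hnorm : ∀ κ, eLpNorm (fun z : Circle => OPUC.packetSum σ h f κ z -
      OPUC.szegoPi σ E z * ∑ j ∈ Finset.range κ, f j κ * (OPUC.bump h κ j z : ℂ)) 2 σ =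
      ENNReal.ofReal (Real.sqrt (∫ z, ‖OPUC.packetSum σ h f κ z -
        OPUC.szegoPi σ E z * ∑ j ∈ Finset.range κ, f j κ * (OPUC.bump h κ j z : ℂ)‖ ^ 2 ∂σ)) :=
    fun κ => by
      rw [(hmem κ).eLpNorm_eq_integral_rpow_norm two_ne_zero ENNReal.ofNat_ne_top,
        Real.sqrt_eq_rpow]
      simp
  simp_rw [hnorm]
  simpa using ENNReal.tendsto_ofReal hint.sqrt
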